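/- **Setting.** Let $(S,o)$ be a germ of smooth complex surface (formal coordinates identify its complete local ring with $\mathbb C[[x,y]]$), let $L=Z(x)$ be a smooth branch on it and let $C=Z(f)$ be a reduced curve singularity ($f$ square-free, $f(0)=0$) which does not contain $L$. A *cross* at a point is a pair of smooth transversal branches. *Toroidal pseudo-resolution.* Consider any complete execution of the following algorithm. (1) If $(L,C)$ is a cross, stop. (2) Otherwise choose a smooth branch $L'$, possibly contained in $C$, such that $(L,L')$ is a cross. (3) Perform the Newton modification of $C$ relative to $(L,L')$, i.e. the toric modification defined by the Newton fan of $C$ relative to $(L,L')$. (4) At each point where the strict transform of $C$ meets the exceptional divisor, restart at (1), with $L$ replaced by the germ of the exceptional divisor and $C$ by the germ of the strict transform. Let $(A_i,B_i)_{i\in I}$ be the crosses met during the execution, where $B_i$ is the branch chosen in (2), or is the germ of the strict transform of $C$ if the algorithm stops at that cross. The *completion* $\hat C_\pi$ is the union of the branches of $C$, of $L$ and of the images in $S$ of all the branches $B_i$. *Fan tree.* The *trunk* of $(A_i,B_i)$ is the segment $[e_{A_i},e_{B_i}]$ in the weight lattice of the cross; the slope $d/c$ of the weight vector $ce_{A_i}+de_{B_i}$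 is a homeomorphism from the trunk onto $[0,\infty]$. The fan tree $\theta_\pi(C)$ is the quotient of the disjoint union of the trunks obtained by gluing the origin $e_{A_i}$ of each trunk other than the first one to the point, on the preceding trunk, of the ray which corresponds to the exceptional component containing $A_i$. It is rooted at the origin of the first trunk, which is labelled by $L$; the end $e_{B_i}$ is labelled by the image of $B_i$ in $S$. The *slope function* $\mathrm{slp}_\pi:\theta_\pi(C)\to[0,\infty]$ is the slope of the trunk on each half-open trunk $(e_{A_i},e_{B_i}]$, and is $0$ at the root. *Eggers-Wall tree.* Let $\Theta_L(\hat C_\pi)$ be the Eggers-Wall tree of $\hat C_\pi$ relative to $L$: for each branch $B\ne L$ of $\hat C_\pi$ take a segment $[L,B]$ parametrized by its exponent $\mathbf e_L\in[0,\infty]$, and identify the points of two segments $[L,B]$, $[L,B']$ which have the same exponent not greater than the maximal order of the difference of a Newton-Puiseux root in $x$ of $B$ and one of $B'$. The index $\mathbf i_L$ is, at the point of $[L,B]$ of exponent $t$, the lowest common multiple of the denominators of the characteristic exponents of $B$ (the orders of the differences of pairs of distinct Newton-Puiseux roots of $B$) which are $<t$. The contact complexity is $\mathbf c_L(P)=\int_L^P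 \frac{1}{\mathbf i_L}\,d\mathbf e_L$. The index and the contact complexity do not depend on the segment used to compute them. *Identification.* There is an isomorphism of rooted trees $\Psi:\theta_\pi(C)\to\Theta_L(\hat C_\pi)$ preserving the labels of the ends, with the following parametrization on the trunks: the point of slope $s$ of the first trunk is sent to the point of $[L,B]$ with $\mathbf e_L=s$, where $B$ is the second branch of the first cross; and the part of the fan tree arising from a point $p$ of the exceptional component $E$ of weight $(c,d)$ of the first Newton modification is sent, recursively by the same rule, to the Eggers-Wall tree relative to $E$ at $p$, followed by the natural embedding into $\Theta_L(\hat C_\pi)$, which sends each branch to its image in $S$ and satisfies $\mathbf c_L=\frac{\mathbf c_E}{c^2}+\frac dc$. It is the unique isomorphism preserving the labels of the ends and having this parametrization, and every isomorphism preserving the labels of the ends coincides with it at the marked points (the ends and the origins of the trunks). We identify the two trees by $\Psi$. *Notation.* For $P\in\theta_\pi(C)$, let $\delta_P$ be the set of discontinuity points of the restriction of $\mathrm{slp}_\pi$ to $[L,P)$. For $\lambda\in\mathbb Q^*_+$, let $\mathrm{den}(\lambda)$ be its denominator in lowest terms. For a function $g\ge 0$ on the fan tree, $\int_L^P g\,d\,\mathrm{slp}_\pi$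 denotes the sum, over the trunks which the segment $[L,P]$ crosses, of the integral of $g$ with respect to the slope on the part of that trunk contained in $[L,P]$ (the jumps of $\mathrm{slp}_\pi$ from one trunk to the next do not contribute); it takes values in $[0,\infty]$. **Proposition.** For every $P\in\theta_\pi(C)$ the set $\delta_P$ is finite and $$\text{(i)}\quad \mathbf i_L(P)=\prod_{Q\in\delta_P}\mathrm{den}(\mathrm{slp}_\pi(Q)),\qquad \text{(ii)}\quad \mathbf e_L(P)=\int_L^P\frac{1}{\mathbf i_L}\,d\,\mathrm{slp}_\pi,\qquad \text{(iii)}\quad \mathbf c_L(P)=\int_L^P\frac{1}{\mathbf i_L^2}\,d\,\mathrm{slp}_\pi .$$ Explicitly, let $P_1\prec_L\dots\prec_L P_k=P$ be the points of $\delta_P\cup\{P\}$, let $s_j=\mathrm{slp}_\pi(P_j)$ for $1\le j\le k$ and $c_j=\mathrm{den}(s_j)$ for $1\le j<k$. Then $$\mathbf i_L(P)=c_1\cdots c_{k-1},\qquad \mathbf e_L(P)=\sum_{j=1}^{k}\frac{s_j}{c_1\cdots c_{j-1}},\qquad \mathbf c_L(P)=\sum_{j=1}^{k}\frac{s_j}{c_1^2\cdots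 c_{j-1}^2}.$$ In particular, if $s_j=d_j/c_j$ with coprime $c_j,d_j\in\mathbb N^*$ for all $j\le k$ (with $s_k = d_k=\infty$, $c_k=1$ if $P$ is an end of a trunk), then $\mathbf e_L(P)=\sum_j \frac{d_j}{c_1\cdots c_j}$ and $\mathbf c_L(P)=\sum_j\frac{d_j}{c_1^2\cdots c_{j-1}^2c_j}$. -/

import Mathlib

open scoped ENNReal

noncomputable section

namespace PlaneCurve

/-! ## The formal germ of smooth surface and substitutions

A formal coordinate system `(x, y)` identifies the complete local ring of a germ of smooth
surface with `ℂ⟦x, y⟧`; here `x = X 0`, `y = X 1`, and the reference smooth branch is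
`L = Z(x)`. -/

/-- The ring `ℂ⟦x, y⟧`. -/
abbrev PS : Type := MvPowerSeries (Fin 2) ℂ

/-- A series `φ ∈ ℂ⟦t⟧` with `φ(0) = 0`.  The smooth branches transversal to `Z(x)` are exactly
the `Z(y - φ(x))`, for a unique such `φ`. -/
abbrev Transversal : Type := {φ : PowerSeries ℂ // PowerSeries.constantCoeff φ = 0}

/-- The series `φ(x)`, seen in `ℂ⟦x, y⟧`. -/
def Transversal.inX (φ : Transversal) : PS := PowerSeries.subst (MvPowerSeries.X 0 : PS) φ.1

/-- A defining function `y - φ(x)` of the smooth branch given by `φ`. -/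
def Transversal.eqn (φ : Transversal) : PS := MvPowerSeries.X 1 - φ.inX

theorem Transversal.constantCoeff_inX (φ : Transversal) :
    MvPowerSeries.constantCoeff φ.inX = 0 :=
  PowerSeries.constantCoeff_subst_eq_zero (MvPowerSeries.constantCoeff_X _) _ φ.2

theorem hasSubst_shear (φ : Transversal) :
    MvPowerSeries.HasSubst (![MvPowerSeries.X 0, MvPowerSeries.X 1 + φ.inX] : Fin 2 → PS) := by
  refine MvPowerSeries.hasSubst_of_constantCoeff_zero fun i => ?_
  fin_cases i
  · simp
  · simp [φ.constantCoeff_inX]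

/-- The coordinate change `g(x, y) ↦ g(x, y + φ(x))`: it expresses `g` in the coordinates
`(x, y - φ(x))`, which define the cross `(Z(x), Z(y - φ(x)))`. -/
def shear (φ : Transversal) : PS →ₐ[ℂ] PS := MvPowerSeries.substAlgHom (hasSubst_shear φ)

/-- A primitive vector `c e₁ + d e₂` in the interior of the cone `σ₀`. -/
structure Weight where
  c : ℕ
  d : ℕ
  c_pos : 0 < c
  d_pos : 0 < d
  coprime : Nat.Coprime c d

/-- The slope `d / c` of the ray generated by `c e₁ + d e₂`. -/
def Weight.slope (w : Weight) : ℝ≥0∞ := (w.d : ℝ≥0∞) / (w.c : ℝ≥0∞)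

theorem Weight.slope_ne_zero (w : Weight) : w.slope ≠ 0 := by
  have h : (w.d : ℝ≥0∞) ≠ 0 := by exact_mod_cast w.d_pos.ne'
  exact ENNReal.div_ne_zero.2 ⟨h, ENNReal.natCast_ne_top _⟩

theorem hasSubst_newtonMap (w : Weight) (a : ℂ) :
    MvPowerSeries.HasSubst (![MvPowerSeries.X 0 ^ w.c,
      MvPowerSeries.X 0 ^ w.d * (MvPowerSeries.C a + MvPowerSeries.X 1)] : Fin 2 → PS) := by
  refine MvPowerSeries.hasSubst_of_constantCoeff_zero fun i => ?_
  fin_cases i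
  · simp [w.c_pos.ne']
  · simp [w.d_pos.ne']

/-- Let `ρ` be the ray of `w = (c, d)`, let `O_ρ` be the corresponding torus orbit of the toric
modification of the plane, with coordinate `v = x ^ (-d) y ^ c`, and let `E_ρ` be its closure.
In suitable formal coordinates `(x₁, y₁)` centred at the point `v = a ^ c` of `O_ρ`, with
`E_ρ = Z(x₁)`, the modification is `x = x₁ ^ c`, `y = x₁ ^ d (a + y₁)`.  This is its pull back
`ℂ⟦x, y⟧ → ℂ⟦x₁, y₁⟧`. The relation with the toric charts is `toricChart_eq` below. -/
def newtonMap (w : Weight) (a : ℂ) : PS →ₐ[ℂ] PS :=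
  MvPowerSeries.substAlgHom (hasSubst_newtonMap w a)

/-- A regular subcone `⟨(c, d), (c', d')⟩` of `σ₀`, with `d' c - c' d = 1`, gives the toric chart
`x = u ^ c v ^ c'`, `y = u ^ d v ^ d'`, in which the orbit is `u = 0`, `v ≠ 0`. With
`t = a + y₁` (a unit as `a ≠ 0`), the coordinates `x₁, y₁` used in `newtonMap` are related to the
chart by `u = x₁ t ^ (-c')`, `v = t ^ c`. -/
theorem toricChart_eq {A : Type*} [CommRing A] (c d c' d' : ℕ) (h : d' * c = c' * d + 1)
    (x₁ : A) (t : Aˣ) :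
    (x₁ * (↑(t⁻¹ ^ c') : A)) ^ c * ((t : A) ^ c) ^ c' = x₁ ^ c ∧
    (x₁ * (↑(t⁻¹ ^ c') : A)) ^ d * ((t : A) ^ c) ^ d' = x₁ ^ d * (t : A) := by
  have h1 : (t⁻¹ ^ c') ^ c * (t ^ c) ^ c' = 1 := by
    rw [← pow_mul, ← pow_mul, inv_pow, mul_comm c c', inv_mul_cancel]
  have h2 : (t⁻¹ ^ c') ^ d * (t ^ c) ^ d' = t := by
    rw [← pow_mul, ← pow_mul, inv_pow, mul_comm c d', h, pow_succ, inv_mul_cancel_left]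
  constructor
  · rw [mul_pow, mul_assoc]
    have := congrArg (Units.val) h1
    push_cast at this ⊢
    rw [this, mul_one]
  · rw [mul_pow, mul_assoc]
    have := congrArg (Units.val) h2
    push_cast at this ⊢
    rw [this]

/-! ## Newton fan, strict transform -/

/-- The tropicalization of `f` at the vector `w`. -/
def trop (f : PS) (w : Weight) : ℕ :=
  sInf {n | ∃ e : Fin 2 →₀ ℕ, MvPowerSeries.coeff e f ≠ 0 ∧ n = w.c * e 0 + w.d * e 1}

/-- `w` generates a ray of the Newton fan of `f` lying in the interior of `σ₀`: the face of the
Newton polygon on which `w` is minimal is an edge, that is, it contains at least two points of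
the support of `f`. -/
def IsNewtonRay (f : PS) (w : Weight) : Prop :=
  ∃ e e' : Fin 2 →₀ ℕ, e ≠ e' ∧ MvPowerSeries.coeff e f ≠ 0 ∧ MvPowerSeries.coeff e' f ≠ 0 ∧
    w.c * e 0 + w.d * e 1 = trop f w ∧ w.c * e' 0 + w.d * e' 1 = trop f w

/-- The strict transform of `Z(f)` at the point `v = a ^ c` of the orbit of `w`, in the
coordinates of `newtonMap`: the pull back of `f` divided by the power `x₁ ^ trop f w` of the
equation `x₁` of the exceptional divisor. -/
def strictTransform (f : PS) (w : Weight) (a : ℂ) : PS :=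
  fun e => MvPowerSeries.coeff (e + Finsupp.single 0 (trop f w)) (newtonMap w a f)

/-- A point of intersection of the strict transform of `Z(f)` with the exceptional divisor of the
Newton modification defined by `f` relative to the cross `(Z(x), Z(y))`: a ray `w` of the Newton
fan and a point of the corresponding orbit, of coordinate `v ≠ 0`, lying on the strict
transform. -/
structure Point (f : PS) where
  w : Weight
  v : ℂ
  isRay : IsNewtonRay f w
  v_ne_zero : v ≠ 0
  mem : ∃ a : ℂ, a ^ w.c = v ∧ MvPowerSeries.constantCoeff (strictTransform f w a) = 0

/-- `(Z(x), Z(f))` is a cross: `Z(f)` is a smooth branch transversal to `Z(x)`. -/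
def IsCross (f : PS) : Prop :=
  MvPowerSeries.constantCoeff f = 0 ∧ MvPowerSeries.coeff (Finsupp.single 1 1) f ≠ 0

/-! ## The toroidal pseudo-resolution algorithm -/

attribute [local irreducible] shear strictTransform
/-- A (complete) execution of the toroidal pseudo-resolution algorithm on the germ `Z(f)` with
smooth branch `Z(x)`: either `(Z(x), Z(f))` is a cross and one stops, or one chooses a smooth
branch `Z(y - φ(x))` transversal to `Z(x)`, performs the Newton modification defined by `Z(f)`
relative to the cross `(Z(x), Z(y - φ(x)))`, and goes on with the strict transform of `Z(f)` and
the exceptional divisor at each of their points of intersection. The number `root p`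
only fixes the formal coordinates used at the point `p`. -/
inductive Run : PS → Type
  | finish {f : PS} (h : IsCross f) : Run f
  | step {f : PS} (h : ¬ IsCross f) (φ : Transversal)
      (root : Point (shear φ f) → ℂ) (root_pow : ∀ p, root p ^ p.w.c = p.v)
      (next : ∀ p : Point (shear φ f), Run (strictTransform (shear φ f) p.w (root p))) : Run f

/-- The crosses `(A_i, B_i)` met during the execution: the first one, or one of those met during
the execution which goes on at the point `p`. -/
inductive Node : {f : PS} → Run f → Type
  | top {f : PS} {r : Run f} : Node r
  | sub {f : PS} {h : ¬ IsCross f} {φ : Transversal} {root : Point (shear φ f) → ℂ}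
      {root_pow : ∀ p, root p ^ p.w.c = p.v}
      {next : ∀ p : Point (shear φ f), Run (strictTransform (shear φ f) p.w (root p))}
      (p : Point (shear φ f)) (i : Node (next p)) : Node (Run.step h φ root root_pow next)

/-- The pull back of functions to the point `p` of a Newton modification, composed with the change
of coordinates adapted to the cross `(Z(x), Z(y - φ(x)))`. -/
def pullback (φ : Transversal) (w : Weight) (a : ℂ) : PS →ₐ[ℂ] PS :=
  (newtonMap w a).comp (shear φ)

/-- The image on the initial germ of surface of the branch `B_i` of the cross `(A_i, B_i)`, as a
prime ideal of `ℂ⟦x, y⟧`. Here `B_i` is the germ of the strict transform of the curve if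
the algorithm stops at that cross, and is the chosen transversal branch otherwise. The image of a
branch is the zero locus of the functions whose pull back vanishes on that branch. -/
def label : {f : PS} → {r : Run f} → Node r → Ideal PS
  | f, .finish _, .top => Ideal.span {f}
  | _, .step _ φ _ _ _, .top => Ideal.span {φ.eqn}
  | _, _, .sub (φ := φ) (root := root) p i => (label i).comap (pullback φ p.w (root p))

/-- The algorithm does not stop at the cross `i`. -/
def IsStep : {f : PS} → {r : Run f} → Node r → Prop
  | _, .finish _, .top => False
  | _, .step _ _ _ _ _, .top => True
  | _, _, .sub _ i => IsStep i

/-- The branches, distinct from `L = Z(x)`, of the completion of the curve `Z(f)` relative to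
the execution `r`: the irreducible components of `Z(f)`, and the images of the transversal branches
chosen during the execution. -/
def completion {f : PS} (r : Run f) : Set (Ideal PS) :=
  (Ideal.span {f}).minimalPrimes ∪ {P | ∃ i : Node r, IsStep i ∧ label i = P}

/-! ## The fan tree -/

/-- The trunk of a cross is identified with `[0, ∞]` by its slope function, which is a
homeomorphism. The origin of the trunk of a cross created at a point of the exceptional
component of weight `w` is identified with the point of slope `w.slope` of the trunk which
contains the ray of `w`. -/
inductive Glue : {f : PS} → {r : Run f} → Node r → ℝ≥0∞ → Node r → ℝ≥0∞ → Prop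
  | attach {f : PS} {h : ¬ IsCross f} {φ : Transversal} {root : Point (shear φ f) → ℂ}
      {root_pow : ∀ p, root p ^ p.w.c = p.v}
      {next : ∀ p : Point (shear φ f), Run (strictTransform (shear φ f) p.w (root p))}
      (p : Point (shear φ f)) :
      Glue (Node.sub (h := h) (root_pow := root_pow) p (Node.top (r := next p))) 0
        Node.top p.w.slope
  | sub {f : PS} {h : ¬ IsCross f} {φ : Transversal} {root : Point (shear φ f) → ℂ}
      {root_pow : ∀ p, root p ^ p.w.c = p.v}
      {next : ∀ p : Point (shear φ f), Run (strictTransform (shear φ f) p.w (root p))}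
      (p : Point (shear φ f)) {i j : Node (next p)} {s t : ℝ≥0∞} (hg : Glue i s j t) :
      Glue (Node.sub (h := h) (root_pow := root_pow) p i) s (Node.sub p j) t

/-- The fan tree: the disjoint union of the trunks, glued as above. -/
def FanTree {f : PS} (r : Run f) : Type :=
  Quot fun a b : (_ : Node r) × ℝ≥0∞ => Glue a.1 a.2 b.1 b.2

/-- The quotient topology. -/
instance {f : PS} (r : Run f) : TopologicalSpace (FanTree r) :=
  inferInstanceAs (TopologicalSpace (Quot fun a b : (_ : Node r) × ℝ≥0∞ =>
    Glue a.1 a.2 b.1 b.2))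

/-- The point of slope `s` of the trunk of the cross `i`. -/
def FanTree.pt {f : PS} {r : Run f} (i : Node r) (s : ℝ≥0∞) : FanTree r := Quot.mk _ ⟨i, s⟩

/-- The cross `i` is the first one. -/
def Node.isTop : {f : PS} → {r : Run f} → Node r → Prop
  | _, _, .top => True
  | _, _, .sub _ _ => False

open Classical in
/-- The slope, in the preceding trunk, of the point at which the trunk `i` is attached; it is
`0` for the first trunk. -/
def attachSlope : {f : PS} → {r : Run f} → Node r → ℝ≥0∞
  | _, _, .top => 0
  | _, _, .sub p i => if i.isTop then p.w.slope else attachSlope i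

theorem Glue.spec {f : PS} {r : Run f} {i j : Node r} {s t : ℝ≥0∞} (h : Glue i s j t) :
    ¬ i.isTop ∧ s = 0 ∧ t ≠ 0 ∧ attachSlope i = t := by
  induction h with
  | attach p => exact ⟨by simp [Node.isTop], rfl, p.w.slope_ne_zero, by simp [attachSlope, Node.isTop]⟩
  | sub p hg ih => exact ⟨by simp [Node.isTop], ih.2.1, ih.2.2.1, by simp [attachSlope, ih.1, ih.2.2.2]⟩

open Classical in
/-- The slope function of the fan tree. On the trunk of a cross `i` deprived of its origin, it is
the slope function of the trunk; it vanishes at the root, which is the origin of the first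
trunk. The origin of any other trunk is a point of positive slope of the preceding trunk. -/
def FanTree.slp {f : PS} {r : Run f} : FanTree r → ℝ≥0∞ :=
  Quot.lift (fun a => if a.2 = 0 then attachSlope a.1 else a.2) fun a b h => by
    obtain ⟨-, h1, h2, h3⟩ := Glue.spec h
    simp [h1, h2, h3]

/-- The root of the fan tree, labelled by `L`. -/
def FanTree.root {f : PS} (r : Run f) : FanTree r := FanTree.pt Node.top 0

/-- The order of the points of the fan tree defined by its root: `P ≼ Q` if and only if the
segment `[L, P]` is contained in `[L, Q]`, that is, if and only if one can go from `P` to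
`Q` by moving along trunks in the direction of increasing slopes. -/
def FanTree.le {f : PS} {r : Run f} : FanTree r → FanTree r → Prop :=
  Relation.ReflTransGen fun P Q =>
    ∃ (i : Node r) (s t : ℝ≥0∞), s ≤ t ∧ P = FanTree.pt i s ∧ Q = FanTree.pt i t

/-- The half-open segment `[L, P)` of the fan tree. -/
def FanTree.segment {f : PS} {r : Run f} (P : FanTree r) : Set (FanTree r) :=
  {Q | FanTree.le Q P ∧ Q ≠ P}

/-- The set `δ_P` of points of discontinuity of the restriction of the slope function to
`[L, P)`. -/
def FanTree.delta {f : PS} {r : Run f} (P : FanTree r) : Set (FanTree r) :=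
  {Q | Q ∈ P.segment ∧ ¬ ContinuousWithinAt FanTree.slp P.segment Q}

/-- The integral `∫_L^P g d slp`: the sum, over the trunks, of the integral of `g` with respect to
the slope (a homeomorphism on each trunk) on the part of the trunk contained in the segment
`[L, P]`. The jumps of the slope function from one trunk to another do not contribute. -/
def FanTree.integral {f : PS} {r : Run f} (g : FanTree r → ℝ≥0∞) (P : FanTree r) : ℝ≥0∞ :=
  ∑' i : Node r, ∫⁻ s in {s : ℝ | 0 < s ∧ FanTree.le (FanTree.pt i (ENNReal.ofReal s)) P},
    g (FanTree.pt i (ENNReal.ofReal s))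

/-- The marked points of the fan tree: the ends and the origins of the trunks. (Each ray of
a Newton fan lying inside `σ₀` meets its trunk at the origin of at least one further trunk.) -/
def FanTree.IsMarked {f : PS} {r : Run f} (P : FanTree r) : Prop :=
  ∃ i : Node r, P = FanTree.pt i 0 ∨ P = FanTree.pt i ⊤

/-- The denominator `q` of `λ = p / q`, with `p, q` coprime: the least positive integer `q` such
that `q λ` is an integer. -/
def den (l : ℝ≥0∞) : ℕ := sInf {q : ℕ | 0 < q ∧ ∃ p : ℕ, l = (p : ℝ≥0∞) / (q : ℝ≥0∞)}

/-! ## Newton-Puiseux series and Eggers-Wall trees -/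

/-- The exponents `k ↦ k / n`. -/
def divEmb (n : ℕ+) : ℕ ↪o ℚ :=
  OrderEmbedding.ofStrictMono (fun k => (k : ℚ) / (n : ℚ)) fun a b h => by
    have hn : (0 : ℚ) < (n : ℚ) := by exact_mod_cast n.pos
    have hab : (a : ℚ) < (b : ℚ) := by exact_mod_cast h
    exact div_lt_div_of_pos_right hab hn

/-- The Newton-Puiseux series `ζ(x ^ (1 / n))`, as a series with rational exponents. -/
def puiseux (n : ℕ+) (ζ : PowerSeries ℂ) : HahnSeries ℚ ℂ :=
  HahnSeries.embDomain (divEmb n) (HahnSeries.toPowerSeries.symm ζ)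

/-- The series `g(t ^ n, ζ(t))`. -/
def evalAt (n : ℕ+) (ζ : PowerSeries ℂ) (g : PS) : PowerSeries ℂ :=
  MvPowerSeries.subst (![PowerSeries.X ^ (n : ℕ), ζ] : Fin 2 → MvPowerSeries Unit ℂ) g

/-- The set of Newton-Puiseux roots relative to `x` of the curve defined by the ideal `P`: the
Newton-Puiseux series `η(x)` of positive order such that `g(x, η(x)) = 0` for all `g ∈ P`. -/
def roots (P : Ideal PS) : Set (HahnSeries ℚ ℂ) :=
  {η | ∃ (n : ℕ+) (ζ : PowerSeries ℂ), PowerSeries.constantCoeff ζ = 0 ∧ η = puiseux n ζ ∧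
    ∀ g ∈ P, evalAt n ζ g = 0}

open Classical in
/-- The order in `x` of a series (`∞` for the zero series). -/
def ordX (η : HahnSeries ℚ ℂ) : ℝ≥0∞ := if η = 0 then ⊤ else ENNReal.ofReal (η.order : ℝ)

/-- The order of coincidence of two branches: the maximal order of the difference of a root of the
first one and a root of the second one. -/
def coincidence (P Q : Ideal PS) : ℝ≥0∞ := ⨆ ξ ∈ roots P, ⨆ η ∈ roots Q, ordX (ξ - η)

/-- The characteristic exponents of a branch relative to `x`. -/
def charExponents (P : Ideal PS) : Set ℚ :=
  {q | ∃ ξ ∈ roots P, ∃ η ∈ roots P, ξ ≠ η ∧ q = (ξ - η).order}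

/-- The index function on the segment `[0, ∞]` of a branch: at the point of exponent `t`, the
lowest common multiple of the denominators of the characteristic exponents `< t`. -/
def branchIndex (P : Ideal PS) (t : ℝ≥0∞) : ℕ :=
  sInf {n : ℕ | 0 < n ∧ ∀ q ∈ charExponents P, ENNReal.ofReal (q : ℝ) < t → q.den ∣ n}

/-- The contact complexity on the segment of a branch, at the point of exponent `t`: the integral
of `1 / index` with respect to the exponent, from `0` to `t`. -/
def branchContact (P : Ideal PS) (t : ℝ≥0∞) : ℝ≥0∞ :=
  ∫⁻ s in {s : ℝ | 0 < s ∧ ENNReal.ofReal s ≤ t}, (branchIndex P (ENNReal.ofReal s) : ℝ≥0∞)⁻¹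

/-- The Eggers-Wall tree, relative to `L = Z(x)`, of the reduced curve whose branches distinct from
`L` are the elements of `𝓑`. The segment of each branch is parametrized by `[0, ∞]`
through its exponent function, and one identifies the points of the segments of two branches which
have equal exponents not greater than the order of coincidence. -/
def EWTree (𝓑 : Set (Ideal PS)) : Type :=
  Quot fun a b : (_ : 𝓑) × ℝ≥0∞ => a.2 = b.2 ∧ a.2 ≤ coincidence a.1.1 b.1.1

/-- The point of exponent `t` of the segment of the branch `B`. It is labelled by `B` if
`t = ∞`, and is the root (labelled by `L`) if `t = 0`. -/
def EWTree.mk {𝓑 : Set (Ideal PS)} (B : 𝓑) (t : ℝ≥0∞) : EWTree 𝓑 := Quot.mk _ ⟨B, t⟩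

/-- The exponent function. -/
def EWTree.exponent {𝓑 : Set (Ideal PS)} : EWTree 𝓑 → ℝ≥0∞ :=
  Quot.lift (fun a => a.2) fun _ _ h => h.1

/-- The index function, glued from the index functions of the branches. -/
def EWTree.index {𝓑 : Set (Ideal PS)} (Q : EWTree 𝓑) : ℕ :=
  branchIndex (Quot.out Q).1.1 (Quot.out Q).2

/-- The contact complexity function: the integral of `1 / index` with respect to the exponent along
the segment from the root. -/
def EWTree.contact {𝓑 : Set (Ideal PS)} (Q : EWTree 𝓑) : ℝ≥0∞ :=
  branchContact (Quot.out Q).1.1 (Quot.out Q).2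

/-- The order of the points of the Eggers-Wall tree defined by its root. -/
def EWTree.le {𝓑 : Set (Ideal PS)} (P Q : EWTree 𝓑) : Prop :=
  ∃ (B : 𝓑) (s t : ℝ≥0∞), s ≤ t ∧ P = EWTree.mk B s ∧ Q = EWTree.mk B t

/-! ## The identification of the fan tree with the Eggers-Wall tree -/

/-- `Ψ` is an isomorphism of rooted trees (a bijection compatible with the orders defined
by the roots) from the fan tree to the Eggers-Wall tree of the completion, which preserves the
labels of the ends: the root goes to the root, and the end of the trunk of a cross `(A_i, B_i)`
goes to the end labelled by the image of `B_i`. -/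
structure IsLabelledIso {f : PS} {r : Run f} (Ψ : FanTree r → EWTree (completion r)) : Prop where
  bijective : Function.Bijective Ψ
  le_iff : ∀ P Q, FanTree.le P Q ↔ EWTree.le (Ψ P) (Ψ Q)
  map_root : EWTree.exponent (Ψ (FanTree.root r)) = 0
  map_end : ∀ i : Node r, ∃ h : label i ∈ completion r,
    Ψ (FanTree.pt i ⊤) = EWTree.mk ⟨label i, h⟩ ⊤

/-- The parametrization of the identification on the trunks. On the first trunk, `Ψ` sends the
point of slope `s` to the point of exponent `s` of the segment of the branch `B` of the first cross
`(Z(x), B)`. The subtree above the first trunk arising from a point `p` of weight `(c, d)` of the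
exceptional divisor `E` is sent first, in the same way, to the Eggers-Wall tree relative to
`E` at that point, and then to the initial Eggers-Wall tree by the natural embedding, which is
given on the segment of a branch `B` by `c_L = c_E / c ^ 2 + d / c`, with values in the segment of
the image of `B`. -/
def IsCanonical : {f : PS} → (r : Run f) → (FanTree r → EWTree (completion r)) → Prop
  | _, .finish h, Ψ =>
      ∀ s : ℝ≥0∞, ∃ hB : label (Node.top (r := Run.finish h)) ∈ completion (Run.finish h),
        Ψ (FanTree.pt Node.top s) = EWTree.mk ⟨_, hB⟩ s
  | _, .step h φ root root_pow next, Ψ =>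
      (∀ s : ℝ≥0∞, ∃ hB : label (Node.top (r := Run.step h φ root root_pow next)) ∈
          completion (Run.step h φ root root_pow next),
        Ψ (FanTree.pt Node.top s) = EWTree.mk ⟨_, hB⟩ s) ∧
      ∀ p : Point (shear φ _), ∃ Ψp : FanTree (next p) → EWTree (completion (next p)),
        IsCanonical (next p) Ψp ∧
        ∀ (i : Node (next p)) (s : ℝ≥0∞) (B : completion (next p)) (t : ℝ≥0∞),
          Ψp (FanTree.pt i s) = EWTree.mk B t →
          ∃ (hB : B.1.comap (pullback φ p.w (root p)) ∈
              completion (Run.step h φ root root_pow next)) (t' : ℝ≥0∞),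
            Ψ (FanTree.pt (Node.sub p i) s) = EWTree.mk ⟨_, hB⟩ t' ∧
            branchContact (B.1.comap (pullback φ p.w (root p))) t' =
              branchContact B.1 t / (p.w.c : ℝ≥0∞) ^ 2 + p.w.slope

end PlaneCurve

end

open PlaneCurve

/-!
The proof compares both trees with a third description, by recursion on the execution of the
algorithm, of the segment which joins the root to the end labelled by the branch `label i` of a
cross `i`.

*Branches.* Every branch distinct from `Z(x)` is parametrized by an arc `x = t ^ n`, `y = ζ(t)`,
and its ideal is the kernel `arcIdeal n ζ` of the pull back to this arc. The Newton-Puiseux theorem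
(`exists_arc`, obtained by a Tschirnhaus transformation followed by a Newton modification which
makes the order in `y` drop) and a norm argument (`exists_arcIdeal_le`) show that the components of
`Z(f)` are the branches of the arcs contained in `Z(f)`. Such an arc can be lifted along the
execution until it becomes one of the branches `B_i` (`exists_label_eq`). Hence the branches of the
completion are exactly the images of the branches `B_i` (`completion_eq`).

*Effect of a Newton modification.* The image of the arc `(t ^ n, ζ(t))` at a point of the
exceptional component of weight `(c, d)` is
`(t ^ (n c), φ(t ^ (n c)) + t ^ (n d) (a + ζ(t)))`. Comparing conjugates, orders of coincidence are
transformed by `e ↦ e / c + d / c` for two branches through the same point, and are equal to the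
minimum of the slopes otherwise (`coincidence_comap`, `coincidence_comap_of_ne`,
`coincidence_comap_top`); the characteristic exponents undergo the same affine transformation, with
the new exponent `d / c` if `c > 1` (`charExponents_comap`). So, above the exponent `d / c`, the
index is multiplied by `c`, and the contact complexity is divided by `c ^ 2` and increased by
`d / c` (`branchIndex_comap`, `branchContact_comap`).

*Trees.* By these formulas, index and contact complexity at the point of exponent `e` of the segment
of `label i` only depend on the list `Node.slopes` of the slopes of the points at which the segment
leaves a trunk, and this list only depends on `e` and on the branch up to the order of coincidence
(`Node.slopes_eq_of_le_coincidence`). The point of exponent `e` of the corresponding segment of the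
fan tree is `Node.point`; it satisfies the same compatibility, and gives the inverse of the
identification `FanTree.toEW`. The slope function is the continuous function `Node.slopeAt` of the
exponent away from the points at which the segment leaves a trunk; there it jumps to `0`
(`Node.delta_point`). Finally the integrals along the segment (`Node.integral_point`) satisfy
the same recursion `s₁ + (next terms) / c₁ ^ k` as the sums over the list of slopes, with `k = 1`
for the exponent and `k = 2` for the contact complexity.
-/

open scoped ENNReal

noncomputable section

namespace PlaneCurve

/-! ### Substitutions -/

section Substitution

variable {τ υ : Type*}

theorem hasSubst_pair {A B : MvPowerSeries τ ℂ} (hA : MvPowerSeries.constantCoeff A = 0)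
    (hB : MvPowerSeries.constantCoeff B = 0) :
    MvPowerSeries.HasSubst (![A, B] : Fin 2 → MvPowerSeries τ ℂ) := by
  refine MvPowerSeries.hasSubst_of_constantCoeff_zero fun i => ?_
  fin_cases i
  · exact hA
  · exact hB

/-- The substitution `g(x, y) ↦ g(A, B)`. -/
def pairHom (A B : MvPowerSeries τ ℂ) (hA : MvPowerSeries.constantCoeff A = 0)
    (hB : MvPowerSeries.constantCoeff B = 0) : PS →ₐ[ℂ] MvPowerSeries τ ℂ :=
  MvPowerSeries.substAlgHom (hasSubst_pair hA hB)

variable {A B : MvPowerSeries τ ℂ} (hA : MvPowerSeries.constantCoeff A = 0)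
    (hB : MvPowerSeries.constantCoeff B = 0)

theorem pairHom_apply (g : PS) : pairHom A B hA hB g = MvPowerSeries.subst ![A, B] g := by
  rw [pairHom, MvPowerSeries.coe_substAlgHom]

@[simp] theorem pairHom_X0 : pairHom A B hA hB (MvPowerSeries.X 0) = A := by
  rw [pairHom, MvPowerSeries.substAlgHom_X]; rfl

@[simp] theorem pairHom_X1 : pairHom A B hA hB (MvPowerSeries.X 1) = B := by
  rw [pairHom, MvPowerSeries.substAlgHom_X]; rfl

@[simp] theorem pairHom_C (a : ℂ) : pairHom A B hA hB (MvPowerSeries.C a) = MvPowerSeries.C a :=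
  (pairHom A B hA hB).commutes a

theorem constantCoeff_pairHom (g : PS) : MvPowerSeries.constantCoeff (pairHom A B hA hB g) =
    MvPowerSeries.constantCoeff g := by
  have h : MvPowerSeries.constantCoeff
      (pairHom A B hA hB (g - MvPowerSeries.C (MvPowerSeries.constantCoeff g))) = 0 := by
    rw [pairHom_apply]
    refine MvPowerSeries.constantCoeff_subst_eq_zero (hasSubst_pair hA hB) (fun i => ?_) (by simp)
    fin_cases i
    · exact hA
    · exact hB
  rw [map_sub, pairHom_C, map_sub, sub_eq_zero] at h
  simpa using h

theorem pairHom_congr {A' B' : MvPowerSeries τ ℂ} (hA' : MvPowerSeries.constantCoeff A' = 0)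
    (hB' : MvPowerSeries.constantCoeff B' = 0) (h : A = A') (h' : B = B') :
    pairHom A B hA hB = pairHom A' B' hA' hB' := by
  subst h; subst h'; rfl

theorem pairHom_comp_pairHom {C D : MvPowerSeries (Fin 2) ℂ}
    (hC : MvPowerSeries.constantCoeff C = 0) (hD : MvPowerSeries.constantCoeff D = 0) (g : PS) :
    pairHom A B hA hB (pairHom C D hC hD g) =
      pairHom (pairHom A B hA hB C) (pairHom A B hA hB D)
        (by rw [constantCoeff_pairHom, hC]) (by rw [constantCoeff_pairHom, hD]) g := by
  simp only [pairHom_apply]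
  rw [MvPowerSeries.subst_comp_subst_apply (hasSubst_pair hC hD) (hasSubst_pair hA hB)]
  congr 1
  funext i
  fin_cases i <;> rfl

theorem pairHom_eq_id (g : PS) (h0 : MvPowerSeries.constantCoeff (MvPowerSeries.X 0 : PS) = 0)
    (h1 : MvPowerSeries.constantCoeff (MvPowerSeries.X 1 : PS) = 0) :
    pairHom (MvPowerSeries.X 0) (MvPowerSeries.X 1) h0 h1 g = g := by
  rw [pairHom_apply]
  have : (![MvPowerSeries.X 0, MvPowerSeries.X 1] : Fin 2 → PS) = MvPowerSeries.X := by
    funext i; fin_cases i <;> rfl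
  rw [this, MvPowerSeries.subst_self, id]

theorem subst_pair_uni [Finite υ] {C : MvPowerSeries υ ℂ} (hC : MvPowerSeries.constantCoeff C = 0)
    {A B : PowerSeries ℂ} (hA : MvPowerSeries.constantCoeff A = 0)
    (hB : MvPowerSeries.constantCoeff B = 0) (g : PS)
    (h1 : MvPowerSeries.constantCoeff (PowerSeries.subst C A) = 0)
    (h2 : MvPowerSeries.constantCoeff (PowerSeries.subst C B) = 0) :
    PowerSeries.subst C (pairHom A B hA hB g) =
      pairHom (PowerSeries.subst C A) (PowerSeries.subst C B) h1 h2 g := by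
  simp only [pairHom_apply]
  rw [PowerSeries.subst, MvPowerSeries.subst_comp_subst_apply (hasSubst_pair hA hB)
    (PowerSeries.HasSubst.const (PowerSeries.HasSubst.of_constantCoeff_zero hC))]
  congr 1
  funext i
  fin_cases i <;> rfl

theorem pairHom_subst {C : PS} (hC : MvPowerSeries.constantCoeff C = 0) (φ : PowerSeries ℂ) :
    pairHom A B hA hB (PowerSeries.subst C φ) = PowerSeries.subst (pairHom A B hA hB C) φ := by
  simp only [pairHom_apply]
  rw [PowerSeries.subst, MvPowerSeries.subst_comp_subst_apply
    (PowerSeries.HasSubst.const (PowerSeries.HasSubst.of_constantCoeff_zero hC))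
    (hasSubst_pair hA hB)]
  rfl

theorem pairHom_inX (φ : Transversal) : pairHom A B hA hB φ.inX = PowerSeries.subst A φ.1 := by
  rw [Transversal.inX, pairHom_subst _ _ (MvPowerSeries.constantCoeff_X _), pairHom_X0]

end Substitution

theorem constantCoeff_newton_fst (w : Weight) :
    MvPowerSeries.constantCoeff (MvPowerSeries.X 0 ^ w.c : PS) = 0 := by
  simp [w.c_pos.ne']

theorem constantCoeff_newton_snd (w : Weight) (a : ℂ) :
    MvPowerSeries.constantCoeff
      (MvPowerSeries.X 0 ^ w.d * (MvPowerSeries.C a + MvPowerSeries.X 1) : PS) = 0 := by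
  simp [w.d_pos.ne']

theorem constantCoeff_shear_snd (φ : Transversal) :
    MvPowerSeries.constantCoeff (MvPowerSeries.X 1 + φ.inX : PS) = 0 := by
  simp [φ.constantCoeff_inX]

theorem shear_eq (φ : Transversal) : shear φ = pairHom (MvPowerSeries.X 0)
    (MvPowerSeries.X 1 + φ.inX) (MvPowerSeries.constantCoeff_X _) (constantCoeff_shear_snd φ) := rfl

theorem newtonMap_eq (w : Weight) (a : ℂ) : newtonMap w a = pairHom (MvPowerSeries.X 0 ^ w.c)
    (MvPowerSeries.X 0 ^ w.d * (MvPowerSeries.C a + MvPowerSeries.X 1))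
    (constantCoeff_newton_fst w) (constantCoeff_newton_snd w a) := rfl

/-! ### Arcs -/

/-- The first coordinate of a weight, as a positive integer. -/
def Weight.cP (w : Weight) : ℕ+ := ⟨w.c, w.c_pos⟩

/-- The second coordinate of a weight, as a positive integer. -/
def Weight.dP (w : Weight) : ℕ+ := ⟨w.d, w.d_pos⟩

@[simp] theorem Weight.coe_cP (w : Weight) : (w.cP : ℕ) = w.c := rfl
@[simp] theorem Weight.coe_dP (w : Weight) : (w.dP : ℕ) = w.d := rfl

theorem constantCoeff_X_pow_pnat (n : ℕ+) :
    MvPowerSeries.constantCoeff (PowerSeries.X ^ (n : ℕ) : PowerSeries ℂ) = 0 := by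
  have : PowerSeries.constantCoeff (PowerSeries.X ^ (n : ℕ) : PowerSeries ℂ) = 0 := by simp
  exact this

theorem Transversal.constantCoeff_mv (ζ : Transversal) :
    MvPowerSeries.constantCoeff (ζ.1 : PowerSeries ℂ) = 0 := ζ.2

/-- The pull back of functions to the arc `x = t ^ n`, `y = ζ(t)`. -/
def arcHom (n : ℕ+) (ζ : Transversal) : PS →ₐ[ℂ] PowerSeries ℂ :=
  pairHom (PowerSeries.X ^ (n : ℕ)) ζ.1 (constantCoeff_X_pow_pnat n) ζ.constantCoeff_mv

theorem evalAt_eq (n : ℕ+) (ζ : Transversal) (g : PS) : evalAt n ζ.1 g = arcHom n ζ g := by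
  rw [arcHom, pairHom_apply]; rfl

/-- The ideal of the functions which vanish on the arc `x = t ^ n`, `y = ζ(t)`. -/
def arcIdeal (n : ℕ+) (ζ : Transversal) : Ideal PS := RingHom.ker (arcHom n ζ)

theorem mem_arcIdeal {n : ℕ+} {ζ : Transversal} {g : PS} :
    g ∈ arcIdeal n ζ ↔ arcHom n ζ g = 0 := RingHom.mem_ker

instance (n : ℕ+) (ζ : Transversal) : (arcIdeal n ζ).IsPrime := RingHom.ker_isPrime _

namespace Transversal

/-- The series `ζ(t ^ m)`. -/
def expand (m : ℕ+) (ζ : Transversal) : Transversal :=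
  ⟨PowerSeries.expand m m.ne_zero ζ.1, by rw [PowerSeries.constantCoeff_expand, ζ.2]⟩

/-- The series `ζ(ω t)`. -/
def rot (ω : ℂ) (ζ : Transversal) : Transversal :=
  ⟨PowerSeries.rescale ω ζ.1, by
    rw [← PowerSeries.coeff_zero_eq_constantCoeff_apply, PowerSeries.coeff_rescale]
    simp [ζ.2]⟩

/-- The arc `t ^ k (a + ζ(t))`. -/
def blowDown (k : ℕ+) (a : ℂ) (ζ : Transversal) : Transversal :=
  ⟨PowerSeries.X ^ (k : ℕ) * (PowerSeries.C a + ζ.1), by simp⟩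

instance : Add Transversal := ⟨fun φ ψ => ⟨φ.1 + ψ.1, by simp [φ.2, ψ.2]⟩⟩
instance : Neg Transversal := ⟨fun φ => ⟨-φ.1, by simp [φ.2]⟩⟩
instance : Zero Transversal := ⟨⟨0, by simp⟩⟩

@[simp] theorem coe_add (φ ψ : Transversal) : (φ + ψ).1 = φ.1 + ψ.1 := rfl
@[simp] theorem coe_neg (φ : Transversal) : (-φ).1 = -φ.1 := rfl
@[simp] theorem coe_zero : (0 : Transversal).1 = 0 := rfl
@[simp] theorem coe_expand (m : ℕ+) (ζ : Transversal) :
    (ζ.expand m).1 = PowerSeries.expand m m.ne_zero ζ.1 := rfl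
@[simp] theorem coe_rot (ω : ℂ) (ζ : Transversal) : (ζ.rot ω).1 = PowerSeries.rescale ω ζ.1 := rfl
@[simp] theorem coe_blowDown (k : ℕ+) (a : ℂ) (ζ : Transversal) :
    (ζ.blowDown k a).1 = PowerSeries.X ^ (k : ℕ) * (PowerSeries.C a + ζ.1) := rfl

theorem inX_add (φ ψ : Transversal) : (φ + ψ).inX = φ.inX + ψ.inX := by
  simp only [inX, coe_add]
  exact PowerSeries.subst_add
    (PowerSeries.HasSubst.of_constantCoeff_zero (MvPowerSeries.constantCoeff_X _)) _ _

theorem inX_zero : (0 : Transversal).inX = 0 := by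
  have := inX_add 0 0
  have h : (0 : Transversal) + 0 = 0 := Subtype.ext (by simp)
  rw [h] at this
  simpa using this

theorem neg_add_self (φ : Transversal) : -φ + φ = 0 := Subtype.ext (by simp)
theorem add_neg_self (φ : Transversal) : φ + -φ = 0 := Subtype.ext (by simp)

theorem expand_expand (m k : ℕ+) (ζ : Transversal) : (ζ.expand k).expand m = ζ.expand (m * k) := by
  apply Subtype.ext
  simp only [coe_expand]
  exact (PowerSeries.expand_mul (m : ℕ) m.ne_zero (k : ℕ) k.ne_zero ζ.1).symm

theorem expand_one (ζ : Transversal) : ζ.expand 1 = ζ :=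
  Subtype.ext (PowerSeries.expand_one_apply ζ.1)

end Transversal

@[simp] theorem arcHom_X0 (n : ℕ+) (ζ : Transversal) :
    arcHom n ζ (MvPowerSeries.X 0) = PowerSeries.X ^ (n : ℕ) := pairHom_X0 _ _
@[simp] theorem arcHom_X1 (n : ℕ+) (ζ : Transversal) :
    arcHom n ζ (MvPowerSeries.X 1) = ζ.1 := pairHom_X1 _ _
theorem constantCoeff_arcHom (n : ℕ+) (ζ : Transversal) (g : PS) :
    PowerSeries.constantCoeff (arcHom n ζ g) = MvPowerSeries.constantCoeff g :=
  constantCoeff_pairHom _ _ g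
theorem arcHom_inX (n : ℕ+) (ζ φ : Transversal) : arcHom n ζ φ.inX = (φ.expand n).1 := by
  rw [arcHom, pairHom_inX, Transversal.coe_expand, PowerSeries.expand_apply]

theorem arcHom_shear (n : ℕ+) (ζ φ : Transversal) (g : PS) :
    arcHom n ζ (shear φ g) = arcHom n (φ.expand n + ζ) g := by
  rw [arcHom, shear_eq, pairHom_comp_pairHom]
  refine DFunLike.congr_fun (pairHom_congr _ _ _ _ ?_ ?_) g
  · simp
  · rw [map_add, pairHom_X1, ← arcHom, arcHom_inX, Transversal.coe_add, add_comm]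

theorem arcHom_newtonMap (n : ℕ+) (ζ : Transversal) (w : Weight) (a : ℂ) (g : PS) :
    arcHom n ζ (newtonMap w a g) = arcHom (n * w.cP) (ζ.blowDown (n * w.dP) a) g := by
  rw [arcHom, newtonMap_eq, pairHom_comp_pairHom]
  refine DFunLike.congr_fun (pairHom_congr _ _ _ _ ?_ ?_) g
  · rw [map_pow, pairHom_X0, ← pow_mul, PNat.mul_coe, Weight.coe_cP]
  · rw [map_mul, map_pow, map_add, pairHom_X0, pairHom_X1, pairHom_C, ← pow_mul,
      Transversal.coe_blowDown, PNat.mul_coe, Weight.coe_dP]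
    rfl

theorem expand_arcHom (m n : ℕ+) (ζ : Transversal) (g : PS) :
    PowerSeries.expand m m.ne_zero (arcHom n ζ g) = arcHom (n * m) (ζ.expand m) g := by
  rw [arcHom, PowerSeries.expand_apply, subst_pair_uni (constantCoeff_X_pow_pnat m)]
  · refine DFunLike.congr_fun (pairHom_congr _ _ _ _ ?_ ?_) g
    · rw [PowerSeries.subst_pow (PowerSeries.HasSubst.X_pow m.ne_zero), PowerSeries.subst_X
        (PowerSeries.HasSubst.X_pow m.ne_zero), ← pow_mul, mul_comm, PNat.mul_coe]
    · rw [Transversal.coe_expand, PowerSeries.expand_apply]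
  · exact PowerSeries.constantCoeff_subst_eq_zero (constantCoeff_X_pow_pnat m) _ (by simp)
  · exact PowerSeries.constantCoeff_subst_eq_zero (constantCoeff_X_pow_pnat m) _ ζ.constantCoeff_mv

theorem rescale_arcHom {ω : ℂ} (n : ℕ+) (hω : ω ^ (n : ℕ) = 1) (ζ : Transversal) (g : PS) :
    PowerSeries.rescale ω (arcHom n ζ g) = arcHom n (ζ.rot ω) g := by
  have h0 : MvPowerSeries.constantCoeff (ω • PowerSeries.X : PowerSeries ℂ) = 0 := by
    have : PowerSeries.constantCoeff (ω • PowerSeries.X : PowerSeries ℂ) = 0 := by simp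
    exact this
  rw [arcHom, PowerSeries.rescale_eq_subst, subst_pair_uni h0]
  · refine DFunLike.congr_fun (pairHom_congr _ _ _ _ ?_ ?_) g
    · rw [← PowerSeries.rescale_eq_subst, map_pow, PowerSeries.rescale_X, mul_pow, ← map_pow, hω]
      simp
    · rw [Transversal.coe_rot, PowerSeries.rescale_eq_subst]
  · exact PowerSeries.constantCoeff_subst_eq_zero h0 _ (by simp)
  · exact PowerSeries.constantCoeff_subst_eq_zero h0 _ ζ.constantCoeff_mv

theorem expand_injective (m : ℕ+) :
    Function.Injective (PowerSeries.expand (R := ℂ) (m : ℕ) m.ne_zero) := by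
  intro f g h
  ext k
  rw [← PowerSeries.coeff_expand_mul (m : ℕ) m.ne_zero f k, h, PowerSeries.coeff_expand_mul]

/-- Reparametrizing an arc by `t ↦ t ^ m` does not change its branch. -/
theorem arcIdeal_expand (m n : ℕ+) (ζ : Transversal) :
    arcIdeal (n * m) (ζ.expand m) = arcIdeal n ζ := by
  ext g
  rw [mem_arcIdeal, mem_arcIdeal, ← expand_arcHom, map_eq_zero_iff _ (expand_injective m)]

theorem rescale_injective {ω : ℂ} (hω : ω ≠ 0) :
    Function.Injective (PowerSeries.rescale ω) := by
  intro f g h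
  ext k
  have := congrArg (PowerSeries.coeff k) h
  rw [PowerSeries.coeff_rescale, PowerSeries.coeff_rescale] at this
  exact mul_left_cancel₀ (pow_ne_zero _ hω) this

/-- Conjugate arcs have the same branch. -/
theorem arcIdeal_rot {ω : ℂ} (n : ℕ+) (hω : ω ^ (n : ℕ) = 1) (ζ : Transversal) :
    arcIdeal n (ζ.rot ω) = arcIdeal n ζ := by
  have h0 : ω ≠ 0 := by rintro rfl; simp at hω
  ext g
  rw [mem_arcIdeal, mem_arcIdeal, ← rescale_arcHom n hω, map_eq_zero_iff _ (rescale_injective h0)]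

theorem arcHom_pullback (n : ℕ+) (ζ φ : Transversal) (w : Weight) (a : ℂ) (g : PS) :
    arcHom n ζ (pullback φ w a g) =
      arcHom (n * w.cP) (φ.expand (n * w.cP) + ζ.blowDown (n * w.dP) a) g := by
  rw [pullback, AlgHom.comp_apply, arcHom_newtonMap n ζ w a, arcHom_shear]

/-- The image of the branch of an arc by a Newton modification is the branch of the composed
arc. -/
theorem comap_pullback_arcIdeal (n : ℕ+) (ζ φ : Transversal) (w : Weight) (a : ℂ) :
    (arcIdeal n ζ).comap (pullback φ w a) =
      arcIdeal (n * w.cP) (φ.expand (n * w.cP) + ζ.blowDown (n * w.dP) a) := by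
  ext g
  rw [Ideal.mem_comap, mem_arcIdeal, mem_arcIdeal, arcHom_pullback n ζ φ w a]

/-! ### Coefficients of substituted series -/

theorem exponent_ext {e e' : Fin 2 →₀ ℕ} (h0 : e 0 = e' 0) (h1 : e 1 = e' 1) : e = e' := by
  ext i; fin_cases i
  · exact h0
  · exact h1

theorem coeff_pairHom {τ : Type*} {A B : MvPowerSeries τ ℂ}
    (hA : MvPowerSeries.constantCoeff A = 0) (hB : MvPowerSeries.constantCoeff B = 0)
    (e : τ →₀ ℕ) (g : PS) :
    MvPowerSeries.coeff e (pairHom A B hA hB g) =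
      ∑ᶠ d : Fin 2 →₀ ℕ, MvPowerSeries.coeff d g * MvPowerSeries.coeff e (A ^ d 0 * B ^ d 1) := by
  rw [pairHom_apply, MvPowerSeries.coeff_subst (hasSubst_pair hA hB)]
  refine finsum_congr fun d => ?_
  rw [smul_eq_mul, Finsupp.prod_fintype _ _ (by simp), Fin.prod_univ_two]
  rfl

theorem coeff_X0_pow_mul_eq (m : ℕ) (e : Fin 2 →₀ ℕ) (g : PS) :
    MvPowerSeries.coeff e (MvPowerSeries.X 0 ^ m * g) =
      if m ≤ e 0 then MvPowerSeries.coeff (e - Finsupp.single 0 m) g else 0 := by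
  rw [MvPowerSeries.X_pow_eq, MvPowerSeries.coeff_monomial_mul, one_mul]
  simp

theorem coeff_X1_pow_mul_eq (m : ℕ) (e : Fin 2 →₀ ℕ) (g : PS) :
    MvPowerSeries.coeff e (MvPowerSeries.X 1 ^ m * g) =
      if m ≤ e 1 then MvPowerSeries.coeff (e - Finsupp.single 1 m) g else 0 := by
  rw [MvPowerSeries.X_pow_eq, MvPowerSeries.coeff_monomial_mul, one_mul]
  simp

theorem coeff_subst_X0 (e : Fin 2 →₀ ℕ) (ψ : PowerSeries ℂ) :
    MvPowerSeries.coeff e (PowerSeries.subst (MvPowerSeries.X 0 : PS) ψ) =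
      if e 1 = 0 then PowerSeries.coeff (e 0) ψ else 0 := by
  rw [PowerSeries.coeff_subst_single]
  congr 1
  refine propext ⟨fun h => by rw [h]; simp, fun h => exponent_ext (by simp) (by simp [h])⟩

theorem coeff_X1_add_inX_pow (φ : Transversal) (k : ℕ) (e : Fin 2 →₀ ℕ) :
    MvPowerSeries.coeff e ((MvPowerSeries.X 1 + φ.inX) ^ k : PS) =
      (k.choose (e 1) : ℂ) * PowerSeries.coeff (e 0) (φ.1 ^ (k - e 1)) := by
  have hs : PowerSeries.HasSubst (MvPowerSeries.X 0 : PS) :=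
    PowerSeries.HasSubst.of_constantCoeff_zero (MvPowerSeries.constantCoeff_X _)
  rw [add_pow, map_sum]
  have key : ∀ j : ℕ, MvPowerSeries.coeff e
      (MvPowerSeries.X 1 ^ j * φ.inX ^ (k - j) * (k.choose j : PS)) =
      if e 1 = j then (k.choose j : ℂ) * PowerSeries.coeff (e 0) (φ.1 ^ (k - j)) else 0 := by
    intro j
    have h1 : (k.choose j : PS) = MvPowerSeries.C (k.choose j : ℂ) := by simp
    rw [h1, MvPowerSeries.coeff_mul_C, coeff_X1_pow_mul_eq, Transversal.inX,
      ← PowerSeries.subst_pow hs, coeff_subst_X0]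
    by_cases h : e 1 = j
    · subst h; simp [mul_comm]
    · simp only [Finsupp.coe_tsub, Pi.sub_apply, Finsupp.single_eq_same, h, if_false]
      split_ifs with h2 h3
      · omega
      · simp
      · simp
  simp_rw [key]
  rw [Finset.sum_ite_eq]
  split_ifs with h
  · rfl
  · rw [Nat.choose_eq_zero_of_lt (by simpa using h)]; simp

theorem coeff_shear (φ : Transversal) (e : Fin 2 →₀ ℕ) (g : PS) :
    MvPowerSeries.coeff e (shear φ g) = ∑ᶠ d : Fin 2 →₀ ℕ, MvPowerSeries.coeff d g *
      (if d 0 ≤ e 0 then ((d 1).choose (e 1) : ℂ) *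
        PowerSeries.coeff (e 0 - d 0) (φ.1 ^ (d 1 - e 1)) else 0) := by
  rw [shear_eq, coeff_pairHom]
  refine finsum_congr fun d => ?_
  rw [coeff_X0_pow_mul_eq]
  split_ifs
  · rw [coeff_X1_add_inX_pow]; simp
  · rfl

theorem coeff_C_add_X1_pow (a : ℂ) (k : ℕ) (e : Fin 2 →₀ ℕ) :
    MvPowerSeries.coeff e ((MvPowerSeries.C a + MvPowerSeries.X 1) ^ k : PS) =
      if e 0 = 0 then (k.choose (e 1) : ℂ) * a ^ (k - e 1) else 0 := by
  rw [add_comm, add_pow, map_sum]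
  have key : ∀ j : ℕ, MvPowerSeries.coeff e
      (MvPowerSeries.X 1 ^ j * MvPowerSeries.C a ^ (k - j) * (k.choose j : PS)) =
      if e 1 = j then (if e 0 = 0 then (k.choose j : ℂ) * a ^ (k - j) else 0) else 0 := by
    intro j
    have h1 : (k.choose j : PS) = MvPowerSeries.C (k.choose j : ℂ) := by simp
    rw [h1, mul_assoc, ← map_pow, ← map_mul, MvPowerSeries.coeff_mul_C, MvPowerSeries.coeff_X_pow]
    by_cases h : e 1 = j
    · by_cases h0 : e 0 = 0
      · have : e = Finsupp.single 1 j := exponent_ext (by simp [h0]) (by simp [h])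
        simp [this, mul_comm]
      · have : e ≠ Finsupp.single 1 j := by rintro rfl; simp at h0
        simp [h0, this]
    · have : e ≠ Finsupp.single 1 j := by rintro rfl; simp at h
      simp [h, this]
  simp_rw [key]
  rw [Finset.sum_ite_eq]
  split_ifs with h h' h'
  · rfl
  · rfl
  · rw [Nat.choose_eq_zero_of_lt (by simpa using h)]; simp
  · rfl

/-- The weight of the monomial of exponent `e`. -/
def Weight.deg (w : Weight) (e : Fin 2 →₀ ℕ) : ℕ := w.c * e 0 + w.d * e 1

theorem coeff_newtonMap (w : Weight) (a : ℂ) (e : Fin 2 →₀ ℕ) (g : PS) :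
    MvPowerSeries.coeff e (newtonMap w a g) = ∑ᶠ d : Fin 2 →₀ ℕ, if w.deg d = e 0 then
      MvPowerSeries.coeff d g * (((d 1).choose (e 1) : ℂ) * a ^ (d 1 - e 1)) else 0 := by
  rw [newtonMap_eq, coeff_pairHom]
  refine finsum_congr fun d => ?_
  rw [mul_pow, ← mul_assoc, ← pow_mul, ← pow_mul, ← pow_add, coeff_X0_pow_mul_eq, ← Weight.deg,
    coeff_C_add_X1_pow]
  by_cases h : w.deg d = e 0
  · simp [h]
  · rw [if_neg h]
    split_ifs with h1 h2
    · simp at h2; omega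
    · simp
    · simp

theorem Weight.finite_deg (w : Weight) (m : ℕ) : {d | w.deg d = m}.Finite := by
  refine Set.Finite.of_finite_image (f := fun d => (d 0, d 1)) (Set.Finite.subset
    ((Set.finite_Iic m).prod (Set.finite_Iic m)) ?_) ?_
  · rintro _ ⟨d, hd, rfl⟩
    have h1 := w.c_pos
    have h2 := w.d_pos
    simp only [Set.mem_ofPred_eq, Weight.deg] at hd
    constructor
    · simp only [Set.mem_Iic]; nlinarith
    · simp only [Set.mem_Iic]; nlinarith
  · intro d _ d' _ h
    simp only [Prod.mk.injEq] at h
    exact exponent_ext h.1 h.2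

theorem Weight.deg_inj (w : Weight) {d d' : Fin 2 →₀ ℕ} (h : w.deg d = w.deg d')
    (h1 : d 1 = d' 1) : d = d' := by
  refine exponent_ext ?_ h1
  simp only [Weight.deg, h1] at h
  exact Nat.eq_of_mul_eq_mul_left w.c_pos (by omega)

theorem trop_le {g : PS} (w : Weight) {d : Fin 2 →₀ ℕ} (hd : MvPowerSeries.coeff d g ≠ 0) :
    trop g w ≤ w.deg d := Nat.sInf_le ⟨d, hd, rfl⟩

theorem exists_trop {g : PS} (w : Weight) (hg : g ≠ 0) :
    ∃ d, MvPowerSeries.coeff d g ≠ 0 ∧ w.deg d = trop g w := by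
  have : {n | ∃ e : Fin 2 →₀ ℕ, MvPowerSeries.coeff e g ≠ 0 ∧ n = w.c * e 0 + w.d * e 1}.Nonempty := by
    obtain ⟨d, hd⟩ := MvPowerSeries.ne_zero_iff_exists_coeff_ne_zero _ |>.1 hg
    exact ⟨_, d, hd, rfl⟩
  obtain ⟨d, hd, h⟩ := Nat.sInf_mem this
  exact ⟨d, hd, h.symm⟩

theorem coeff_strictTransform_eq (g : PS) (w : Weight) (a : ℂ) (e : Fin 2 →₀ ℕ) :
    MvPowerSeries.coeff e (strictTransform g w a) =
      MvPowerSeries.coeff (e + Finsupp.single 0 (trop g w)) (newtonMap w a g) := rfl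

theorem X0_pow_trop_mul_strictTransform (g : PS) (w : Weight) (a : ℂ) :
    MvPowerSeries.X 0 ^ trop g w * strictTransform g w a = newtonMap w a g := by
  ext e
  rw [coeff_X0_pow_mul_eq]
  split_ifs with h
  · rw [coeff_strictTransform_eq, tsub_add_cancel_of_le (by simpa using h)]
  · rw [coeff_newtonMap, finsum_eq_zero_of_forall_eq_zero]
    intro d
    split_ifs with h1
    · by_cases h2 : MvPowerSeries.coeff d g = 0
      · simp [h2]
      · exact absurd (h1 ▸ trop_le w h2) h
    · rfl

/-- The restriction of the strict transform to the exceptional divisor only depends on the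
monomials of the face of the Newton polygon. -/
theorem coeff_strictTransform (g : PS) (w : Weight) (a : ℂ) (j : ℕ) :
    MvPowerSeries.coeff (Finsupp.single 1 j) (strictTransform g w a) =
      ∑ᶠ d : Fin 2 →₀ ℕ, if w.deg d = trop g w then
        MvPowerSeries.coeff d g * (((d 1).choose j : ℂ) * a ^ (d 1 - j)) else 0 := by
  rw [coeff_strictTransform_eq, coeff_newtonMap]
  simp

/-- The strict transform does not contain the exceptional divisor. -/
theorem exists_coeff_strictTransform_ne_zero {g : PS} (hg : g ≠ 0) (w : Weight) (a : ℂ) :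
    ∃ j, MvPowerSeries.coeff (Finsupp.single 1 j) (strictTransform g w a) ≠ 0 := by
  have hfin : {d | w.deg d = trop g w ∧ MvPowerSeries.coeff d g ≠ 0}.Finite :=
    (w.finite_deg _).subset fun d h => h.1
  have hne : {d | w.deg d = trop g w ∧ MvPowerSeries.coeff d g ≠ 0}.Nonempty := by
    obtain ⟨d, h1, h2⟩ := exists_trop w hg
    exact ⟨d, h2, h1⟩
  obtain ⟨d, ⟨hd1, hd2⟩, hmax⟩ := Set.exists_max_image _ (fun d : Fin 2 →₀ ℕ => d 1) hfin hne
  refine ⟨d 1, ?_⟩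
  -- The monomial of the face with the largest exponent of `y` is alone to contribute.
  rw [coeff_strictTransform, finsum_eq_single _ d]
  · simpa [hd1] using hd2
  · intro d' hd'
    split_ifs with h
    · by_cases h2 : MvPowerSeries.coeff d' g = 0
      · simp [h2]
      · have h3 := hmax d' ⟨h, h2⟩
        have h4 : d' 1 ≠ d 1 := fun h5 => hd' (w.deg_inj (h.trans hd1.symm) h5)
        rw [Nat.choose_eq_zero_of_lt (by omega)]; simp
    · rfl

theorem not_X0_dvd_iff {g : PS} : ¬ (MvPowerSeries.X 0 : PS) ∣ g ↔
    ∃ j, MvPowerSeries.coeff (Finsupp.single 1 j) g ≠ 0 := by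
  rw [MvPowerSeries.X_dvd_iff]
  push Not
  constructor
  · rintro ⟨m, h, hm⟩
    refine ⟨m 1, ?_⟩
    rwa [show Finsupp.single 1 (m 1) = m from exponent_ext (by simp [h]) (by simp)]
  · rintro ⟨j, hj⟩
    exact ⟨_, by simp, hj⟩

theorem not_X0_dvd_strictTransform {g : PS} (hg : g ≠ 0) (w : Weight) (a : ℂ) :
    ¬ (MvPowerSeries.X 0 : PS) ∣ strictTransform g w a :=
  not_X0_dvd_iff.2 (exists_coeff_strictTransform_ne_zero hg w a)

theorem constantCoeff_strictTransform (g : PS) (w : Weight) (a : ℂ) :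
    MvPowerSeries.constantCoeff (strictTransform g w a) =
      ∑ᶠ d : Fin 2 →₀ ℕ, if w.deg d = trop g w then MvPowerSeries.coeff d g * a ^ d 1 else 0 := by
  have := coeff_strictTransform g w a 0
  simpa [MvPowerSeries.coeff_zero_eq_constantCoeff_apply] using this

/-- If the strict transform meets the orbit of `w`, then the face of `w` is an edge. -/
theorem isNewtonRay_of_constantCoeff {g : PS} (hg : g ≠ 0) (w : Weight) {a : ℂ} (ha : a ≠ 0)
    (h : MvPowerSeries.constantCoeff (strictTransform g w a) = 0) : IsNewtonRay g w := by
  obtain ⟨d, hd, hdt⟩ := exists_trop w hg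
  by_contra hray
  rw [constantCoeff_strictTransform, finsum_eq_single _ d] at h
  · simp [hdt, hd, ha] at h
  · intro d' hd'
    split_ifs with h1
    · by_cases h2 : MvPowerSeries.coeff d' g = 0
      · simp [h2]
      · exact absurd ⟨d', d, hd', h2, hd, h1, hdt⟩ hray
    · rfl

/-- The vanishing at the point `v = a ^ c` of an orbit does not depend on the choice of `a`. -/
theorem constantCoeff_strictTransform_eq_zero {g : PS} {w : Weight} {a b : ℂ} (ha : a ≠ 0)
    (hab : a ^ w.c = b ^ w.c) (h : MvPowerSeries.constantCoeff (strictTransform g w a) = 0) :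
    MvPowerSeries.constantCoeff (strictTransform g w b) = 0 := by
  by_cases hg : g = 0
  · rw [constantCoeff_strictTransform, finsum_eq_zero_of_forall_eq_zero]
    intro d; simp [hg]
  have hb : b ≠ 0 := by
    rintro rfl
    rw [zero_pow w.c_pos.ne'] at hab
    exact ha (pow_eq_zero_iff w.c_pos.ne' |>.1 hab)
  obtain ⟨d₀, -, hd₀⟩ := exists_trop w hg
  have hθ : (b / a) ^ w.c = 1 := by rw [div_pow, hab, div_self (pow_ne_zero _ hb)]
  -- The exponents of `y` in the monomials of the face are congruent modulo `c`.
  have key : ∀ d, w.deg d = trop g w → (b / a) ^ d 1 = (b / a) ^ d₀ 1 := by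
    intro d hd
    have h1 : w.c * d 0 + w.d * d 1 = w.c * d₀ 0 + w.d * d₀ 1 := hd.trans hd₀.symm
    have h2 : w.d * d 1 ≡ w.d * d₀ 1 [MOD w.c] := by
      have : (w.c * d 0 + w.d * d 1) ≡ (w.c * d₀ 0 + w.d * d₀ 1) [MOD w.c] := by rw [h1]
      simpa [Nat.ModEq, Nat.mul_add_mod] using this
    have h3 : d 1 ≡ d₀ 1 [MOD w.c] := Nat.ModEq.cancel_left_of_coprime w.coprime h2
    rw [← Nat.mod_add_div (d 1) w.c, ← Nat.mod_add_div (d₀ 1) w.c, h3, pow_add, pow_add, pow_mul,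
      pow_mul, hθ, one_pow, one_pow]
  rw [constantCoeff_strictTransform] at h ⊢
  have h2 : ∀ d : Fin 2 →₀ ℕ, (if w.deg d = trop g w then MvPowerSeries.coeff d g * b ^ d 1 else 0)
      = (b / a) ^ d₀ 1 *
        (if w.deg d = trop g w then MvPowerSeries.coeff d g * a ^ d 1 else 0) := by
    intro d
    split_ifs with hd
    · rw [← key d hd, mul_left_comm, ← mul_pow, div_mul_cancel₀ _ ha]
    · simp
  rw [finsum_congr h2, ← mul_finsum, h, mul_zero]

/-! ### Newton-Puiseux theorem -/

/-- The order of `g(0, y)` is `m`. -/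
def HasYOrder (g : PS) (m : ℕ) : Prop :=
  MvPowerSeries.coeff (Finsupp.single 1 m) g ≠ 0 ∧
    ∀ j < m, MvPowerSeries.coeff (Finsupp.single 1 j) g = 0

theorem exists_hasYOrder {g : PS} (h : ¬ (MvPowerSeries.X 0 : PS) ∣ g) : ∃ m, HasYOrder g m := by
  classical
  have h' := not_X0_dvd_iff.1 h
  exact ⟨Nat.find h', Nat.find_spec h', fun j hj => not_not.1 (Nat.find_min h' hj)⟩

theorem coeff_zero_pow_of_pos (φ : Transversal) {k : ℕ} (hk : k ≠ 0) :
    PowerSeries.coeff 0 (φ.1 ^ k) = 0 := by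
  rw [PowerSeries.coeff_zero_eq_constantCoeff_apply, map_pow, φ.2, zero_pow hk]

theorem coeff_single_shear (φ : Transversal) (j : ℕ) (g : PS) :
    MvPowerSeries.coeff (Finsupp.single 1 j) (shear φ g) =
      MvPowerSeries.coeff (Finsupp.single 1 j) g := by
  rw [coeff_shear, finsum_eq_single _ (Finsupp.single 1 j)]
  · simp
  · intro d hd
    split_ifs with h
    · simp only [Finsupp.single_eq_same]
      have h0 : d 0 = 0 := by simpa using h
      have h1 : d 1 ≠ j := fun h1 => hd (exponent_ext (by simp [h0]) (by simp [h1]))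
      rcases lt_or_gt_of_ne h1 with h2 | h2
      · rw [Nat.choose_eq_zero_of_lt h2]; simp
      · rw [h0, show (Finsupp.single 1 j : Fin 2 →₀ ℕ) 0 - 0 = 0 by simp,
          coeff_zero_pow_of_pos φ (by omega)]
        simp
    · simp

theorem HasYOrder.shear {g : PS} {m : ℕ} (h : HasYOrder g m) (φ : Transversal) :
    HasYOrder (shear φ g) m :=
  ⟨by rw [coeff_single_shear]; exact h.1, fun j hj => by rw [coeff_single_shear]; exact h.2 j hj⟩

theorem shear_shear (φ δ : Transversal) (g : PS) : shear δ (shear φ g) = shear (φ + δ) g := by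
  simp only [shear_eq]
  rw [pairHom_comp_pairHom]
  refine DFunLike.congr_fun (pairHom_congr _ _ _ _ (by simp) ?_) g
  rw [map_add, pairHom_X1, ← shear_eq, Transversal.inX_add]
  have : PlaneCurve.shear δ φ.inX = φ.inX := by
    rw [shear_eq, pairHom_inX]; rfl
  rw [this]; ring

/-- The effect of a small change of variable `y ↦ y + δ(x)` on the coefficient of `y ^ l`, up to
the order of `δ`: only the monomial `y ^ (l + 1)` contributes. -/
theorem coeff_shear_small {δ : Transversal} {k : ℕ} (hk : 0 < k)
    (hδ : PowerSeries.X ^ k ∣ δ.1) (g : PS) (l i : ℕ) (hi : i ≤ k) :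
    MvPowerSeries.coeff (Finsupp.single 0 i + Finsupp.single 1 l) (shear δ g) =
      MvPowerSeries.coeff (Finsupp.single 0 i + Finsupp.single 1 l) g +
      if i = k then MvPowerSeries.coeff (Finsupp.single 1 (l + 1)) g *
        ((l + 1 : ℂ) * PowerSeries.coeff k δ.1) else 0 := by
  classical
  have hne : (Finsupp.single 0 i + Finsupp.single 1 l : Fin 2 →₀ ℕ) ≠ Finsupp.single 1 (l + 1) := by
    intro h
    have := DFunLike.congr_fun h 1
    simp at this
  rw [coeff_shear, finsum_eq_sum_of_support_subset (s := {Finsupp.single 0 i + Finsupp.single 1 l,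
    Finsupp.single 1 (l + 1)}), Finset.sum_pair hne]
  · congr 1
    · simp
    · have hδ' := PowerSeries.X_pow_dvd_iff.1 hδ
      split_ifs with h1 h2 h2
      · subst h2; simp
      · have : i < k := lt_of_le_of_ne hi h2
        simp [hδ' i this]
      · simp at h1
      · simp
  · intro d hd
    by_contra hd'
    refine hd ?_
    simp only [Finset.coe_insert, Finset.coe_singleton, Set.mem_insert_iff,
      Set.mem_singleton_iff, not_or] at hd'
    simp only [Finsupp.coe_add, Pi.add_apply, Finsupp.single_eq_same]
    have e1 : (Finsupp.single (1 : Fin 2) l : Fin 2 →₀ ℕ) 0 = 0 := by simp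
    have e0 : (Finsupp.single (0 : Fin 2) i : Fin 2 →₀ ℕ) 1 = 0 := by simp
    rw [e1, e0, add_zero, zero_add]
    split_ifs with h
    · have hδ' := PowerSeries.X_pow_dvd_iff.1 hδ
      suffices ((d 1).choose l : ℂ) * PowerSeries.coeff (i - d 0) (δ.1 ^ (d 1 - l)) = 0 by
        rw [this, mul_zero]
      rcases lt_trichotomy (d 1) l with h2 | h2 | h2
      · rw [Nat.choose_eq_zero_of_lt h2]; simp
      · have h3 : d 0 ≠ i := fun h3 => hd'.1 (exponent_ext (by simp [h3]) (by simp [h2]))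
        rw [h2, Nat.sub_self, pow_zero, PowerSeries.coeff_one, if_neg (by omega), mul_zero]
      · obtain ⟨q, hq⟩ := Nat.exists_eq_add_of_lt h2
        rw [hq, show l + q + 1 - l = q + 1 by omega]
        rcases Nat.eq_zero_or_pos q with h4 | h4
        · subst h4
          have h3 : d 0 ≠ 0 := fun h3 => hd'.2 (exponent_ext (by simp [h3]) (by simp [hq]))
          rw [zero_add, pow_one, hδ' _ (by omega), mul_zero]
        · have h5 : PowerSeries.X ^ (k * 2) ∣ δ.1 ^ (q + 1) :=
            (pow_mul (PowerSeries.X : PowerSeries ℂ) k 2 ▸ pow_dvd_pow_of_dvd hδ 2).trans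
              (pow_dvd_pow _ (by omega))
          rw [PowerSeries.X_pow_dvd_iff.1 h5 _ (by omega), mul_zero]
    · simp

/-- The series `c t ^ (k + 1)`. -/
def Transversal.mono (k : ℕ) (c : ℂ) : Transversal :=
  ⟨PowerSeries.monomial (k + 1) c, by
    rw [← PowerSeries.coeff_zero_eq_constantCoeff_apply, PowerSeries.coeff_monomial]; simp⟩

/-- Successive approximations of the transversal branch on which the coefficient of `y ^ l`
vanishes. -/
def maximalContactApprox (g : PS) (l : ℕ) : ℕ → Transversal
  | 0 => 0
  | k + 1 => maximalContactApprox g l k + Transversal.mono k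
      (-MvPowerSeries.coeff (Finsupp.single 0 (k + 1) + Finsupp.single 1 l)
        (shear (maximalContactApprox g l k) g) /
        ((l + 1 : ℂ) * MvPowerSeries.coeff (Finsupp.single 1 (l + 1)) g))

theorem shear_zero (g : PS) : shear 0 g = g := by
  have : (MvPowerSeries.X 1 + (0 : Transversal).inX : PS) = MvPowerSeries.X 1 := by
    rw [Transversal.inX_zero, add_zero]
  rw [shear_eq, pairHom_congr _ _ (MvPowerSeries.constantCoeff_X _)
    (MvPowerSeries.constantCoeff_X _) rfl this, pairHom_eq_id]

/-- Tschirnhaus transformation: if `g(0, y)` has order `l + 1`, some change of variable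
`y ↦ y + φ(x)` kills the coefficient of `y ^ l`. For `l = 0` this is the implicit function
theorem. -/
theorem exists_maximalContact {g : PS} {l : ℕ} (hg : HasYOrder g (l + 1)) :
    ∃ φ : Transversal, ∀ i, MvPowerSeries.coeff (Finsupp.single 0 i + Finsupp.single 1 l)
      (shear φ g) = 0 := by
  set ψ := maximalContactApprox g l with hψ
  have hl : (l + 1 : ℂ) ≠ 0 := by exact_mod_cast l.succ_ne_zero
  have hdvd : ∀ k c, (PowerSeries.X : PowerSeries ℂ) ^ (k + 1) ∣ (Transversal.mono k c).1 := by
    intro k c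
    rw [PowerSeries.X_pow_dvd_iff]
    intro m hm
    exact (PowerSeries.coeff_monomial _ _ _).trans (if_neg hm.ne)
  have h1 : ∀ k, ∀ i ≤ k, MvPowerSeries.coeff (Finsupp.single 0 i + Finsupp.single 1 l)
      (shear (ψ k) g) = 0 := by
    intro k
    induction k with
    | zero =>
      intro i hi
      obtain rfl : i = 0 := by omega
      have : ψ 0 = 0 := rfl
      rw [this, shear_zero, Finsupp.single_zero, zero_add]
      exact hg.2 l (by omega)
    | succ k ih =>
      intro i hi
      change MvPowerSeries.coeff _ (shear (ψ k + Transversal.mono k _) g) = 0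
      rw [← shear_shear, coeff_shear_small k.succ_pos (hdvd k _) _ _ _ hi, coeff_single_shear]
      split_ifs with h
      · subst h
        have : PowerSeries.coeff (k + 1) (Transversal.mono k
            (-MvPowerSeries.coeff (Finsupp.single 0 (k + 1) + Finsupp.single 1 l)
            (shear (ψ k) g) / ((l + 1 : ℂ) * MvPowerSeries.coeff (Finsupp.single 1 (l + 1)) g))).1
            = -MvPowerSeries.coeff (Finsupp.single 0 (k + 1) + Finsupp.single 1 l)
            (shear (ψ k) g) / ((l + 1 : ℂ) * MvPowerSeries.coeff (Finsupp.single 1 (l + 1)) g) :=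
          (PowerSeries.coeff_monomial _ _ _).trans (if_pos rfl)
        rw [← hψ, this]
        have := hg.1
        field_simp
        ring
      · rw [ih i (by omega), add_zero]
  have h2 : ∀ n k, PowerSeries.coeff n (ψ (n + k)).1 = PowerSeries.coeff n (ψ n).1 := by
    intro n k
    induction k with
    | zero => rfl
    | succ k ih =>
      rw [← ih]
      change PowerSeries.coeff n (ψ (n + k) + Transversal.mono (n + k) _).1 = _
      rw [Transversal.coe_add, map_add, PowerSeries.X_pow_dvd_iff.1 (hdvd (n + k) _) n (by omega),
        add_zero]
  refine ⟨⟨PowerSeries.mk fun n => PowerSeries.coeff n (ψ n).1, ?_⟩, fun i => ?_⟩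
  · rw [← PowerSeries.coeff_zero_eq_constantCoeff_apply, PowerSeries.coeff_mk]
    exact (PowerSeries.coeff_zero_eq_constantCoeff_apply _).trans (ψ 0).2
  · set φ : Transversal := ⟨PowerSeries.mk fun n => PowerSeries.coeff n (ψ n).1, _⟩ with hφ
    have h3 : φ = ψ i + (-ψ i + φ) := by
      apply Subtype.ext; simp
    have h4 : PowerSeries.X ^ (i + 1) ∣ (-ψ i + φ).1 := by
      rw [PowerSeries.X_pow_dvd_iff]
      intro m hm
      obtain ⟨k, rfl⟩ := Nat.exists_eq_add_of_le (Nat.lt_succ_iff.1 hm)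
      rw [Transversal.coe_add, Transversal.coe_neg, map_add, map_neg, h2]
      simp [hφ]
    rw [h3, ← shear_shear, coeff_shear_small i.succ_pos h4 _ _ _ i.le_succ, h1 i i le_rfl,
      if_neg (by omega), add_zero]

theorem arcHom_eq_zero_of_X1_dvd (n : ℕ+) {g : PS} (h : (MvPowerSeries.X 1 : PS) ∣ g) :
    arcHom n 0 g = 0 := by
  obtain ⟨k, rfl⟩ := h
  rw [map_mul, arcHom_X1, Transversal.coe_zero, zero_mul]

/-- Among the monomials `x ^ i y ^ j` of `g` with `j < M`, one minimizes the slope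
`i / (M - j)`. -/
theorem exists_min_slope {g : PS} {M : ℕ}
    (h : ∃ e : Fin 2 →₀ ℕ, e 1 < M ∧ MvPowerSeries.coeff e g ≠ 0) :
    ∃ e : Fin 2 →₀ ℕ, e 1 < M ∧ MvPowerSeries.coeff e g ≠ 0 ∧
      ∀ e' : Fin 2 →₀ ℕ, e' 1 < M → MvPowerSeries.coeff e' g ≠ 0 →
        e 0 * (M - e' 1) ≤ e' 0 * (M - e 1) := by
  -- Multiplying the slopes by `M!` makes them integers, so that a minimum exists.
  let F : (Fin 2 →₀ ℕ) → ℕ := fun e => e 0 * (M.factorial / (M - e 1))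
  obtain ⟨e, ⟨h1, h2⟩, hmin⟩ := (measure F).wf.has_min
    {e : Fin 2 →₀ ℕ | e 1 < M ∧ MvPowerSeries.coeff e g ≠ 0} h
  refine ⟨e, h1, h2, fun e' h1' h2' => ?_⟩
  have h3 : F e ≤ F e' := not_lt.1 (hmin e' ⟨h1', h2'⟩)
  have h4 : M.factorial / (M - e 1) * (M - e 1) = M.factorial :=
    Nat.div_mul_cancel (Nat.dvd_factorial (by omega) (by omega))
  have h5 : M.factorial / (M - e' 1) * (M - e' 1) = M.factorial :=
    Nat.div_mul_cancel (Nat.dvd_factorial (by omega) (by omega))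
  refine le_of_mul_le_mul_left (a := M.factorial) ?_ M.factorial_pos
  simp only [F] at h3
  generalize M.factorial / (M - e 1) = q at h3 h4
  generalize M.factorial / (M - e' 1) = q' at h3 h5
  calc M.factorial * (e 0 * (M - e' 1)) = e 0 * q * ((M - e 1) * (M - e' 1)) := by rw [← h4]; ring
    _ ≤ e' 0 * q' * ((M - e 1) * (M - e' 1)) := Nat.mul_le_mul_right _ h3
    _ = M.factorial * (e' 0 * (M - e 1)) := by rw [← h5]; ring

/-- One step of the Newton-Puiseux algorithm: if the coefficient of `y ^ l` vanishes, and
`y ^ (l + 1)` does not divide `g`, a suitable Newton modification makes the order drop. -/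
theorem exists_newtonMap_drop {g : PS} {l : ℕ} (hg : HasYOrder g (l + 1))
    (hl : ∀ i, MvPowerSeries.coeff (Finsupp.single 0 i + Finsupp.single 1 l) g = 0)
    (hne : ∃ e : Fin 2 →₀ ℕ, e 1 < l + 1 ∧ MvPowerSeries.coeff e g ≠ 0) :
    ∃ (w : Weight) (a : ℂ) (m : ℕ), m < l ∧ HasYOrder (strictTransform g w a) (m + 1) := by
  classical
  have hg0 : g ≠ 0 := by rintro rfl; exact hg.1 (by simp)
  obtain ⟨e, he1, he, hmin⟩ := exists_min_slope hne
  have hel : e 1 ≠ l := by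
    intro h
    refine he ?_
    rw [show e = Finsupp.single 0 (e 0) + Finsupp.single 1 l from
      exponent_ext (by simp) (by simp [h])]
    exact hl _
  have he0 : 0 < e 0 := by
    rcases Nat.eq_zero_or_pos (e 0) with h | h
    · exact absurd (hg.2 (e 1) he1) (by
        rwa [show Finsupp.single 1 (e 1) = e from exponent_ext (by simp [h]) (by simp)])
    · exact h
  -- The weight of the corresponding edge of the Newton polygon.
  obtain ⟨q, c, d, hq, hcop, hc, hd⟩ := Nat.exists_coprime' (m := l + 1 - e 1) (n := e 0)
    (Nat.gcd_pos_of_pos_right _ he0)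
  have hc0 : 0 < c := Nat.pos_of_ne_zero (by rintro rfl; omega)
  have hd0 : 0 < d := Nat.pos_of_ne_zero (by rintro rfl; omega)
  let w : Weight := ⟨c, d, hc0, hd0, hcop⟩
  have hdeg : ∀ e' : Fin 2 →₀ ℕ, w.deg e' = c * e' 0 + d * e' 1 := fun _ => rfl
  have hwe : w.deg e = d * (l + 1) := by
    have h1 : l + 1 = c * q + e 1 := by omega
    rw [hdeg, h1, hd]; ring
  have hwm : w.deg (Finsupp.single 1 (l + 1)) = d * (l + 1) := by rw [hdeg]; simp
  have htrop : trop g w = d * (l + 1) := by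
    refine le_antisymm (hwm ▸ trop_le w hg.1) ?_
    obtain ⟨e', he', h⟩ := exists_trop w hg0
    rw [← h, hdeg]
    by_cases h1 : e' 1 < l + 1
    · have h2 := hmin e' h1 he'
      rw [hc, hd] at h2
      have h3 : d * (l + 1 - e' 1) ≤ e' 0 * c :=
        le_of_mul_le_mul_right (a := q) (by linarith) hq
      have h4 : l + 1 = (l + 1 - e' 1) + e' 1 := by omega
      rw [h4]
      nlinarith
    · have h5 : d * (l + 1) ≤ d * e' 1 := Nat.mul_le_mul_left _ (by omega)
      omega
  have hface : ∀ e' : Fin 2 →₀ ℕ, w.deg e' = trop g w → e' 1 ≤ l + 1 := by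
    intro e' h
    rw [htrop, hdeg] at h
    by_contra h1
    have h5 : d * (l + 1 + 1) ≤ d * e' 1 := Nat.mul_le_mul_left _ (by omega)
    nlinarith
  -- A root of the polynomial of the edge.
  obtain ⟨a, ha⟩ : ∃ a, MvPowerSeries.constantCoeff (strictTransform g w a) = 0 := by
    let T : Polynomial ℂ := ∑ e' ∈ (w.finite_deg (trop g w)).toFinset,
      Polynomial.monomial (e' 1) (MvPowerSeries.coeff e' g)
    have hT : T.coeff (l + 1) = MvPowerSeries.coeff (Finsupp.single 1 (l + 1)) g := by
      simp only [T, Polynomial.finsetSum_coeff, Polynomial.coeff_monomial]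
      rw [Finset.sum_eq_single (Finsupp.single 1 (l + 1))]
      · simp
      · intro e' h1 h2
        rw [if_neg]
        intro h3
        refine h2 (w.deg_inj ?_ (by simp [h3]))
        rw [hwm, ← htrop]
        simpa using h1
      · intro h
        exact absurd (hwm.trans htrop.symm) (by simpa using h)
    have hT0 : T.degree ≠ 0 := by
      intro h
      rw [Polynomial.eq_C_of_degree_eq_zero h, Polynomial.coeff_C, if_neg (by omega)] at hT
      exact hg.1 hT.symm
    obtain ⟨a, ha⟩ := IsAlgClosed.exists_root T hT0
    refine ⟨a, ?_⟩
    refine Eq.trans ?_ ha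
    rw [constantCoeff_strictTransform, finsum_eq_sum_of_support_subset
      (s := (w.finite_deg (trop g w)).toFinset)]
    · simp only [T, Polynomial.eval_finsetSum, Polynomial.eval_monomial]
      refine Finset.sum_congr rfl fun e' h => if_pos (by simpa using h)
    · intro e' h
      by_contra h1
      exact h (if_neg (by simpa using h1))
  -- Since the edge has no monomial in `y ^ l`, no root has full multiplicity.
  have hdrop : ∃ j, j ≤ l ∧ MvPowerSeries.coeff (Finsupp.single 1 j) (strictTransform g w a) ≠ 0 := by
    by_cases ha0 : a = 0
    · refine ⟨e 1, by omega, ?_⟩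
      rw [coeff_strictTransform, finsum_eq_single _ e]
      · simpa [htrop, hwe] using he
      · intro e' h
        split_ifs with h1
        · have h2 : e' 1 ≠ e 1 := fun h2 => h (w.deg_inj (by rw [h1, htrop, hwe]) h2)
          rcases lt_or_gt_of_ne h2 with h3 | h3
          · rw [Nat.choose_eq_zero_of_lt h3]; simp
          · rw [ha0, zero_pow (by omega)]; simp
        · rfl
    · refine ⟨l, le_rfl, ?_⟩
      rw [coeff_strictTransform, finsum_eq_single _ (Finsupp.single 1 (l + 1))]
      · rw [if_pos (by rw [hwm, htrop])]
        have hl : (l + 1 : ℂ) ≠ 0 := by exact_mod_cast l.succ_ne_zero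
        simpa [ha0, hl] using hg.1
      · intro e' h
        split_ifs with h1
        · have h2 : e' 1 ≠ l + 1 := fun h2 => h (w.deg_inj (by rw [h1, htrop, hwm]) (by simp [h2]))
          have h3 := hface e' h1
          rcases lt_or_eq_of_le (show e' 1 ≤ l by omega) with h4 | h4
          · rw [Nat.choose_eq_zero_of_lt h4]; simp
          · rw [show e' = Finsupp.single 0 (e' 0) + Finsupp.single 1 l from
              exponent_ext (by simp) (by simp [h4]), hl, zero_mul]
        · rfl
  have hex : ∃ j, MvPowerSeries.coeff (Finsupp.single 1 j) (strictTransform g w a) ≠ 0 :=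
    let ⟨j, _, h⟩ := hdrop; ⟨j, h⟩
  obtain ⟨j, hj, hjne⟩ := hdrop
  have hf : Nat.find hex ≠ 0 := by
    intro h
    have := Nat.find_spec hex
    rw [h, Finsupp.single_zero, MvPowerSeries.coeff_zero_eq_constantCoeff_apply] at this
    exact this ha
  have hle : Nat.find hex ≤ j := Nat.find_min' hex hjne
  have heq : Nat.find hex - 1 + 1 = Nat.find hex := by omega
  refine ⟨w, a, Nat.find hex - 1, by omega, ?_, fun i hi => ?_⟩
  · rw [heq]; exact Nat.find_spec hex
  · rw [heq] at hi; exact not_not.1 (Nat.find_min hex hi)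

theorem arcHom_newtonMap_eq_zero {n : ℕ+} {ζ : Transversal} {g : PS} {w : Weight} {a : ℂ} :
    arcHom n ζ (newtonMap w a g) = 0 ↔ arcHom n ζ (strictTransform g w a) = 0 := by
  rw [← X0_pow_trop_mul_strictTransform, map_mul, map_pow, arcHom_X0, mul_eq_zero,
    or_iff_right (pow_ne_zero _ (pow_ne_zero _ PowerSeries.X_ne_zero))]

/-- Newton-Puiseux theorem: a curve which does not contain `Z(x)` and passes through the origin
contains an arc transversal to `Z(x)`. -/
theorem exists_arc {g : PS} {l : ℕ} (hg : HasYOrder g (l + 1)) :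
    ∃ (n : ℕ+) (ζ : Transversal), arcHom n ζ g = 0 := by
  induction l using Nat.strong_induction_on generalizing g with
  | _ l ih =>
    obtain ⟨φ, hφ⟩ := exists_maximalContact hg
    suffices ∃ (n : ℕ+) (ζ : Transversal), arcHom n ζ (shear φ g) = 0 by
      obtain ⟨n, ζ, h⟩ := this
      exact ⟨n, _, by rwa [arcHom_shear] at h⟩
    by_cases hne : ∃ e : Fin 2 →₀ ℕ, e 1 < l + 1 ∧ MvPowerSeries.coeff e (shear φ g) ≠ 0
    · obtain ⟨w, a, m, hm, hord⟩ := exists_newtonMap_drop (hg.shear φ) hφ hne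
      obtain ⟨n, ζ, h⟩ := ih m hm hord
      exact ⟨_, _, by rwa [← arcHom_newtonMap_eq_zero, arcHom_newtonMap] at h⟩
    · push Not at hne
      refine ⟨1, 0, arcHom_eq_zero_of_X1_dvd 1 ?_⟩
      rw [MvPowerSeries.X_dvd_iff]
      intro e he
      exact hne e (by omega)

/-! ### Factorization after a ramified base change, and norms -/

/-- The base change `g(x, y) ↦ g(x ^ n, y)`. -/
def expandX (n : ℕ+) : PS →ₐ[ℂ] PS :=
  pairHom (MvPowerSeries.X 0 ^ (n : ℕ)) (MvPowerSeries.X 1) (by simp)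
    (MvPowerSeries.constantCoeff_X _)

theorem arcHom_expandX (m n : ℕ+) (ζ : Transversal) (g : PS) :
    arcHom m ζ (expandX n g) = arcHom (m * n) ζ g := by
  rw [arcHom, expandX, pairHom_comp_pairHom]
  refine DFunLike.congr_fun (pairHom_congr _ _ _ _ ?_ (pairHom_X1 _ _)) g
  rw [map_pow, pairHom_X0, ← pow_mul, PNat.mul_coe]

theorem expandX_expandX (m n : ℕ+) (g : PS) : expandX m (expandX n g) = expandX (m * n) g := by
  rw [expandX, expandX, pairHom_comp_pairHom]
  refine DFunLike.congr_fun (pairHom_congr _ _ _ _ ?_ (pairHom_X1 _ _)) g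
  rw [map_pow, pairHom_X0, ← pow_mul, PNat.mul_coe]

theorem expandX_eqn (n : ℕ+) (ζ : Transversal) : expandX n ζ.eqn = (ζ.expand n).eqn := by
  have hX : PowerSeries.HasSubst (MvPowerSeries.X 0 : PS) :=
    PowerSeries.HasSubst.of_constantCoeff_zero (MvPowerSeries.constantCoeff_X _)
  rw [Transversal.eqn, map_sub, expandX, pairHom_X1, pairHom_inX, Transversal.eqn,
    Transversal.inX, Transversal.coe_expand, PowerSeries.expand_apply,
    PowerSeries.subst_comp_subst_apply (PowerSeries.HasSubst.X_pow n.ne_zero) hX,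
    PowerSeries.subst_pow hX, PowerSeries.subst_X hX]

theorem coeff_expandX (n : ℕ+) (e : Fin 2 →₀ ℕ) (g : PS) :
    MvPowerSeries.coeff e (expandX n g) = if (n : ℕ) ∣ e 0 then
      MvPowerSeries.coeff (Finsupp.single 0 (e 0 / n) + Finsupp.single 1 (e 1)) g else 0 := by
  have key : ∀ d : Fin 2 →₀ ℕ, MvPowerSeries.coeff e
      ((MvPowerSeries.X 0 ^ (n : ℕ)) ^ d 0 * MvPowerSeries.X 1 ^ d 1 : PS) =
      if e 0 = n * d 0 ∧ e 1 = d 1 then 1 else 0 := by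
    intro d
    rw [← pow_mul, MvPowerSeries.X_pow_eq, MvPowerSeries.X_pow_eq,
      MvPowerSeries.monomial_mul_monomial, one_mul, MvPowerSeries.coeff_monomial]
    congr 1
    refine propext ⟨fun h => by rw [h]; simp, fun h => exponent_ext (by simp [h.1]) (by simp [h.2])⟩
  rw [expandX, coeff_pairHom]
  simp_rw [key]
  split_ifs with h
  · obtain ⟨k, hk⟩ := h
    have hk' : e 0 / n = k := by rw [hk, Nat.mul_div_cancel_left _ n.pos]
    rw [hk', finsum_eq_single _ (Finsupp.single 0 k + Finsupp.single 1 (e 1))]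
    · simp [hk]
    · intro d hd
      rw [if_neg, mul_zero]
      rintro ⟨h1, h2⟩
      refine hd (exponent_ext ?_ (by simp [h2]))
      rw [hk] at h1
      simpa using (Nat.eq_of_mul_eq_mul_left n.pos h1).symm
  · refine finsum_eq_zero_of_forall_eq_zero fun d => ?_
    rw [if_neg, mul_zero]
    rintro ⟨h1, -⟩
    exact h ⟨_, h1⟩

theorem expandX_injective (n : ℕ+) : Function.Injective (expandX n) := by
  intro f g h
  ext e
  have h1 := congrArg (MvPowerSeries.coeff (Finsupp.single 0 (n * e 0) + Finsupp.single 1 (e 1))) h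
  rw [coeff_expandX, coeff_expandX] at h1
  have h2 : (Finsupp.single 0 (e 0) + Finsupp.single 1 (e 1) : Fin 2 →₀ ℕ) = e :=
    exponent_ext (by simp) (by simp)
  simpa [h2] using h1

theorem HasYOrder.expandX {g : PS} {m : ℕ} (h : HasYOrder g m) (n : ℕ+) :
    HasYOrder (expandX n g) m := by
  have h1 : ∀ j, MvPowerSeries.coeff (Finsupp.single 1 j) (PlaneCurve.expandX n g) =
      MvPowerSeries.coeff (Finsupp.single 1 j) g := by
    intro j; rw [coeff_expandX]; simp
  exact ⟨by rw [h1]; exact h.1, fun j hj => by rw [h1]; exact h.2 j hj⟩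

theorem coeff_arcHom_one_zero (k : ℕ) (g : PS) :
    PowerSeries.coeff k (arcHom 1 0 g) = MvPowerSeries.coeff (Finsupp.single 0 k) g := by
  rw [PowerSeries.coeff, arcHom, coeff_pairHom, finsum_eq_single _ (Finsupp.single 0 k)]
  · have : PowerSeries.coeff k ((PowerSeries.X ^ ((1 : ℕ+) : ℕ)) ^ k *
        (0 : Transversal).1 ^ 0 : PowerSeries ℂ) = 1 := by simp
    have h2 : MvPowerSeries.coeff (Finsupp.single () k) ((PowerSeries.X ^ ((1 : ℕ+) : ℕ)) ^ k *
        (0 : Transversal).1 ^ 0 : PowerSeries ℂ) = 1 := this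
    simp only [Finsupp.single_eq_same]
    rw [show (Finsupp.single (0 : Fin 2) k : Fin 2 →₀ ℕ) 1 = 0 by simp, h2, mul_one]
  · intro d hd
    by_cases h1 : d 1 = 0
    · have h0 : d 0 ≠ k := fun h0 => hd (exponent_ext (by simp [h0]) (by simp [h1]))
      have h2 : PowerSeries.coeff k ((PowerSeries.X ^ ((1 : ℕ+) : ℕ)) ^ d 0 *
        (0 : Transversal).1 ^ d 1 : PowerSeries ℂ) = 0 := by
        simp [h1, PowerSeries.coeff_X_pow, h0.symm]
      have h3 : MvPowerSeries.coeff (Finsupp.single () k)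
        ((PowerSeries.X ^ ((1 : ℕ+) : ℕ)) ^ d 0 * (0 : Transversal).1 ^ d 1 : PowerSeries ℂ) = 0 := h2
      rw [h3, mul_zero]
    · rw [Transversal.coe_zero, zero_pow h1, mul_zero, map_zero, mul_zero]

theorem shear_neg_shear (φ : Transversal) (g : PS) : shear (-φ) (shear φ g) = g := by
  rw [shear_shear, Transversal.add_neg_self, shear_zero]

theorem shear_neg_X1 (φ : Transversal) : shear (-φ) (MvPowerSeries.X 1) = φ.eqn := by
  have h : (-φ).inX = -φ.inX := by
    have := Transversal.inX_add (-φ) φ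
    rw [Transversal.neg_add_self, Transversal.inX_zero] at this
    exact eq_neg_of_add_eq_zero_left this.symm
  rw [shear_eq, pairHom_X1, h, Transversal.eqn, sub_eq_add_neg]

theorem eqn_dvd_iff {φ : Transversal} {g : PS} : φ.eqn ∣ g ↔ arcHom 1 φ g = 0 := by
  constructor
  · rintro ⟨h, rfl⟩
    rw [map_mul, Transversal.eqn, map_sub, arcHom_X1, arcHom_inX, Transversal.expand_one, sub_self,
      zero_mul]
  · intro h
    have h0 : arcHom 1 0 (shear φ g) = 0 := by
      rw [arcHom_shear, Transversal.expand_one, show φ + 0 = φ from Subtype.ext (by simp), h]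
    have h1 : (MvPowerSeries.X 1 : PS) ∣ shear φ g := by
      rw [MvPowerSeries.X_dvd_iff]
      intro e he
      rw [show e = Finsupp.single 0 (e 0) from exponent_ext (by simp) (by simp [he]),
        ← coeff_arcHom_one_zero, h0, map_zero]
    have := map_dvd (shear (-φ)) h1
    rwa [shear_neg_shear, shear_neg_X1] at this

theorem coeff_single_eqn_mul (φ : Transversal) (j : ℕ) (g : PS) :
    MvPowerSeries.coeff (Finsupp.single 1 j) (φ.eqn * g) =
      if j = 0 then 0 else MvPowerSeries.coeff (Finsupp.single 1 (j - 1)) g := by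
  have h0 : (MvPowerSeries.X 0 : PS) ∣ φ.inX := by
    rw [MvPowerSeries.X_dvd_iff]
    intro e he
    rw [Transversal.inX, coeff_subst_X0, he, PowerSeries.coeff_zero_eq_constantCoeff_apply, φ.2,
      ite_self]
  have h1 : MvPowerSeries.coeff (Finsupp.single 1 j) (φ.inX * g) = 0 :=
    MvPowerSeries.X_dvd_iff.1 (h0.mul_right g) _ (by simp)
  have h2 := coeff_X1_pow_mul_eq 1 (Finsupp.single 1 j) g
  rw [pow_one] at h2
  rw [Transversal.eqn, sub_mul, map_sub, h1, sub_zero, h2]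
  rcases Nat.eq_zero_or_pos j with h | h
  · simp [h]
  · rw [if_pos (by simp only [Finsupp.single_eq_same]; omega), if_neg h.ne', ← Finsupp.single_tsub]

theorem HasYOrder.of_eqn_mul {φ : Transversal} {g : PS} {m : ℕ}
    (h : HasYOrder (φ.eqn * g) (m + 1)) : HasYOrder g m := by
  constructor
  · have := h.1
    rw [coeff_single_eqn_mul] at this
    simpa using this
  · intro j hj
    have := h.2 (j + 1) (by omega)
    rw [coeff_single_eqn_mul] at this
    simpa using this

/-- After a ramified base change `x ↦ x ^ N`, a curve which does not contain `Z(x)` is a union of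
smooth branches transversal to `Z(x)`. -/
theorem exists_factorization {f : PS} {m : ℕ} (hf : HasYOrder f m) :
    ∃ (N : ℕ+) (u : PS) (l : List Transversal), IsUnit u ∧
      expandX N f = u * (l.map Transversal.eqn).prod := by
  induction m generalizing f with
  | zero =>
    refine ⟨1, expandX 1 f, [], ?_, by simp⟩
    rw [MvPowerSeries.isUnit_iff_constantCoeff, isUnit_iff_ne_zero]
    have := (hf.expandX 1).1
    rwa [Finsupp.single_zero, MvPowerSeries.coeff_zero_eq_constantCoeff_apply] at this
  | succ m ih =>
    obtain ⟨n, ζ, h⟩ := exists_arc hf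
    have h1 : arcHom 1 ζ (expandX n f) = 0 := by rw [arcHom_expandX, one_mul, h]
    obtain ⟨g, hg⟩ := eqn_dvd_iff.2 h1
    have h2 := hf.expandX n
    rw [hg] at h2
    obtain ⟨N, u, l, hu, hl⟩ := ih h2.of_eqn_mul
    refine ⟨N * n, u, ζ.expand N :: l, hu, ?_⟩
    rw [← expandX_expandX, hg, map_mul, hl, expandX_eqn, List.map_cons, List.prod_cons]
    ring

/-- The rotation `g(x, y) ↦ g(ω x, y)`. -/
def rotX (ω : ℂ) : PS →+* PS := MvPowerSeries.rescale ![ω, 1]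

theorem coeff_rotX (ω : ℂ) (e : Fin 2 →₀ ℕ) (g : PS) :
    MvPowerSeries.coeff e (rotX ω g) = ω ^ e 0 * MvPowerSeries.coeff e g := by
  rw [rotX, MvPowerSeries.coeff_rescale, Finsupp.prod_fintype _ _ (by simp), Fin.prod_univ_two]
  simp

theorem rotX_rotX (ω ω' : ℂ) (g : PS) : rotX ω (rotX ω' g) = rotX (ω * ω') g := by
  ext e
  rw [coeff_rotX, coeff_rotX, coeff_rotX, mul_pow, mul_assoc]

theorem rotX_expandX {ω : ℂ} {n : ℕ+} (hω : ω ^ (n : ℕ) = 1) (g : PS) :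
    rotX ω (expandX n g) = expandX n g := by
  ext e
  rw [coeff_rotX, coeff_expandX]
  split_ifs with h
  · obtain ⟨k, hk⟩ := h
    rw [hk, pow_mul, hω, one_pow, one_mul]
  · rw [mul_zero]

theorem rotX_eqn (ω : ℂ) (ζ : Transversal) : rotX ω ζ.eqn = (ζ.rot ω).eqn := by
  ext e
  rw [coeff_rotX, Transversal.eqn, Transversal.eqn, map_sub, map_sub, Transversal.inX,
    Transversal.inX, coeff_subst_X0, coeff_subst_X0, Transversal.coe_rot, PowerSeries.coeff_rescale,
    MvPowerSeries.coeff_X, mul_sub]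
  congr 1
  · split_ifs with h
    · simp [h]
    · simp
  · split_ifs <;> simp

/-- The set of `n`-th roots of unity. -/
def unityRoots (n : ℕ+) : Finset ℂ := Polynomial.nthRootsFinset (n : ℕ) (1 : ℂ)

theorem mem_unityRoots {n : ℕ+} {ω : ℂ} : ω ∈ unityRoots n ↔ ω ^ (n : ℕ) = 1 :=
  Polynomial.mem_nthRootsFinset n.pos 1

theorem exists_expandX_eq {n : ℕ+} {g : PS} (h : ∀ ω ∈ unityRoots n, rotX ω g = g) :
    ∃ g', expandX n g' = g := by
  have hω := Complex.isPrimitiveRoot_exp n n.ne_zero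
  set ω := Complex.exp (2 * Real.pi * Complex.I / (n : ℕ)) with hωdef
  obtain ⟨g', hg'⟩ : ∃ g' : PS, ∀ e, MvPowerSeries.coeff e g' =
      MvPowerSeries.coeff (Finsupp.single 0 (n * e 0) + Finsupp.single 1 (e 1)) g :=
    ⟨fun e => MvPowerSeries.coeff (Finsupp.single 0 (n * e 0) + Finsupp.single 1 (e 1)) g,
      fun _ => rfl⟩
  refine ⟨g', ?_⟩
  ext e
  have h1 := congrArg (MvPowerSeries.coeff e) (h ω (mem_unityRoots.2 hω.pow_eq_one))
  rw [coeff_rotX] at h1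
  rw [coeff_expandX]
  split_ifs with h2
  · rw [hg']
    congr 2
    refine exponent_ext ?_ (by simp)
    simp [Nat.mul_div_cancel' h2]
  · by_contra h3
    refine h2 (hω.dvd_of_pow_eq_one _ ?_)
    exact (mul_eq_right₀ (Ne.symm h3)).1 h1

theorem exists_norm (n : ℕ+) (g : PS) :
    ∃ g', expandX n g' = ∏ ω ∈ unityRoots n, rotX ω g := by
  refine exists_expandX_eq fun ω hω => ?_
  rw [mem_unityRoots] at hω
  have hω0 : ω ≠ 0 := by rintro rfl; simp at hω
  rw [map_prod]
  refine Finset.prod_nbij' (fun θ => ω * θ) (fun θ => ω⁻¹ * θ) ?_ ?_ ?_ ?_ ?_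
  · intro θ hθ; rw [mem_unityRoots] at hθ ⊢; rw [mul_pow, hω, hθ, one_mul]
  · intro θ hθ; rw [mem_unityRoots] at hθ ⊢; rw [mul_pow, inv_pow, hω, hθ, inv_one, one_mul]
  · intro θ _; simp [hω0]
  · intro θ _; simp [hω0]
  · intro θ _; rw [rotX_rotX]

/-- The norm of `g` relative to the base change `expandX n`: the series which becomes the product
of the conjugates of `g`. -/
def normX (n : ℕ+) (g : PS) : PS := (exists_norm n g).choose

theorem expandX_normX (n : ℕ+) (g : PS) :
    expandX n (normX n g) = ∏ ω ∈ unityRoots n, rotX ω g := (exists_norm n g).choose_spec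

theorem normX_mul (n : ℕ+) (g h : PS) : normX n (g * h) = normX n g * normX n h := by
  apply expandX_injective n
  rw [map_mul, expandX_normX, expandX_normX, expandX_normX, ← Finset.prod_mul_distrib]
  simp

theorem normX_one (n : ℕ+) : normX n 1 = 1 := by
  apply expandX_injective n
  rw [expandX_normX, map_one]
  simp

theorem normX_expandX (n : ℕ+) (g : PS) :
    normX n (expandX n g) = g ^ (unityRoots n).card := by
  apply expandX_injective n
  rw [expandX_normX, map_pow, Finset.prod_congr rfl fun ω hω =>
    rotX_expandX (mem_unityRoots.1 hω) g, Finset.prod_const]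

theorem normX_list_prod (n : ℕ+) (l : List PS) : normX n l.prod = (l.map (normX n)).prod := by
  induction l with
  | nil => simp [normX_one]
  | cons a l ih => simp [normX_mul, ih]

theorem isUnit_normX (n : ℕ+) {u : PS} (hu : IsUnit u) : IsUnit (normX n u) := by
  obtain ⟨v, hv⟩ := isUnit_iff_exists_inv.1 hu
  exact IsUnit.of_mul_eq_one (normX n v) (by rw [← normX_mul, hv, normX_one])

theorem arcHom_normX_eqn (n m : ℕ+) (ζ ξ : Transversal) :
    PowerSeries.expand n n.ne_zero (arcHom m ξ (normX n ζ.eqn)) =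
      ∏ ω ∈ unityRoots n, ((ξ.expand n).1 - ((ζ.rot ω).expand m).1) := by
  rw [expand_arcHom, ← arcHom_expandX, expandX_normX, map_prod]
  refine Finset.prod_congr rfl fun ω _ => ?_
  rw [rotX_eqn, Transversal.eqn, map_sub, arcHom_X1, arcHom_inX]

theorem arcHom_normX_eqn_eq_zero (n m : ℕ+) (ζ ξ : Transversal) :
    arcHom m ξ (normX n ζ.eqn) = 0 ↔
      ∃ ω : ℂ, ω ^ (n : ℕ) = 1 ∧ ξ.expand n = (ζ.rot ω).expand m := by
  rw [← map_eq_zero_iff _ (expand_injective n), arcHom_normX_eqn, Finset.prod_eq_zero_iff]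
  simp only [mem_unityRoots, sub_eq_zero, Subtype.ext_iff]

theorem Transversal.rot_one (ζ : Transversal) : ζ.rot 1 = ζ := Subtype.ext (by simp)

theorem normX_eqn_mem (n : ℕ+) (ζ : Transversal) : normX n ζ.eqn ∈ arcIdeal n ζ := by
  rw [mem_arcIdeal, arcHom_normX_eqn_eq_zero]
  exact ⟨1, one_pow _, by rw [Transversal.rot_one]⟩

theorem normX_eqn_dvd_of_mem {n : ℕ+} {ζ : Transversal} {g : PS} (h : g ∈ arcIdeal n ζ) :
    normX n ζ.eqn ∣ g ^ (unityRoots n).card := by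
  rw [mem_arcIdeal] at h
  have h1 : ζ.eqn ∣ expandX n g := by rw [eqn_dvd_iff, arcHom_expandX, one_mul, h]
  obtain ⟨k, hk⟩ := h1
  rw [← normX_expandX, hk, normX_mul]
  exact dvd_mul_right _ _

theorem arcIdeal_le_of_normX_mem {n : ℕ+} {ζ : Transversal} {P : Ideal PS} (hP : P.IsPrime)
    (h : normX n ζ.eqn ∈ P) : arcIdeal n ζ ≤ P := fun _ hg =>
  hP.mem_of_pow_mem _ (Ideal.mem_of_dvd P (normX_eqn_dvd_of_mem hg) h)

/-- Two arcs on the same branch are conjugate. -/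
theorem exists_conj_of_le {n m : ℕ+} {ζ ξ : Transversal} (h : arcIdeal n ζ ≤ arcIdeal m ξ) :
    ∃ ω : ℂ, ω ^ (n : ℕ) = 1 ∧ ξ.expand n = (ζ.rot ω).expand m :=
  (arcHom_normX_eqn_eq_zero n m ζ ξ).1 (mem_arcIdeal.1 (h (normX_eqn_mem n ζ)))

theorem arcIdeal_eq_of_le {n m : ℕ+} {ζ ξ : Transversal} (h : arcIdeal n ζ ≤ arcIdeal m ξ) :
    arcIdeal n ζ = arcIdeal m ξ := by
  obtain ⟨ω, hω, h1⟩ := exists_conj_of_le h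
  rw [← arcIdeal_expand n m ξ, h1, mul_comm, arcIdeal_expand, arcIdeal_rot n hω]

/-- Every prime ideal containing `f` contains the ideal of an arc of `Z(f)`. -/
theorem exists_arcIdeal_le {f : PS} (hf : ¬ (MvPowerSeries.X 0 : PS) ∣ f) {P : Ideal PS}
    (hP : P.IsPrime) (hfP : f ∈ P) :
    ∃ (n : ℕ+) (ζ : Transversal), f ∈ arcIdeal n ζ ∧ arcIdeal n ζ ≤ P := by
  obtain ⟨m, hm⟩ := exists_hasYOrder hf
  obtain ⟨N, u, l, hu, hl⟩ := exists_factorization hm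
  have hcard : (unityRoots N).card ≠ 0 :=
    Finset.card_ne_zero_of_mem (mem_unityRoots.2 (one_pow (N : ℕ)))
  have h1 : normX N (expandX N f) ∈ P := by
    rw [normX_expandX]; exact Ideal.pow_mem_of_mem P hfP _ (Nat.pos_of_ne_zero hcard)
  rw [hl, normX_mul, normX_list_prod] at h1
  have h2 := (hP.mem_or_mem h1).resolve_left fun h =>
    hP.ne_top (Ideal.eq_top_of_isUnit_mem P h (isUnit_normX N hu))
  have h3 : ∀ L : List PS, L.prod ∈ P → ∃ a ∈ L, a ∈ P := by
    intro L
    induction L with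
    | nil => intro h; exact absurd ((Ideal.eq_top_iff_one P).2 h) hP.ne_top
    | cons a L ih =>
      intro h
      rw [List.prod_cons] at h
      rcases hP.mem_or_mem h with h | h
      · exact ⟨a, by simp, h⟩
      · obtain ⟨b, hb, hbP⟩ := ih h
        exact ⟨b, by simp [hb], hbP⟩
  obtain ⟨a, ha, haP⟩ := h3 _ h2
  simp only [List.map_map, List.mem_map, Function.comp] at ha
  obtain ⟨ζ, hζ, rfl⟩ := ha
  refine ⟨N, ζ, ?_, arcIdeal_le_of_normX_mem hP haP⟩
  have h4 : ζ.eqn ∣ expandX N f := by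
    rw [hl]
    exact (List.dvd_prod (List.mem_map_of_mem hζ)).mul_left _
  rwa [eqn_dvd_iff, arcHom_expandX, one_mul] at h4

theorem arcIdeal_mem_minimalPrimes {f : PS} (hf : ¬ (MvPowerSeries.X 0 : PS) ∣ f) {n : ℕ+}
    {ζ : Transversal} (h : f ∈ arcIdeal n ζ) : arcIdeal n ζ ∈ (Ideal.span {f}).minimalPrimes := by
  refine ⟨⟨inferInstance, by simpa [Ideal.span_le] using h⟩, fun Q hQ hle => ?_⟩
  obtain ⟨m, ξ, -, h2⟩ := exists_arcIdeal_le hf hQ.1 (hQ.2 (Ideal.mem_span_singleton_self f))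
  rw [← arcIdeal_eq_of_le (h2.trans hle)]
  exact h2

theorem exists_arcIdeal_eq {f : PS} (hf : ¬ (MvPowerSeries.X 0 : PS) ∣ f) {P : Ideal PS}
    (hP : P ∈ (Ideal.span {f}).minimalPrimes) :
    ∃ (n : ℕ+) (ζ : Transversal), f ∈ arcIdeal n ζ ∧ P = arcIdeal n ζ := by
  obtain ⟨n, ζ, h1, h2⟩ := exists_arcIdeal_le hf hP.1.1 (hP.1.2 (Ideal.mem_span_singleton_self f))
  exact ⟨n, ζ, h1, le_antisymm (hP.2 ⟨inferInstance, by simpa [Ideal.span_le] using h1⟩ h2) h2⟩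

/-! ### The branches of the completion -/

/-- `Z(g)` passes through the origin and does not contain `Z(x)`. -/
structure IsCurve (g : PS) : Prop where
  zero : MvPowerSeries.constantCoeff g = 0
  not_dvd : ¬ (MvPowerSeries.X 0 : PS) ∣ g

theorem IsCurve.ne_zero {g : PS} (h : IsCurve g) : g ≠ 0 := by
  rintro rfl; exact h.not_dvd (dvd_zero _)

theorem IsCurve.shear {g : PS} (h : IsCurve g) (φ : Transversal) : IsCurve (shear φ g) := by
  refine ⟨?_, ?_⟩
  · rw [shear_eq, constantCoeff_pairHom, h.zero]
  · rw [not_X0_dvd_iff]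
    obtain ⟨j, hj⟩ := not_X0_dvd_iff.1 h.not_dvd
    exact ⟨j, by rwa [coeff_single_shear]⟩

theorem Point.ne_zero {g : PS} (p : Point g) {a : ℂ} (ha : a ^ p.w.c = p.v) : a ≠ 0 := by
  rintro rfl
  rw [zero_pow p.w.c_pos.ne'] at ha
  exact p.v_ne_zero ha.symm

theorem IsCurve.strictTransform {g : PS} (h : IsCurve g) (p : Point g) {a : ℂ}
    (ha : a ^ p.w.c = p.v) : IsCurve (strictTransform g p.w a) := by
  obtain ⟨b, hb, hb0⟩ := p.mem
  exact ⟨constantCoeff_strictTransform_eq_zero (p.ne_zero hb) (hb.trans ha.symm) hb0,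
    not_X0_dvd_strictTransform h.ne_zero _ _⟩

theorem span_eqn (φ : Transversal) : Ideal.span {φ.eqn} = arcIdeal 1 φ := by
  ext g
  rw [Ideal.mem_span_singleton, eqn_dvd_iff, mem_arcIdeal]

/-- If the algorithm stops at once, then `Z(f)` is a smooth branch transversal to `Z(x)`, by the
implicit function theorem. -/
theorem IsCross.exists_arcIdeal {f : PS} (h : IsCross f) :
    ∃ φ : Transversal, Ideal.span {f} = arcIdeal 1 φ := by
  have hord : HasYOrder f (0 + 1) := by
    refine ⟨h.2, fun j hj => ?_⟩
    obtain rfl : j = 0 := by omega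
    rw [Finsupp.single_zero, MvPowerSeries.coeff_zero_eq_constantCoeff_apply, h.1]
  obtain ⟨φ, hφ⟩ := exists_maximalContact hord
  have h0 : arcHom 1 φ f = 0 := by
    have : arcHom 1 0 (PlaneCurve.shear φ f) = 0 := by
      ext k
      rw [coeff_arcHom_one_zero, map_zero]
      simpa using hφ k
    rwa [arcHom_shear, Transversal.expand_one,
      show φ + 0 = φ from Subtype.ext (by simp)] at this
  obtain ⟨u, hu⟩ := eqn_dvd_iff.2 h0
  have h1 : IsUnit u := by
    rw [MvPowerSeries.isUnit_iff_constantCoeff, isUnit_iff_ne_zero]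
    have := hord.1
    rw [hu, coeff_single_eqn_mul] at this
    simpa using this
  refine ⟨φ, ?_⟩
  rw [← span_eqn, hu, Ideal.span_singleton_mul_right_unit h1]

section

variable {f : PS} {h : ¬ IsCross f} {φ : Transversal} {root : Point (shear φ f) → ℂ}
    {root_pow : ∀ p, root p ^ p.w.c = p.v}
    {next : ∀ p : Point (shear φ f), Run (strictTransform (shear φ f) p.w (root p))}

theorem label_finish (h : IsCross f) :
    label (Node.top (r := Run.finish h)) = Ideal.span {f} := by simp only [label]

theorem label_top :
    label (Node.top (r := Run.step h φ root root_pow next)) = arcIdeal 1 φ := by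
  rw [← span_eqn]; simp only [label]

theorem label_sub (p : Point (shear φ f)) (i : Node (next p)) :
    label (Node.sub (h := h) (root_pow := root_pow) p i) =
      (label i).comap (pullback φ p.w (root p)) := by simp only [label]

end

theorem exists_label_eq_arcIdeal {f : PS} {r : Run f} (i : Node r) :
    ∃ (n : ℕ+) (ζ : Transversal), label i = arcIdeal n ζ := by
  induction i with
  | @top f r =>
    cases r with
    | finish h =>
      obtain ⟨φ, hφ⟩ := h.exists_arcIdeal
      exact ⟨1, φ, by rw [label_finish, hφ]⟩
    | step h φ root root_pow next => exact ⟨1, φ, label_top⟩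
  | sub p i ih =>
    obtain ⟨n, ζ, hi⟩ := ih
    exact ⟨_, _, by rw [label_sub, hi, comap_pullback_arcIdeal]⟩

theorem pullback_eq (f : PS) (φ : Transversal) (w : Weight) (a : ℂ) :
    pullback φ w a f =
      MvPowerSeries.X 0 ^ trop (shear φ f) w * strictTransform (shear φ f) w a := by
  rw [X0_pow_trop_mul_strictTransform, pullback, AlgHom.comp_apply]

/-- At the crosses where the algorithm stops, the branch is a component of the curve. -/
theorem mem_label_of_not_isStep {f : PS} {r : Run f} (i : Node r) (hi : ¬ IsStep i) :
    f ∈ label i := by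
  induction i with
  | @top f r =>
    cases r with
    | finish h => rw [label_finish]; exact Ideal.mem_span_singleton_self f
    | step h φ root root_pow next => exact absurd (by simp only [IsStep]) hi
  | sub p i ih =>
    rw [label_sub, Ideal.mem_comap, pullback_eq]
    exact Ideal.mul_mem_left _ _ (ih (by simpa only [IsStep] using hi))

/-- The action of `σ` on the pairs (ramification, leading coefficient) of arcs: as `c` and `d` are
coprime, the `c`-th root of unity `θ` is the effect on the leading coefficient of the conjugation
by some `σ` of order dividing the ramification `c q`. -/
theorem exists_root_of_unity {θ : ℂ} {c d q : ℕ} (hc : 0 < c) (hq : 0 < q)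
    (hcop : Nat.Coprime c d) (hθ : θ ^ c = 1) : ∃ σ : ℂ, σ ^ (c * q) = 1 ∧ σ ^ (d * q) = θ := by
  have hθ0 : θ ≠ 0 := by rintro rfl; simp [hc.ne'] at hθ
  obtain ⟨σ, hσ⟩ := IsAlgClosed.exists_pow_nat_eq (θ ^ (Nat.gcdB c d)) hq
  have hb := Nat.gcd_eq_gcd_ab c d
  rw [hcop.gcd_eq_one, Nat.cast_one] at hb
  have hθz : θ ^ (c : ℤ) = 1 := by rw [zpow_natCast, hθ]
  refine ⟨σ, ?_, ?_⟩
  · rw [mul_comm, pow_mul, hσ, ← zpow_natCast, ← zpow_mul, mul_comm, zpow_mul, hθz, one_zpow]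
  · rw [mul_comm, pow_mul, hσ, ← zpow_natCast, ← zpow_mul, mul_comm]
    have : θ ^ ((d : ℤ) * Nat.gcdB c d) = θ ^ ((c : ℤ) * Nat.gcdA c d + d * Nat.gcdB c d) := by
      rw [zpow_add₀ hθ0, zpow_mul θ (c : ℤ), hθz, one_zpow, one_mul]
    rw [this, ← hb, zpow_one]

theorem Transversal.rot_add (ω : ℂ) (φ ψ : Transversal) :
    (φ + ψ).rot ω = φ.rot ω + ψ.rot ω := Subtype.ext (by simp)

theorem Transversal.rot_expand {ω : ℂ} {n : ℕ+} (hω : ω ^ (n : ℕ) = 1) (φ : Transversal) :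
    (φ.expand n).rot ω = φ.expand n := by
  apply Subtype.ext
  ext k
  rw [coe_rot, PowerSeries.coeff_rescale, coe_expand, PowerSeries.coeff_expand]
  split_ifs with h
  · obtain ⟨j, rfl⟩ := h
    rw [pow_mul, hω, one_pow, one_mul]
  · rw [mul_zero]

/-- A non zero arc is `t ^ k (b + ξ(t))` with `b ≠ 0`. -/
theorem Transversal.exists_eq_blowDown {ζ : Transversal} (h : ζ ≠ 0) :
    ∃ (k : ℕ+) (b : ℂ) (ξ : Transversal), b ≠ 0 ∧ ζ = ξ.blowDown k b := by
  have h0 : ζ.1 ≠ 0 := fun h0 => h (Subtype.ext h0)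
  obtain ⟨u, hu⟩ := PowerSeries.X_pow_order_dvd (φ := ζ.1)
  set k := ζ.1.order.toNat with hk
  have hb : PowerSeries.constantCoeff u ≠ 0 := by
    have := PowerSeries.coeff_order h0
    have h1 := PowerSeries.coeff_X_pow_mul u k 0
    rw [zero_add, PowerSeries.coeff_zero_eq_constantCoeff_apply] at h1
    rwa [← hk, hu, h1] at this
  have hk0 : 0 < k := by
    rcases Nat.eq_zero_or_pos k with h1 | h1
    · rw [h1, pow_zero, one_mul] at hu
      exact absurd (hu ▸ ζ.2) hb
    · exact h1
  obtain ⟨k', hk'⟩ : ∃ k' : ℕ+, (k' : ℕ) = k := ⟨⟨k, hk0⟩, rfl⟩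
  refine ⟨k', _, ⟨u - PowerSeries.C (PowerSeries.constantCoeff u), by simp⟩, hb, ?_⟩
  apply Subtype.ext
  rw [coe_blowDown, hk']
  simpa using hu

theorem rescale_C (ω b : ℂ) : PowerSeries.rescale ω (PowerSeries.C b) = PowerSeries.C b := by
  ext j
  rw [PowerSeries.coeff_rescale, PowerSeries.coeff_C]
  split_ifs with h <;> simp [h]

theorem Transversal.exists_rot_blowDown (σ : ℂ) (k : ℕ+) (b : ℂ) (ξ : Transversal) :
    ∃ ξ' : Transversal, (ξ.blowDown k b).rot σ = ξ'.blowDown k (σ ^ (k : ℕ) * b) := by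
  refine ⟨⟨PowerSeries.C (σ ^ (k : ℕ)) * (ξ.rot σ).1, by rw [map_mul, (ξ.rot σ).2, mul_zero]⟩, ?_⟩
  apply Subtype.ext
  simp only [coe_rot, coe_blowDown, map_mul, map_add, map_pow, PowerSeries.rescale_X, rescale_C]
  ring

/-- Every arc contained in `Z(f)` lies on the branch of one of the crosses: the execution of the
algorithm lifts the arc until it becomes a chosen branch. -/
theorem exists_label_eq {f : PS} (r : Run f) (hf : IsCurve f) {n : ℕ+} {ζ : Transversal}
    (hζ : f ∈ arcIdeal n ζ) : ∃ i : Node r, label i = arcIdeal n ζ := by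
  induction r generalizing n ζ with
  | finish h =>
    refine ⟨Node.top, ?_⟩
    obtain ⟨φ, hφ⟩ := h.exists_arcIdeal
    rw [label_finish, hφ]
    exact arcIdeal_eq_of_le (by rw [← hφ]; simpa [Ideal.span_le] using hζ)
  | @step f h φ root root_pow next ih =>
    set ζ' : Transversal := -φ.expand n + ζ with hζ'
    have hsum : φ.expand n + ζ' = ζ := Subtype.ext (by simp [hζ'])
    have hg : arcHom n ζ' (shear φ f) = 0 := by
      rw [arcHom_shear, hsum]; exact mem_arcIdeal.1 hζ
    by_cases h0 : ζ' = 0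
    · refine ⟨Node.top, ?_⟩
      rw [label_top, ← hsum, h0, show φ.expand n + 0 = φ.expand n from Subtype.ext (by simp),
        ← arcIdeal_expand n 1 φ, one_mul]
    obtain ⟨k, b, ξ, hb, hξ⟩ := Transversal.exists_eq_blowDown h0
    obtain ⟨q, c, d, hq, hcop, hc, hd⟩ := Nat.exists_coprime' (m := n) (n := k)
      (Nat.gcd_pos_of_pos_right _ k.pos)
    have hc0 : 0 < c := Nat.pos_of_ne_zero (by rintro rfl; have := n.pos; omega)
    have hd0 : 0 < d := Nat.pos_of_ne_zero (by rintro rfl; have := k.pos; omega)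
    let w : Weight := ⟨c, d, hc0, hd0, hcop⟩
    let q' : ℕ+ := ⟨q, hq⟩
    have hn : q' * w.cP = n := PNat.eq (by rw [PNat.mul_coe, hc, mul_comm]; rfl)
    have hk : q' * w.dP = k := PNat.eq (by rw [PNat.mul_coe, hd, mul_comm]; rfl)
    have hlift : ∀ (a : ℂ) (ξ' : Transversal), arcHom q' ξ' (strictTransform (shear φ f) w a) = 0 ↔
        arcHom n (ξ'.blowDown k a) (shear φ f) = 0 := by
      intro a ξ'
      rw [← arcHom_newtonMap_eq_zero, arcHom_newtonMap, hn, hk]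
    have hst : MvPowerSeries.constantCoeff (strictTransform (shear φ f) w b) = 0 := by
      rw [← constantCoeff_arcHom q' ξ, (hlift b ξ).2 (by rw [← hξ, hg]), map_zero]
    let p : Point (shear φ f) := ⟨w, b ^ c, isNewtonRay_of_constantCoeff (hf.shear φ).ne_zero w hb
      hst, pow_ne_zero _ hb, b, rfl, hst⟩
    have hrp : root p ^ c = b ^ c := root_pow p
    obtain ⟨σ, hσn, hσk⟩ := exists_root_of_unity (θ := root p / b) hc0 hq hcop
      (by rw [div_pow, hrp, div_self (pow_ne_zero _ hb)])
    rw [← hc] at hσn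
    rw [← hd] at hσk
    -- The conjugate arc has the prescribed leading coefficient `root p`.
    obtain ⟨ξ', hrot⟩ := Transversal.exists_rot_blowDown σ k b ξ
    rw [hσk, div_mul_cancel₀ _ hb, ← hξ] at hrot
    have hmem : strictTransform (shear φ f) p.w (root p) ∈ arcIdeal q' ξ' := by
      rw [mem_arcIdeal]
      refine (hlift (root p) ξ').2 ?_
      rw [← hrot, ← rescale_arcHom n hσn, hg, map_zero]
    obtain ⟨i, hi⟩ := ih p ((hf.shear φ).strictTransform p (root_pow p)) hmem
    refine ⟨Node.sub p i, ?_⟩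
    rw [label_sub, hi, comap_pullback_arcIdeal]
    change arcIdeal (q' * w.cP) (φ.expand (q' * w.cP) + ξ'.blowDown (q' * w.dP) (root p)) = _
    rw [hn, hk, ← arcIdeal_rot n hσn ζ, ← hsum, Transversal.rot_add,
      Transversal.rot_expand hσn]
    rw [hrot]

/-- The branches of the completion are the branches `B_i` of the crosses. -/
theorem completion_eq {f : PS} (r : Run f) (hf : IsCurve f) :
    completion r = Set.range (label (r := r)) := by
  apply Set.Subset.antisymm
  · rintro P (hP | ⟨i, -, rfl⟩)
    · obtain ⟨n, ζ, h1, rfl⟩ := exists_arcIdeal_eq hf.not_dvd hP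
      exact exists_label_eq r hf h1
    · exact ⟨i, rfl⟩
  · rintro _ ⟨i, rfl⟩
    by_cases hi : IsStep i
    · exact Or.inr ⟨i, hi, rfl⟩
    · refine Or.inl ?_
      have h1 := mem_label_of_not_isStep i hi
      obtain ⟨n, ζ, h2⟩ := exists_label_eq_arcIdeal i
      rw [h2] at h1 ⊢
      exact arcIdeal_mem_minimalPrimes hf.not_dvd h1

/-! ### Newton-Puiseux roots and orders of coincidence -/

theorem puiseux_coeff (n : ℕ+) (ζ : PowerSeries ℂ) (k : ℕ) :
    (puiseux n ζ).coeff ((k : ℚ) / (n : ℚ)) = PowerSeries.coeff k ζ := by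
  have : (k : ℚ) / (n : ℚ) = divEmb n k := rfl
  rw [puiseux, this, HahnSeries.embDomain_coeff, HahnSeries.coeff_toPowerSeries_symm]

theorem puiseux_coeff_of_ne (n : ℕ+) (ζ : PowerSeries ℂ) {q : ℚ}
    (h : ∀ k : ℕ, q ≠ (k : ℚ) / (n : ℚ)) : (puiseux n ζ).coeff q = 0 := by
  rw [puiseux, HahnSeries.embDomain_of_notMem_range]
  rintro ⟨k, rfl⟩
  exact h k rfl

theorem puiseux_injective (n : ℕ+) : Function.Injective (puiseux n) := fun _ _ h =>
  HahnSeries.toPowerSeries.symm.injective (HahnSeries.embDomain_injective h)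

theorem puiseux_sub (n : ℕ+) (a b : PowerSeries ℂ) :
    puiseux n a - puiseux n b = puiseux n (a - b) := by
  rw [sub_eq_iff_eq_add]
  simp only [puiseux]
  rw [← HahnSeries.embDomain_add, ← map_add, sub_add_cancel]

theorem puiseux_zero (n : ℕ+) : puiseux n 0 = 0 := by
  simp only [puiseux, map_zero, HahnSeries.embDomain_zero]

theorem puiseux_expand (n m : ℕ+) (ζ : PowerSeries ℂ) :
    puiseux (n * m) (PowerSeries.expand m m.ne_zero ζ) = puiseux n ζ := by
  have hn : (n : ℚ) ≠ 0 := by exact_mod_cast n.ne_zero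
  have hm : (m : ℚ) ≠ 0 := by exact_mod_cast m.ne_zero
  have hk : ∀ k : ℕ, (k : ℚ) / (n : ℚ) = ((m * k : ℕ) : ℚ) / ((n * m : ℕ+) : ℚ) := by
    intro k; push_cast; field_simp
  ext q
  by_cases h : ∃ k : ℕ, q = (k : ℚ) / (n : ℚ)
  · obtain ⟨k, rfl⟩ := h
    rw [puiseux_coeff, hk, puiseux_coeff, PowerSeries.coeff_expand_mul]
  · push Not at h
    rw [puiseux_coeff_of_ne n ζ h]
    by_cases h' : ∃ k : ℕ, q = (k : ℚ) / ((n * m : ℕ+) : ℚ)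
    · obtain ⟨k, rfl⟩ := h'
      rw [puiseux_coeff, PowerSeries.coeff_expand_of_not_dvd]
      rintro ⟨j, rfl⟩
      exact h j (hk j).symm
    · push Not at h'
      rw [puiseux_coeff_of_ne _ _ h']

theorem puiseux_order (n : ℕ+) {δ : PowerSeries ℂ} (h : δ ≠ 0) :
    (puiseux n δ).order = (δ.order.toNat : ℚ) / (n : ℚ) := by
  have hn : (0 : ℚ) < (n : ℚ) := by exact_mod_cast n.pos
  have h0 : puiseux n δ ≠ 0 := by
    rw [← puiseux_zero n]; exact (puiseux_injective n).ne h
  apply le_antisymm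
  · apply HahnSeries.order_le_of_coeff_ne_zero
    rw [puiseux_coeff]
    exact PowerSeries.coeff_order h
  · have h1 : (puiseux n δ).coeff (puiseux n δ).order ≠ 0 :=
      fun h1 => h0 (HahnSeries.coeff_order_eq_zero.1 h1)
    by_cases h2 : ∃ k : ℕ, (puiseux n δ).order = (k : ℚ) / (n : ℚ)
    · obtain ⟨k, hk⟩ := h2
      rw [hk, puiseux_coeff] at h1
      rw [hk]
      have : δ.order.toNat ≤ k := by
        by_contra h3
        exact h1 (PowerSeries.coeff_of_lt_order_toNat k (by omega))
      exact div_le_div_of_nonneg_right (by exact_mod_cast this) hn.le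
    · push Not at h2
      exact absurd (puiseux_coeff_of_ne n δ h2) h1

/-- The order in `x` of the series `δ(x ^ (1 / n))`. -/
def ordN (n : ℕ+) (δ : PowerSeries ℂ) : ℝ≥0∞ := (δ.order : ℝ≥0∞) / (n : ℕ)

theorem pnat_ne_zero (n : ℕ+) : ((n : ℕ) : ℝ≥0∞) ≠ 0 := by exact_mod_cast n.ne_zero

theorem coe_order_eq {δ : PowerSeries ℂ} (h : δ ≠ 0) :
    (δ.order : ℝ≥0∞) = (δ.order.toNat : ℝ≥0∞) := by
  have : δ.order = (δ.order.toNat : ℕ∞) :=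
    (ENat.natCast_toNat (PowerSeries.order_eq_top.not.2 h)).symm
  rw [this]; simp

theorem ordX_puiseux (n : ℕ+) (δ : PowerSeries ℂ) : ordX (puiseux n δ) = ordN n δ := by
  by_cases h : δ = 0
  · subst h
    rw [ordX, puiseux_zero, if_pos rfl, ordN, PowerSeries.order_zero, ENat.toENNReal_top,
      ENNReal.top_div_of_ne_top (ENNReal.natCast_ne_top _)]
  · have h0 : puiseux n δ ≠ 0 := by
      rw [← puiseux_zero n]; exact (puiseux_injective n).ne h
    have hn : (0 : ℝ) < ((n : ℕ) : ℝ) := by exact_mod_cast n.pos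
    rw [ordX, if_neg h0, puiseux_order n h, ordN, coe_order_eq h]
    push_cast
    rw [ENNReal.ofReal_div_of_pos hn, ENNReal.ofReal_natCast, ENNReal.ofReal_natCast]

theorem ordN_mono (n : ℕ+) {a b : PowerSeries ℂ} (h : a.order ≤ b.order) : ordN n a ≤ ordN n b :=
  ENNReal.div_le_div_right (ENat.toENNReal_le.2 h) _

theorem min_ordN_le (n : ℕ+) (a b : PowerSeries ℂ) :
    min (ordN n a) (ordN n b) ≤ ordN n (a + b) := by
  rcases min_le_iff.1 (PowerSeries.min_order_le_order_add a b) with h | h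
  · exact (min_le_left _ _).trans (ordN_mono n h)
  · exact (min_le_right _ _).trans (ordN_mono n h)

theorem order_rescale {ω : ℂ} (hω : ω ≠ 0) (δ : PowerSeries ℂ) :
    (PowerSeries.rescale ω δ).order = δ.order := by
  apply le_antisymm
  · refine PowerSeries.le_order _ _ fun i hi => ?_
    have := PowerSeries.coeff_of_lt_order i hi
    rw [PowerSeries.coeff_rescale] at this
    exact (mul_eq_zero.1 this).resolve_left (pow_ne_zero _ hω)
  · refine PowerSeries.le_order _ _ fun i hi => ?_
    rw [PowerSeries.coeff_rescale, PowerSeries.coeff_of_lt_order i hi, mul_zero]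

/-- The Newton-Puiseux roots of the branch of an arc are the conjugates of the arc. -/
theorem roots_arcIdeal (n : ℕ+) (ζ : Transversal) :
    roots (arcIdeal n ζ) =
      {η | ∃ ω : ℂ, ω ^ (n : ℕ) = 1 ∧ η = puiseux n (PowerSeries.rescale ω ζ.1)} := by
  ext η
  constructor
  · rintro ⟨m, ξ, hξ, rfl, h⟩
    obtain ⟨ω, hω, h1⟩ := exists_conj_of_le (n := n) (m := m) (ζ := ζ) (ξ := ⟨ξ, hξ⟩)
      fun g hg => mem_arcIdeal.2 (by rw [← evalAt_eq]; exact h g hg)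
    refine ⟨ω, hω, ?_⟩
    have h2 := congrArg Subtype.val h1
    simp only [Transversal.coe_expand, Transversal.coe_rot] at h2
    rw [← puiseux_expand m n, h2, mul_comm, puiseux_expand]
  · rintro ⟨ω, hω, rfl⟩
    refine ⟨n, (ζ.rot ω).1, (ζ.rot ω).2, rfl, fun g hg => ?_⟩
    rw [evalAt_eq, ← mem_arcIdeal, arcIdeal_rot n hω]
    exact hg

theorem ne_zero_of_pow_pnat {ω : ℂ} {n : ℕ+} (h : ω ^ (n : ℕ) = 1) : ω ≠ 0 := by
  rintro rfl
  simp at h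

theorem rescale_sub_rescale {ω ω' : ℂ} (hω : ω ≠ 0) (a b : PowerSeries ℂ) :
    PowerSeries.rescale ω a - PowerSeries.rescale ω' b =
      PowerSeries.rescale ω (a - PowerSeries.rescale (ω' / ω) b) := by
  rw [map_sub]
  congr 1
  ext k
  simp only [PowerSeries.coeff_rescale]
  rw [← mul_assoc, ← mul_pow, mul_div_cancel₀ _ hω]

/-- Up to conjugation, one of the two Newton-Puiseux roots may be fixed. -/
theorem coincidence_arcIdeal (n : ℕ+) (ζ ξ : Transversal) :
    coincidence (arcIdeal n ζ) (arcIdeal n ξ) =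
      ⨆ ω : {ω : ℂ // ω ^ (n : ℕ) = 1}, ordN n (ζ.1 - PowerSeries.rescale ω.1 ξ.1) := by
  rw [coincidence, roots_arcIdeal, roots_arcIdeal]
  apply le_antisymm
  · refine iSup₂_le ?_
    rintro _ ⟨ω, hω, rfl⟩
    refine iSup₂_le ?_
    rintro _ ⟨ω', hω', rfl⟩
    have h0 := ne_zero_of_pow_pnat hω
    rw [puiseux_sub, ordX_puiseux, rescale_sub_rescale h0, ordN, order_rescale h0]
    exact le_iSup (fun ω : {ω : ℂ // ω ^ (n : ℕ) = 1} =>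
      ordN n (ζ.1 - PowerSeries.rescale ω.1 ξ.1))
      ⟨ω' / ω, by rw [div_pow, hω, hω', div_one]⟩
  · refine iSup_le fun ω => ?_
    have h := le_iSup₂_of_le (f := fun (η : HahnSeries ℚ ℂ) (_ : η ∈ {η | ∃ ω : ℂ,
      ω ^ (n : ℕ) = 1 ∧ η = puiseux n (PowerSeries.rescale ω ζ.1)}) =>
      ⨆ θ ∈ {η | ∃ ω : ℂ, ω ^ (n : ℕ) = 1 ∧ η = puiseux n (PowerSeries.rescale ω ξ.1)},
        ordX (η - θ)) (a := ordN n (ζ.1 - PowerSeries.rescale ω.1 ξ.1)) (puiseux n ζ.1)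
      ⟨1, one_pow _, by simp⟩ ?_
    · exact h
    · refine le_iSup₂_of_le (puiseux n (PowerSeries.rescale ω.1 ξ.1)) ⟨ω.1, ω.2, rfl⟩ ?_
      rw [puiseux_sub, ordX_puiseux]

/-- The ideals of the branches which are parametrized by an arc. -/
def IsArc (P : Ideal PS) : Prop := ∃ (n : ℕ+) (ζ : Transversal), P = arcIdeal n ζ

theorem IsArc.exists_common {P Q : Ideal PS} (hP : IsArc P) (hQ : IsArc Q) :
    ∃ (n : ℕ+) (ζ ξ : Transversal), P = arcIdeal n ζ ∧ Q = arcIdeal n ξ := by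
  obtain ⟨n, ζ, rfl⟩ := hP
  obtain ⟨m, ξ, rfl⟩ := hQ
  exact ⟨n * m, ζ.expand m, ξ.expand n, (arcIdeal_expand m n ζ).symm,
    by rw [mul_comm, arcIdeal_expand]⟩

theorem IsArc.coincidence_self {P : Ideal PS} (hP : IsArc P) : coincidence P P = ⊤ := by
  obtain ⟨n, ζ, rfl⟩ := hP
  rw [coincidence_arcIdeal, eq_top_iff]
  refine le_iSup_of_le ⟨1, one_pow _⟩ ?_
  rw [PowerSeries.rescale_one, RingHom.id_apply, sub_self, ordN, PowerSeries.order_zero,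
    ENat.toENNReal_top, ENNReal.top_div_of_ne_top (ENNReal.natCast_ne_top _)]

theorem ordX_neg (η : HahnSeries ℚ ℂ) : ordX (-η) = ordX η := by
  by_cases h : η = 0
  · rw [h, neg_zero]
  · rw [ordX, ordX, if_neg (neg_ne_zero.2 h), if_neg h, HahnSeries.order_neg]

theorem coincidence_comm (P Q : Ideal PS) : coincidence P Q = coincidence Q P := by
  rw [coincidence, coincidence, iSup₂_comm]
  refine iSup_congr fun η => iSup_congr fun _ => iSup_congr fun ξ => iSup_congr fun _ => ?_
  rw [← ordX_neg, neg_sub]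

/-- The ultrametric inequality for the orders of coincidence. -/
theorem IsArc.min_coincidence_le {P Q R : Ideal PS} (hP : IsArc P) (hQ : IsArc Q) (hR : IsArc R) :
    min (coincidence P Q) (coincidence Q R) ≤ coincidence P R := by
  obtain ⟨n, ζ, rfl⟩ := hP
  obtain ⟨m, ξ, χ, rfl, rfl⟩ := hQ.exists_common hR
  rw [← arcIdeal_expand m n ζ, ← arcIdeal_expand n m ξ, ← arcIdeal_expand n m χ, mul_comm m n]
  generalize n * m = N
  rw [coincidence_arcIdeal, coincidence_arcIdeal, coincidence_arcIdeal]
  refine le_of_forall_lt fun a ha => ?_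
  obtain ⟨h1, h2⟩ := lt_min_iff.1 ha
  obtain ⟨ω, hω⟩ := lt_iSup_iff.1 h1
  obtain ⟨ω', hω'⟩ := lt_iSup_iff.1 h2
  refine lt_of_lt_of_le ?_ (le_iSup _ ⟨ω.1 * ω'.1, by rw [mul_pow, ω.2, ω'.2, one_mul]⟩)
  refine lt_of_lt_of_le (lt_min hω hω') ?_
  set x := (ζ.expand m).1
  set y := (ξ.expand n).1
  set z := (χ.expand n).1
  have hz : x - PowerSeries.rescale (ω.1 * ω'.1) z =
      (x - PowerSeries.rescale ω.1 y) + PowerSeries.rescale ω.1 (y - PowerSeries.rescale ω'.1 z) := by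
    rw [map_sub, mul_comm, PowerSeries.rescale_mul]; simp
  have hω'' : ordN N (y - PowerSeries.rescale ω'.1 z) =
      ordN N (PowerSeries.rescale ω.1 (y - PowerSeries.rescale ω'.1 z)) := by
    rw [ordN, ordN, order_rescale (ne_zero_of_pow_pnat ω.2)]
  rw [hz, hω'']
  exact min_ordN_le N _ _

/-! ### Effect of a Newton modification on the orders of coincidence -/

theorem Weight.slope_eq (w : Weight) : w.slope = (w.d : ℝ≥0∞) / (w.c : ℝ≥0∞) := rfl

theorem Weight.c_ne_zero (w : Weight) : (w.c : ℝ≥0∞) ≠ 0 := by exact_mod_cast w.c_pos.ne'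

theorem Weight.slope_ne_top (w : Weight) : w.slope ≠ ⊤ :=
  ENNReal.div_ne_top (ENNReal.natCast_ne_top _) w.c_ne_zero

theorem ordN_X_pow_mul (n : ℕ+) (w : Weight) (δ : PowerSeries ℂ) :
    ordN (n * w.cP) (PowerSeries.X ^ ((n * w.dP : ℕ+) : ℕ) * δ) = ordN n δ / w.c + w.slope := by
  have hn := pnat_ne_zero n
  have hnt : ((n : ℕ) : ℝ≥0∞) ≠ ⊤ := ENNReal.natCast_ne_top _
  rw [ordN, ordN, PowerSeries.order_mul, PowerSeries.order_X_pow, ENat.toENNReal_add,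
    Weight.slope_eq, add_comm, ENNReal.add_div, PNat.mul_coe, PNat.mul_coe, Weight.coe_cP,
    Weight.coe_dP]
  congr 1
  · rw [Nat.cast_mul, div_eq_mul_inv, div_eq_mul_inv, div_eq_mul_inv, mul_assoc,
      ENNReal.mul_inv (Or.inl hn) (Or.inl hnt)]
  · rw [ENat.toENNReal_coe, Nat.cast_mul, Nat.cast_mul, ENNReal.mul_div_mul_left _ _ hn hnt]

theorem ordN_of_constantCoeff {n : ℕ+} {δ : PowerSeries ℂ}
    (h : PowerSeries.constantCoeff δ ≠ 0) : ordN n δ = 0 := by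
  have : δ.order = 0 := by
    by_contra h1
    exact h (PowerSeries.order_ne_zero_iff_constCoeff_eq_zero.1 h1)
  rw [ordN, this, ENat.toENNReal_zero, ENNReal.zero_div]

/-- The image on the initial surface of the arc `x₁ = t ^ n`, `y₁ = ζ(t)`: it is the arc
`x = t ^ (n c)`, `y = φ(t ^ (n c)) + t ^ (n d) (a + ζ(t))`. -/
def Transversal.lower (φ : Transversal) (w : Weight) (a : ℂ) (n : ℕ+) (ζ : Transversal) :
    Transversal := φ.expand (n * w.cP) + ζ.blowDown (n * w.dP) a

theorem comap_pullback_eq_lower (n : ℕ+) (ζ φ : Transversal) (w : Weight) (a : ℂ) :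
    (arcIdeal n ζ).comap (pullback φ w a) = arcIdeal (n * w.cP) (φ.lower w a n ζ) :=
  comap_pullback_arcIdeal n ζ φ w a

theorem lower_sub_rescale_lower (φ : Transversal) (w : Weight) (a b : ℂ) (n : ℕ+)
    (ζ ξ : Transversal) {ω : ℂ} (hω : ω ^ ((n * w.cP : ℕ+) : ℕ) = 1) :
    (φ.lower w a n ζ).1 - PowerSeries.rescale ω (φ.lower w b n ξ).1 =
      PowerSeries.X ^ ((n * w.dP : ℕ+) : ℕ) * (PowerSeries.C a + ζ.1 -
        PowerSeries.C (ω ^ ((n * w.dP : ℕ+) : ℕ)) *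
          (PowerSeries.C b + PowerSeries.rescale ω ξ.1)) := by
  have h := congrArg Subtype.val (Transversal.rot_expand hω φ)
  rw [Transversal.coe_rot] at h
  simp only [Transversal.lower, Transversal.coe_add, Transversal.coe_blowDown, map_add, map_mul,
    map_pow, PowerSeries.rescale_X, rescale_C, h]
  ring

theorem lower_sub_rescale_expand (φ : Transversal) (w : Weight) (a : ℂ) (n : ℕ+)
    (ζ : Transversal) {ω : ℂ} (hω : ω ^ ((n * w.cP : ℕ+) : ℕ) = 1) :
    (φ.lower w a n ζ).1 - PowerSeries.rescale ω (φ.expand (n * w.cP)).1 =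
      PowerSeries.X ^ ((n * w.dP : ℕ+) : ℕ) * (PowerSeries.C a + ζ.1) := by
  have h := congrArg Subtype.val (Transversal.rot_expand hω φ)
  rw [Transversal.coe_rot] at h
  rw [h]
  simp [Transversal.lower]

theorem constantCoeff_leading (a b θ ω : ℂ) (ζ ξ : Transversal) :
    PowerSeries.constantCoeff (PowerSeries.C a + ζ.1 - PowerSeries.C θ *
      (PowerSeries.C b + PowerSeries.rescale ω ξ.1)) = a - θ * b := by
  have := (ξ.rot ω).2
  rw [Transversal.coe_rot] at this
  simp [ζ.2, this]

/-- An `nc`-th root of unity whose `nd`-th power is `1` is an `n`-th root of unity. -/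
theorem pow_eq_one_of_coprime (w : Weight) (n : ℕ+) {ω : ℂ}
    (hω : ω ^ ((n * w.cP : ℕ+) : ℕ) = 1) (h : ω ^ ((n * w.dP : ℕ+) : ℕ) = 1) :
    ω ^ (n : ℕ) = 1 := by
  rw [PNat.mul_coe, pow_mul] at hω h
  have h1 : orderOf (ω ^ (n : ℕ)) ∣ w.c := orderOf_dvd_of_pow_eq_one hω
  have h2 : orderOf (ω ^ (n : ℕ)) ∣ w.d := orderOf_dvd_of_pow_eq_one h
  have h3 := Nat.dvd_gcd h1 h2
  rw [w.coprime.gcd_eq_one, Nat.dvd_one] at h3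
  exact orderOf_eq_one_iff.1 h3

/-- The difference of two conjugate images of arcs: either the conjugation comes from one of the
lifted arcs, or the leading coefficients `a` of the arcs are moved apart. -/
theorem ordN_lower_sub (φ : Transversal) (w : Weight) {a : ℂ} (ha : a ≠ 0) (n : ℕ+)
    (ζ ξ : Transversal) {ω : ℂ} (hω : ω ^ ((n * w.cP : ℕ+) : ℕ) = 1) :
    (ω ^ (n : ℕ) = 1 → (φ.lower w a n ζ).1 - PowerSeries.rescale ω (φ.lower w a n ξ).1 =
        PowerSeries.X ^ ((n * w.dP : ℕ+) : ℕ) * (ζ.1 - PowerSeries.rescale ω ξ.1)) ∧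
      (ω ^ (n : ℕ) ≠ 1 → ordN (n * w.cP)
        ((φ.lower w a n ζ).1 - PowerSeries.rescale ω (φ.lower w a n ξ).1) = w.slope) := by
  rw [lower_sub_rescale_lower φ w a a n ζ ξ hω]
  refine ⟨fun h => ?_, fun h => ?_⟩
  · rw [PNat.mul_coe, pow_mul ω, h, one_pow, map_one]
    ring
  · rw [ordN_X_pow_mul, ordN_of_constantCoeff, ENNReal.zero_div, zero_add]
    rw [constantCoeff_leading]
    intro h1
    refine h (pow_eq_one_of_coprime w n hω ?_)
    have h2 : (1 - ω ^ ((n * w.dP : ℕ+) : ℕ)) * a = 0 := by rw [← h1]; ring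
    exact (sub_eq_zero.1 ((mul_eq_zero.1 h2).resolve_right ha)).symm

/-- The order of coincidence of two branches whose strict transforms pass through the same point
of the exceptional divisor. -/
theorem coincidence_comap {P Q : Ideal PS} (hP : IsArc P) (hQ : IsArc Q) (φ : Transversal)
    (w : Weight) {a : ℂ} (ha : a ≠ 0) :
    coincidence (P.comap (pullback φ w a)) (Q.comap (pullback φ w a)) =
      coincidence P Q / w.c + w.slope := by
  obtain ⟨n, ζ, ξ, rfl, rfl⟩ := hP.exists_common hQ
  have : Nonempty {ω : ℂ // ω ^ (n : ℕ) = 1} := ⟨⟨1, one_pow _⟩⟩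
  rw [comap_pullback_eq_lower, comap_pullback_eq_lower, coincidence_arcIdeal, coincidence_arcIdeal,
    ENNReal.iSup_div, ENNReal.iSup_add]
  apply le_antisymm
  · refine iSup_le fun ω => ?_
    by_cases h : ω.1 ^ (n : ℕ) = 1
    · rw [(ordN_lower_sub φ w ha n ζ ξ ω.2).1 h, ordN_X_pow_mul]
      exact le_iSup (fun ω : {ω : ℂ // ω ^ (n : ℕ) = 1} =>
        ordN n (ζ.1 - PowerSeries.rescale ω.1 ξ.1) / w.c + w.slope) ⟨ω.1, h⟩
    · rw [(ordN_lower_sub φ w ha n ζ ξ ω.2).2 h]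
      exact le_iSup_of_le ⟨1, one_pow _⟩ le_add_self
  · refine iSup_le fun ω => ?_
    have hω : ω.1 ^ ((n * w.cP : ℕ+) : ℕ) = 1 := by rw [PNat.mul_coe, pow_mul, ω.2, one_pow]
    rw [← ordN_X_pow_mul, ← (ordN_lower_sub φ w ha n ζ ξ hω).1 ω.2]
    exact le_iSup (fun ω : {ω : ℂ // ω ^ ((n * w.cP : ℕ+) : ℕ) = 1} =>
      ordN (n * w.cP) ((φ.lower w a n ζ).1 - PowerSeries.rescale ω.1 (φ.lower w a n ξ).1)) ⟨ω.1, hω⟩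

/-- The order of coincidence of the chosen transversal branch and of a branch whose strict transform
passes through a point of the exceptional divisor. -/
theorem coincidence_comap_top {P : Ideal PS} (hP : IsArc P) (φ : Transversal) (w : Weight) {a : ℂ}
    (ha : a ≠ 0) : coincidence (P.comap (pullback φ w a)) (arcIdeal 1 φ) = w.slope := by
  obtain ⟨n, ζ, rfl⟩ := hP
  have : Nonempty {ω : ℂ // ω ^ ((n * w.cP : ℕ+) : ℕ) = 1} := ⟨⟨1, one_pow _⟩⟩
  rw [comap_pullback_eq_lower, ← arcIdeal_expand (n * w.cP) 1 φ, one_mul, coincidence_arcIdeal]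
  have h : ∀ ω : {ω : ℂ // ω ^ ((n * w.cP : ℕ+) : ℕ) = 1}, ordN (n * w.cP)
      ((φ.lower w a n ζ).1 - PowerSeries.rescale ω.1 (φ.expand (n * w.cP)).1) = w.slope := by
    intro ω
    rw [lower_sub_rescale_expand φ w a n ζ ω.2, ordN_X_pow_mul, ordN_of_constantCoeff,
      ENNReal.zero_div, zero_add]
    simpa [ζ.2] using ha
  simp_rw [h]
  exact iSup_const

theorem order_blowDown {k : ℕ+} {a : ℂ} (ha : a ≠ 0) (ζ : Transversal) :
    (ζ.blowDown k a).1.order = (k : ℕ) := by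
  have h : PowerSeries.constantCoeff (PowerSeries.C a + ζ.1) ≠ 0 := by simpa [ζ.2] using ha
  have h1 : (PowerSeries.C a + ζ.1).order = 0 := by
    by_contra h1
    exact h (PowerSeries.order_ne_zero_iff_constCoeff_eq_zero.1 h1)
  rw [Transversal.coe_blowDown, PowerSeries.order_mul, h1, PowerSeries.order_X_pow, add_zero]

theorem Weight.eq_of_mul_eq {w w' : Weight} (h : w.d * w'.c = w'.d * w.c) : w = w' := by
  have h1 : w.c ∣ w'.c := w.coprime.dvd_of_dvd_mul_left ⟨w'.d, by rw [h, mul_comm]⟩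
  have h2 : w'.c ∣ w.c := w'.coprime.dvd_of_dvd_mul_left ⟨w.d, by rw [← h, mul_comm]⟩
  have hc : w.c = w'.c := Nat.dvd_antisymm h1 h2
  have hd : w.d = w'.d := by
    rw [hc] at h
    exact Nat.eq_of_mul_eq_mul_right w'.c_pos h
  cases w; cases w'
  simp only at hc hd
  subst hc; subst hd; rfl

/-- The order of coincidence of two branches whose strict transforms pass through different points
of the exceptional divisor. -/
theorem coincidence_comap_of_ne {g : PS} {P Q : Ideal PS} (hP : IsArc P) (hQ : IsArc Q)
    (φ : Transversal) {p p' : Point g} (hpp : p ≠ p') {a b : ℂ} (ha : a ^ p.w.c = p.v)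
    (hb : b ^ p'.w.c = p'.v) :
    coincidence (P.comap (pullback φ p.w a)) (Q.comap (pullback φ p'.w b)) =
      min p.w.slope p'.w.slope := by
  have ha0 := p.ne_zero ha
  have hb0 := p'.ne_zero hb
  obtain ⟨n, ζ, ξ, rfl, rfl⟩ := hP.exists_common hQ
  rw [comap_pullback_eq_lower, comap_pullback_eq_lower]
  by_cases hw : p.w = p'.w
  · have hv : p.v ≠ p'.v := by
      intro hv
      apply hpp
      cases p; cases p'
      simp only at hw hv
      subst hw; subst hv; rfl
    rw [← hw] at hb ⊢
    rw [min_self, coincidence_arcIdeal]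
    have : Nonempty {ω : ℂ // ω ^ ((n * p.w.cP : ℕ+) : ℕ) = 1} := ⟨⟨1, one_pow _⟩⟩
    have h : ∀ ω : {ω : ℂ // ω ^ ((n * p.w.cP : ℕ+) : ℕ) = 1}, ordN (n * p.w.cP)
        ((φ.lower p.w a n ζ).1 - PowerSeries.rescale ω.1 (φ.lower p.w b n ξ).1) = p.w.slope := by
      rintro ⟨ω, h2⟩
      rw [lower_sub_rescale_lower φ p.w a b n ζ ξ h2, ordN_X_pow_mul, ordN_of_constantCoeff,
        ENNReal.zero_div, zero_add]
      rw [constantCoeff_leading, sub_ne_zero]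
      intro h1
      apply hv
      rw [PNat.mul_coe, Weight.coe_cP] at h2
      rw [← ha, ← hb, h1, mul_pow, ← pow_mul, PNat.mul_coe, mul_right_comm, pow_mul, h2, one_pow,
        one_mul]
    simp_rw [h]
    exact iSup_const
  · -- The orders `d / c` of the two arcs are different, so that there is no cancellation.
    have hne : p.w.d * p'.w.c ≠ p'.w.d * p.w.c := fun h => hw (Weight.eq_of_mul_eq h)
    rw [← arcIdeal_expand p'.w.cP, ← arcIdeal_expand p.w.cP (n * p'.w.cP),
      show n * p'.w.cP * p.w.cP = n * p.w.cP * p'.w.cP from mul_right_comm _ _ _,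
      coincidence_arcIdeal]
    have : Nonempty {ω : ℂ // ω ^ ((n * p.w.cP * p'.w.cP : ℕ+) : ℕ) = 1} := ⟨⟨1, one_pow _⟩⟩
    have h : ∀ ω : {ω : ℂ // ω ^ ((n * p.w.cP * p'.w.cP : ℕ+) : ℕ) = 1},
        ordN (n * p.w.cP * p'.w.cP) (((φ.lower p.w a n ζ).expand p'.w.cP).1 -
          PowerSeries.rescale ω.1 ((φ.lower p'.w b n ξ).expand p.w.cP).1) =
        min p.w.slope p'.w.slope := by
      rintro ⟨ω, hω⟩
      have e1 : ((φ.lower p.w a n ζ).expand p'.w.cP).1 = (φ.expand (n * p.w.cP * p'.w.cP)).1 +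
          ((ζ.blowDown (n * p.w.dP) a).expand p'.w.cP).1 := by
        rw [mul_comm (n * p.w.cP), ← Transversal.expand_expand]
        simp [Transversal.lower]
      have e2 : PowerSeries.rescale ω ((φ.lower p'.w b n ξ).expand p.w.cP).1 =
          (φ.expand (n * p.w.cP * p'.w.cP)).1 +
          PowerSeries.rescale ω ((ξ.blowDown (n * p'.w.dP) b).expand p.w.cP).1 := by
        have h := congrArg Subtype.val (Transversal.rot_expand hω φ)
        rw [Transversal.coe_rot] at h
        rw [← h, ← map_add, mul_right_comm, mul_comm (n * p'.w.cP), ← Transversal.expand_expand]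
        simp [Transversal.lower]
      set A := ((ζ.blowDown (n * p.w.dP) a).expand p'.w.cP).1 with hA
      set B := PowerSeries.rescale ω ((ξ.blowDown (n * p'.w.dP) b).expand p.w.cP).1 with hB
      have oA : A.order = (p'.w.c * (n * p.w.d) : ℕ) := by
        rw [hA, Transversal.coe_expand, PowerSeries.order_expand, order_blowDown ha0, nsmul_eq_mul]
        push_cast; rfl
      have oB : (-B).order = (p.w.c * (n * p'.w.d) : ℕ) := by
        rw [PowerSeries.order_neg, hB, order_rescale (ne_zero_of_pow_pnat hω),
          Transversal.coe_expand, PowerSeries.order_expand, order_blowDown hb0, nsmul_eq_mul]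
        push_cast; rfl
      have hAB : A.order ≠ (-B).order := by
        rw [oA, oB]
        intro h1
        have h2 : p'.w.c * (n * p.w.d) = p.w.c * (n * p'.w.d) := by exact_mod_cast h1
        refine hne (Nat.eq_of_mul_eq_mul_left n.pos ?_)
        linarith
      rw [e1, e2, add_sub_add_left_eq_sub, sub_eq_add_neg, ordN,
        PowerSeries.order_add_of_order_ne _ _ hAB, oA, oB]
      have key : ∀ (w w' : Weight), ((w'.c * (n * w.d) : ℕ) : ℝ≥0∞) /
          ((n * w.cP * w'.cP : ℕ+) : ℕ) = w.slope := by
        intro w w'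
        rw [show w'.c * (n * w.d) = (n * w'.c) * w.d by ring,
          show ((n * w.cP * w'.cP : ℕ+) : ℕ) = (n * w'.c) * w.c by
            simp only [PNat.mul_coe, Weight.coe_cP]; ring, Nat.cast_mul (n * w'.c),
          Nat.cast_mul (n * w'.c), ENNReal.mul_div_mul_left _ _ _ (ENNReal.natCast_ne_top _)]
        · rfl
        · exact_mod_cast (Nat.mul_pos n.pos w'.c_pos).ne'
      have k1 := key p.w p'.w
      have k2 := key p'.w p.w
      rw [mul_right_comm] at k2
      have hmono : Monotone fun x : ℕ∞ => (x : ℝ≥0∞) / ((n * p.w.cP * p'.w.cP : ℕ+) : ℕ) :=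
        fun x y hxy => ENNReal.div_le_div_right (ENat.toENNReal_le.2 hxy) _
      have := hmono.map_min (a := ((p'.w.c * (n * p.w.d) : ℕ) : ℕ∞))
        (b := ((p.w.c * (n * p'.w.d) : ℕ) : ℕ∞))
      simp only [ENat.toENNReal_coe] at this
      rw [k1, k2] at this
      exact this
    simp_rw [h]
    exact iSup_const

/-! ### Effect of a Newton modification on the index and the contact complexity -/

open MeasureTheory

theorem charExponents_arcIdeal (n : ℕ+) (ζ : Transversal) :
    charExponents (arcIdeal n ζ) = {q | ∃ ω : ℂ, ω ^ (n : ℕ) = 1 ∧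
      ζ.1 - PowerSeries.rescale ω ζ.1 ≠ 0 ∧
      q = ((ζ.1 - PowerSeries.rescale ω ζ.1).order.toNat : ℚ) / n} := by
  ext q
  rw [charExponents, roots_arcIdeal]
  constructor
  · rintro ⟨_, ⟨ω, hω, rfl⟩, _, ⟨ω', hω', rfl⟩, hne, rfl⟩
    have h0 := ne_zero_of_pow_pnat hω
    have h1 : PowerSeries.rescale ω ζ.1 - PowerSeries.rescale ω' ζ.1 ≠ 0 := by
      intro h
      exact hne (by rw [sub_eq_zero.1 h])
    refine ⟨ω' / ω, by rw [div_pow, hω, hω', div_one], ?_, ?_⟩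
    · intro h
      rw [rescale_sub_rescale h0, h, map_zero] at h1
      exact h1 rfl
    · rw [puiseux_sub, puiseux_order n h1, rescale_sub_rescale h0, order_rescale h0]
  · rintro ⟨ω, hω, hne, rfl⟩
    refine ⟨_, ⟨1, one_pow _, rfl⟩, _, ⟨ω, hω, rfl⟩, ?_, ?_⟩
    · intro h
      have := puiseux_injective n h
      rw [PowerSeries.rescale_one, RingHom.id_apply] at this
      exact hne (sub_eq_zero.2 this)
    · rw [puiseux_sub, PowerSeries.rescale_one, RingHom.id_apply, puiseux_order n hne]

theorem charExponents_nonneg {P : Ideal PS} (hP : IsArc P) {q : ℚ} (hq : q ∈ charExponents P) :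
    0 ≤ q := by
  obtain ⟨n, ζ, rfl⟩ := hP
  rw [charExponents_arcIdeal] at hq
  obtain ⟨ω, -, -, rfl⟩ := hq
  positivity

theorem charExponents_one (φ : Transversal) : charExponents (arcIdeal 1 φ) = ∅ := by
  rw [charExponents_arcIdeal, Set.eq_empty_iff_forall_notMem]
  rintro q ⟨ω, hω, h, -⟩
  rw [PNat.one_coe, pow_one] at hω
  rw [hω, PowerSeries.rescale_one, RingHom.id_apply, sub_self] at h
  exact h rfl

theorem toNat_order_X_pow_mul (k : ℕ) {δ : PowerSeries ℂ} (h : δ ≠ 0) :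
    (PowerSeries.X ^ k * δ).order.toNat = k + δ.order.toNat := by
  rw [PowerSeries.order_mul, PowerSeries.order_X_pow,
    ENat.toNat_add (ENat.natCast_ne_top k) (PowerSeries.order_eq_top.not.2 h), ENat.toNat_natCast]

/-- The first characteristic exponent created by a Newton modification of weight `(c, d)` is
`d / c`, and the further ones come from those of the lifted branch. -/
theorem charExponents_comap {P : Ideal PS} (hP : IsArc P) (φ : Transversal) (w : Weight) {a : ℂ}
    (ha : a ≠ 0) (q : ℚ) : q ∈ charExponents (P.comap (pullback φ w a)) ↔
      (q = (w.d : ℚ) / w.c ∧ 1 < w.c) ∨ ∃ q' ∈ charExponents P, q = (q' + w.d) / w.c := by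
  obtain ⟨n, ζ, rfl⟩ := hP
  have hn : (n : ℚ) ≠ 0 := by exact_mod_cast n.ne_zero
  have hc : (w.c : ℚ) ≠ 0 := by exact_mod_cast w.c_pos.ne'
  rw [comap_pullback_eq_lower, charExponents_arcIdeal, charExponents_arcIdeal]
  have key : ∀ ω : ℂ, ω ^ ((n * w.cP : ℕ+) : ℕ) = 1 → ω ^ (n : ℕ) ≠ 1 →
      (φ.lower w a n ζ).1 - PowerSeries.rescale ω (φ.lower w a n ζ).1 ≠ 0 ∧
      (((φ.lower w a n ζ).1 - PowerSeries.rescale ω (φ.lower w a n ζ).1).order.toNat : ℚ) /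
        (n * w.cP : ℕ+) = (w.d : ℚ) / w.c := by
    intro ω hω h
    rw [lower_sub_rescale_lower φ w a a n ζ ζ hω]
    set δ := PowerSeries.C a + ζ.1 - PowerSeries.C (ω ^ ((n * w.dP : ℕ+) : ℕ)) *
      (PowerSeries.C a + PowerSeries.rescale ω ζ.1) with hδ
    have h1 : PowerSeries.constantCoeff δ ≠ 0 := by
      rw [hδ, constantCoeff_leading]
      intro h1
      refine h (pow_eq_one_of_coprime w n hω ?_)
      have h2 : (1 - ω ^ ((n * w.dP : ℕ+) : ℕ)) * a = 0 := by rw [← h1]; ring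
      exact (sub_eq_zero.1 ((mul_eq_zero.1 h2).resolve_right ha)).symm
    have h2 : δ ≠ 0 := by
      intro h2; rw [h2, map_zero] at h1; exact h1 rfl
    have h3 : δ.order = 0 := by
      by_contra h3
      exact h1 (PowerSeries.order_ne_zero_iff_constCoeff_eq_zero.1 h3)
    refine ⟨mul_ne_zero (pow_ne_zero _ PowerSeries.X_ne_zero) h2, ?_⟩
    rw [toNat_order_X_pow_mul _ h2, h3]
    simp only [PNat.mul_coe, Weight.coe_cP, Weight.coe_dP, ENat.toNat_zero, add_zero]
    push_cast
    field_simp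
  have key' : ∀ o : ℕ, (((n * w.dP : ℕ+) : ℕ) + o : ℚ) / (n * w.cP : ℕ+) =
      ((o : ℚ) / n + w.d) / w.c := by
    intro o
    simp only [PNat.mul_coe, Weight.coe_cP, Weight.coe_dP]
    push_cast
    field_simp
    ring
  constructor
  · rintro ⟨ω, hω, hne, rfl⟩
    by_cases h : ω ^ (n : ℕ) = 1
    · right
      rw [(ordN_lower_sub φ w ha n ζ ζ hω).1 h] at hne ⊢
      have h1 := right_ne_zero_of_mul hne
      refine ⟨_, ⟨ω, h, h1, rfl⟩, ?_⟩
      rw [toNat_order_X_pow_mul _ h1]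
      push_cast [← key']
      rfl
    · left
      refine ⟨(key ω hω h).2, ?_⟩
      by_contra h1
      have h2 : w.c = 1 := by have := w.c_pos; omega
      rw [PNat.mul_coe, Weight.coe_cP, h2, mul_one] at hω
      exact h hω
  · rintro (⟨rfl, h⟩ | ⟨_, ⟨ω, hω, hne, rfl⟩, rfl⟩)
    · -- a primitive root of unity moves the leading coefficient
      have hprim := Complex.isPrimitiveRoot_exp ((n * w.cP : ℕ+) : ℕ) (n * w.cP).ne_zero
      refine ⟨_, hprim.pow_eq_one, ?_⟩
      have h1 := key _ hprim.pow_eq_one (hprim.pow_ne_one_of_pos_of_lt n.ne_zero ?_)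
      · exact ⟨h1.1, h1.2.symm⟩
      · rw [PNat.mul_coe, Weight.coe_cP]
        nlinarith [n.pos]
    · have hω' : ω ^ ((n * w.cP : ℕ+) : ℕ) = 1 := by rw [PNat.mul_coe, pow_mul, hω, one_pow]
      refine ⟨ω, hω', ?_⟩
      rw [(ordN_lower_sub φ w ha n ζ ζ hω').1 hω]
      refine ⟨mul_ne_zero (pow_ne_zero _ PowerSeries.X_ne_zero) hne, ?_⟩
      rw [toNat_order_X_pow_mul _ hne]
      push_cast [← key']
      rfl

/-! ### Affine maps attached to a weight -/

/-- The exponent, before a Newton modification, of a point of exponent `t` after it. -/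
def Weight.down (w : Weight) (t : ℝ≥0∞) : ℝ≥0∞ := t / w.c + w.slope

/-- The exponent, after a Newton modification, of a point of exponent `t ≥ w.slope` before it. -/
def Weight.up (w : Weight) (t : ℝ≥0∞) : ℝ≥0∞ := w.c * t - w.d

theorem Weight.c_ne_top (w : Weight) : (w.c : ℝ≥0∞) ≠ ⊤ := ENNReal.natCast_ne_top _

theorem Weight.c_mul_slope (w : Weight) : (w.c : ℝ≥0∞) * w.slope = w.d := by
  rw [Weight.slope_eq, ENNReal.mul_div_cancel w.c_ne_zero w.c_ne_top]

theorem Weight.up_down (w : Weight) (t : ℝ≥0∞) : w.up (w.down t) = t := by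
  rw [Weight.up, Weight.down, mul_add, w.c_mul_slope, ENNReal.mul_div_cancel w.c_ne_zero w.c_ne_top,
    ENNReal.add_sub_cancel_right (ENNReal.natCast_ne_top _)]

theorem Weight.down_up (w : Weight) {t : ℝ≥0∞} (h : w.slope ≤ t) : w.down (w.up t) = t := by
  have h1 : (w.d : ℝ≥0∞) ≤ w.c * t := by
    rw [← w.c_mul_slope]; gcongr
  rw [Weight.up, Weight.down, Weight.slope_eq, ← ENNReal.add_div, tsub_add_cancel_of_le h1,
    mul_comm, ENNReal.mul_div_cancel_right w.c_ne_zero w.c_ne_top]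

theorem Weight.slope_le_down (w : Weight) (t : ℝ≥0∞) : w.slope ≤ w.down t := le_add_self

theorem Weight.down_zero (w : Weight) : w.down 0 = w.slope := by
  rw [Weight.down, ENNReal.zero_div, zero_add]

theorem Weight.down_top (w : Weight) : w.down ⊤ = ⊤ := by
  rw [Weight.down, ENNReal.top_div_of_ne_top w.c_ne_top, top_add]

theorem Weight.down_strictMono (w : Weight) : StrictMono w.down := fun _ _ h =>
  ENNReal.add_lt_add_right w.slope_ne_top (ENNReal.div_lt_div_right w.c_ne_zero w.c_ne_top h)

theorem Weight.up_mono (w : Weight) : Monotone w.up := fun _ _ h =>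
  tsub_le_tsub_right (mul_le_mul_right h _) _

theorem Weight.up_slope (w : Weight) : w.up w.slope = 0 := by rw [← w.down_zero, w.up_down]

theorem Weight.down_lt_iff (w : Weight) {s t : ℝ≥0∞} (h : w.slope ≤ t) :
    w.down s < t ↔ s < w.up t := by
  conv_lhs => rw [← w.down_up h]
  exact w.down_strictMono.lt_iff_lt

theorem Weight.down_le_iff (w : Weight) {s t : ℝ≥0∞} (h : w.slope ≤ t) :
    w.down s ≤ t ↔ s ≤ w.up t := by
  conv_lhs => rw [← w.down_up h]
  exact w.down_strictMono.le_iff_le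

theorem Weight.ofReal_slope (w : Weight) : ENNReal.ofReal ((w.d : ℝ) / w.c) = w.slope := by
  rw [ENNReal.ofReal_div_of_pos (by exact_mod_cast w.c_pos), ENNReal.ofReal_natCast,
    ENNReal.ofReal_natCast, Weight.slope_eq]

theorem Weight.down_ofReal (w : Weight) {s : ℝ} (hs : 0 ≤ s) :
    w.down (ENNReal.ofReal s) = ENNReal.ofReal ((s + w.d) / w.c) := by
  have hc : (0 : ℝ) < w.c := by exact_mod_cast w.c_pos
  rw [add_div, ENNReal.ofReal_add (by positivity) (by positivity), w.ofReal_slope,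
    ENNReal.ofReal_div_of_pos hc, ENNReal.ofReal_natCast, Weight.down]

/-! ### Index and contact complexity -/

theorem den_dvd_iff (q : ℚ) (n : ℕ) : q.den ∣ n ↔ ∃ z : ℤ, q * n = z := by
  constructor
  · rintro ⟨m, rfl⟩
    refine ⟨q.num * m, ?_⟩
    push_cast
    rw [← mul_assoc, Rat.mul_den_eq_num]
  · rintro ⟨z, hz⟩
    have h1 : q.num * n = z * q.den := by
      have : (q.num : ℚ) * n = z * q.den := by
        rw [← hz, ← Rat.mul_den_eq_num]; ring
      exact_mod_cast this
    have h2 : (q.den : ℤ) ∣ q.num * n := ⟨z, by rw [h1, mul_comm]⟩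
    have h3 : IsCoprime (q.den : ℤ) q.num :=
      (Int.isCoprime_iff_gcd_eq_one.2 (by
        rw [Int.gcd_comm]; exact q.reduced)) 
    exact_mod_cast h3.dvd_of_dvd_mul_left h2

theorem branchIndex_eq_one {P : Ideal PS} {t : ℝ≥0∞}
    (h : ∀ q ∈ charExponents P, t ≤ ENNReal.ofReal (q : ℝ)) : branchIndex P t = 1 := by
  apply le_antisymm
  · exact Nat.sInf_le ⟨one_pos, fun q hq hlt => absurd hlt (h q hq).not_gt⟩
  · have : (1 : ℕ) ∈ {n : ℕ | 0 < n ∧ ∀ q ∈ charExponents P,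
        ENNReal.ofReal (q : ℝ) < t → q.den ∣ n} :=
      ⟨one_pos, fun q hq hlt => absurd hlt (h q hq).not_gt⟩
    exact (Nat.sInf_mem ⟨1, this⟩).1

theorem branchIndex_one (φ : Transversal) (t : ℝ≥0∞) : branchIndex (arcIdeal 1 φ) t = 1 :=
  branchIndex_eq_one fun q hq => by rw [charExponents_one] at hq; exact hq.elim

theorem Weight.den_eq (w : Weight) : ((w.d : ℚ) / w.c).den = w.c := by
  have := Rat.den_div_eq_of_coprime (a := (w.d : ℤ)) (b := (w.c : ℤ))
    (by exact_mod_cast w.c_pos) (by simpa using w.coprime.symm)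
  rw [Int.cast_natCast, Int.cast_natCast] at this
  exact Int.natCast_inj.1 this

theorem ofReal_exponent (w : Weight) {q : ℚ} (hq : 0 ≤ q) :
    ENNReal.ofReal (((q + w.d) / w.c : ℚ) : ℝ) = w.down (ENNReal.ofReal (q : ℝ)) := by
  rw [w.down_ofReal (by exact_mod_cast hq)]
  push_cast
  rfl

/-- The index function of the image of a branch. -/
theorem branchIndex_comap {P : Ideal PS} (hP : IsArc P) (φ : Transversal) (w : Weight) {a : ℂ}
    (ha : a ≠ 0) (t : ℝ≥0∞) : branchIndex (P.comap (pullback φ w a)) t =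
      if t ≤ w.slope then 1 else w.c * branchIndex P (w.up t) := by
  have hs : ENNReal.ofReal (((w.d : ℚ) / w.c : ℚ) : ℝ) = w.slope := by
    push_cast; exact w.ofReal_slope
  split_ifs with ht
  · refine branchIndex_eq_one fun q hq => ht.trans ?_
    rcases (charExponents_comap hP φ w ha q).1 hq with ⟨rfl, -⟩ | ⟨q', hq', rfl⟩
    · rw [hs]
    · rw [ofReal_exponent w (charExponents_nonneg hP hq')]
      exact w.slope_le_down _
  · have ht' := not_le.1 ht
    have key : ∀ m : ℕ, (0 < m ∧ ∀ q ∈ charExponents (P.comap (pullback φ w a)),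
        ENNReal.ofReal (q : ℝ) < t → q.den ∣ m) ↔ ∃ m' : ℕ, (0 < m' ∧ ∀ q ∈ charExponents P,
          ENNReal.ofReal (q : ℝ) < w.up t → q.den ∣ m') ∧ m = w.c * m' := by
      have hc : (w.c : ℚ) ≠ 0 := by exact_mod_cast w.c_pos.ne'
      have hden : ∀ (q' : ℚ) (m' : ℕ), ((q' + w.d) / w.c).den ∣ w.c * m' ↔ q'.den ∣ m' := by
        intro q' m'
        rw [den_dvd_iff, den_dvd_iff]
        have e : (q' + w.d) / w.c * ((w.c * m' : ℕ) : ℚ) = q' * m' + (w.d * m' : ℕ) := by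
          push_cast; field_simp
        rw [e]
        constructor
        · rintro ⟨z, hz⟩
          exact ⟨z - (w.d * m' : ℕ), by push_cast at hz ⊢; linarith⟩
        · rintro ⟨z, hz⟩
          exact ⟨z + (w.d * m' : ℕ), by push_cast at hz ⊢; linarith⟩
      intro m
      constructor
      · rintro ⟨hm, h⟩
        obtain ⟨m', rfl⟩ : w.c ∣ m := by
          by_cases h1 : 1 < w.c
          · have := h _ ((charExponents_comap hP φ w ha _).2 (Or.inl ⟨rfl, h1⟩)) (by rwa [hs])
            rwa [w.den_eq] at this
          · have h2 : w.c = 1 := by have := w.c_pos; omega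
            rw [h2]; exact one_dvd _
        refine ⟨m', ⟨Nat.pos_of_mul_pos_left hm, fun q hq hlt => ?_⟩, rfl⟩
        rw [← hden]
        refine h _ ((charExponents_comap hP φ w ha _).2 (Or.inr ⟨q, hq, rfl⟩)) ?_
        rwa [ofReal_exponent w (charExponents_nonneg hP hq), w.down_lt_iff ht'.le]
      · rintro ⟨m', ⟨hm', h⟩, rfl⟩
        refine ⟨Nat.mul_pos w.c_pos hm', fun q hq hlt => ?_⟩
        rcases (charExponents_comap hP φ w ha q).1 hq with ⟨rfl, -⟩ | ⟨q', hq', rfl⟩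
        · rw [w.den_eq]; exact dvd_mul_right _ _
        · rw [hden]
          refine h q' hq' ?_
          rwa [ofReal_exponent w (charExponents_nonneg hP hq'), w.down_lt_iff ht'.le] at hlt
    rw [branchIndex, branchIndex]
    simp_rw [key]
    set S := {n : ℕ | 0 < n ∧ ∀ q ∈ charExponents P, ENNReal.ofReal (q : ℝ) < w.up t → q.den ∣ n}
      with hS
    rcases S.eq_empty_or_nonempty with h | h
    · rw [h]
      have : {n : ℕ | ∃ m' : ℕ, (0 < m' ∧ ∀ q ∈ charExponents P,
          ENNReal.ofReal (q : ℝ) < w.up t → q.den ∣ m') ∧ n = w.c * m'} = ∅ := by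
        rw [Set.eq_empty_iff_forall_notMem] at h ⊢
        rintro n ⟨m', hm', -⟩
        exact h m' hm'
      rw [this]; simp
    · apply le_antisymm
      · exact Nat.sInf_le ⟨_, Nat.sInf_mem h, rfl⟩
      · obtain ⟨m, hm⟩ := h
        refine le_csInf ⟨_, m, hm, rfl⟩ ?_
        rintro _ ⟨m', hm', rfl⟩
        exact Nat.mul_le_mul_left _ (Nat.sInf_le hm')

theorem volume_segment (t : ℝ≥0∞) : volume {s : ℝ | 0 < s ∧ ENNReal.ofReal s ≤ t} = t := by
  by_cases h : t = ⊤
  · subst h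
    have : {s : ℝ | 0 < s ∧ ENNReal.ofReal s ≤ ⊤} = Set.Ioi 0 := by ext; simp
    rw [this, Real.volume_Ioi]
  · have : {s : ℝ | 0 < s ∧ ENNReal.ofReal s ≤ t} = Set.Ioc 0 t.toReal := by
      ext s
      simp only [Set.mem_ofPred_eq, Set.mem_Ioc, ENNReal.ofReal_le_iff_le_toReal h]
    rw [this, Real.volume_Ioc, sub_zero, ENNReal.ofReal_toReal h]

theorem measurableSet_segment (t : ℝ≥0∞) :
    MeasurableSet {s : ℝ | 0 < s ∧ ENNReal.ofReal s ≤ t} :=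
  measurableSet_Ioi.inter (ENNReal.measurable_ofReal measurableSet_Iic)

theorem branchContact_of_index_eq_one {P : Ideal PS} {t : ℝ≥0∞}
    (h : ∀ s ≤ t, branchIndex P s = 1) : branchContact P t = t := by
  rw [branchContact, setLIntegral_congr_fun (g := fun _ => 1) (measurableSet_segment t)]
  · rw [setLIntegral_one, volume_segment]
  · rintro s ⟨-, hs⟩
    simp [h _ hs]

theorem branchContact_one (φ : Transversal) (t : ℝ≥0∞) : branchContact (arcIdeal 1 φ) t = t :=
  branchContact_of_index_eq_one fun _ _ => branchIndex_one φ _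

/-- The contact complexity function of the image of a branch. -/
theorem branchContact_comap {P : Ideal PS} (hP : IsArc P) (φ : Transversal) (w : Weight) {a : ℂ}
    (ha : a ≠ 0) (t : ℝ≥0∞) : branchContact (P.comap (pullback φ w a)) t =
      if t ≤ w.slope then t else branchContact P (w.up t) / (w.c : ℝ≥0∞) ^ 2 + w.slope := by
  split_ifs with ht
  · exact branchContact_of_index_eq_one fun s hs => by
      rw [branchIndex_comap hP φ w ha, if_pos (hs.trans ht)]
  have ht' := (not_le.1 ht).le
  have hcR : (0 : ℝ) < w.c := by exact_mod_cast w.c_pos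
  set f : ℝ → ℝ := fun s => (s + w.d) / w.c with hf
  have hder : ∀ s, HasDerivAt f ((w.c : ℝ)⁻¹) s := fun s => by
    have := ((hasDerivAt_id s).add_const (w.d : ℝ)).div_const (w.c : ℝ)
    simpa [one_div] using this
  have hinj : Function.Injective f := fun x y h => by
    have := (div_left_inj' hcR.ne').1 h
    linarith
  -- Beyond the exponent `d / c`, substitute `s = (s' + d) / c` in the integral.
  have himg : {s : ℝ | 0 < s ∧ ENNReal.ofReal s ≤ t} =
      {s : ℝ | 0 < s ∧ ENNReal.ofReal s ≤ w.slope} ∪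
        f '' {s : ℝ | 0 < s ∧ ENNReal.ofReal s ≤ w.up t} := by
    ext s
    constructor
    · rintro ⟨h0, hs⟩
      rcases le_or_gt (ENNReal.ofReal s) w.slope with h | h
      · exact Or.inl ⟨h0, h⟩
      · right
        rw [← w.ofReal_slope, ENNReal.ofReal_lt_ofReal_iff h0, div_lt_iff₀ hcR] at h
        refine ⟨s * w.c - w.d, ⟨by linarith, ?_⟩, ?_⟩
        · rw [← w.down_le_iff ht', w.down_ofReal (by linarith)]
          convert hs using 2
          field_simp; ring
        · simp only [hf]; field_simp; ring
    · rintro (⟨h0, hs⟩ | ⟨s', ⟨h0, hs⟩, rfl⟩)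
      · exact ⟨h0, hs.trans ht'⟩
      · refine ⟨by simp only [hf]; positivity, ?_⟩
        rw [hf, ← w.down_ofReal h0.le, w.down_le_iff ht']
        exact hs
  have hdisj : Disjoint {s : ℝ | 0 < s ∧ ENNReal.ofReal s ≤ w.slope}
      (f '' {s : ℝ | 0 < s ∧ ENNReal.ofReal s ≤ w.up t}) := by
    rw [Set.disjoint_left]
    rintro _ ⟨-, h1⟩ ⟨s', ⟨h0, -⟩, rfl⟩
    rw [hf, ← w.down_ofReal h0.le, ← w.down_zero, w.down_strictMono.le_iff_le] at h1
    exact absurd h1 (by simpa using h0)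
  have hmeas : MeasurableSet (f '' {s : ℝ | 0 < s ∧ ENNReal.ofReal s ≤ w.up t}) :=
    (measurableSet_segment _).image_of_continuousOn_injOn
      (fun s _ => (hder s).continuousAt.continuousWithinAt) hinj.injOn
  rw [branchContact, himg, lintegral_union hmeas hdisj, add_comm,
    lintegral_image_eq_lintegral_abs_deriv_mul (measurableSet_segment _)
      (fun s _ => (hder s).hasDerivWithinAt) hinj.injOn]
  congr 1
  · rw [branchContact, ENNReal.div_eq_inv_mul, ← lintegral_const_mul' _ _ (by
      simpa using w.c_ne_zero)]
    refine setLIntegral_congr_fun (measurableSet_segment _) ?_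
    rintro s ⟨h0, hs⟩
    have h1 : ENNReal.ofReal (f s) = w.down (ENNReal.ofReal s) := (w.down_ofReal h0.le).symm
    have h2 : ¬ w.down (ENNReal.ofReal s) ≤ w.slope := by
      rw [← w.down_zero, w.down_strictMono.le_iff_le]
      simpa using h0
    simp only
    rw [h1, branchIndex_comap hP φ w ha, if_neg h2, w.up_down, abs_of_pos (by positivity),
      ENNReal.ofReal_inv_of_pos hcR, ENNReal.ofReal_natCast, Nat.cast_mul,
      ENNReal.mul_inv (Or.inl w.c_ne_zero) (Or.inl w.c_ne_top), ← mul_assoc, pow_two,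
      ENNReal.mul_inv (Or.inl w.c_ne_zero) (Or.inl w.c_ne_top)]
  · rw [setLIntegral_congr_fun (g := fun _ => 1) (measurableSet_segment _)]
    · rw [setLIntegral_one, volume_segment]
    · rintro s ⟨-, hs⟩
      simp [branchIndex_comap hP φ w ha, hs]

/-! ### The segments of the Eggers-Wall tree in terms of the execution -/

/-- The exponent of the point of slope `s` of the trunk of the cross `i`. -/
def Node.exponent : {f : PS} → {r : Run f} → Node r → ℝ≥0∞ → ℝ≥0∞
  | _, _, .top, s => s
  | _, _, .sub p i, s => p.w.down (i.exponent s)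

open Classical in
/-- Walk along the segment from the root to the end labelled by `label i`, up to the point of
exponent `e`: this is the list of the exponents of the points at which one leaves a trunk for
another one, followed by `e`. -/
def Node.breaks : {f : PS} → {r : Run f} → Node r → ℝ≥0∞ → List ℝ≥0∞
  | _, _, .top, e => [e]
  | _, _, .sub p i, e =>
      if e ≤ p.w.slope then [e] else p.w.slope :: (i.breaks (p.w.up e)).map p.w.down

open Classical in
/-- The slopes of the points listed in `Node.breaks`. -/
def Node.slopes : {f : PS} → {r : Run f} → Node r → ℝ≥0∞ → List ℝ≥0∞
  | _, _, .top, e => [e]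
  | _, _, .sub p i, e => if e ≤ p.w.slope then [e] else p.w.slope :: i.slopes (p.w.up e)

open Classical in
/-- The slope of the point of exponent `e` of the segment from the root to the end labelled by
`label i`. -/
def Node.slopeAt : {f : PS} → {r : Run f} → Node r → ℝ≥0∞ → ℝ≥0∞
  | _, _, .top, e => e
  | _, _, .sub p i, e => if e ≤ p.w.slope then e else i.slopeAt (p.w.up e)

/-- The exponents of the points at which one leaves a trunk for another one, on the segment from
the root to the end labelled by `label i`. -/
def Node.jumps : {f : PS} → {r : Run f} → Node r → Set ℝ≥0∞
  | _, _, .top => ∅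
  | _, _, .sub p i => insert p.w.slope (p.w.down '' i.jumps)

/-- The product of the denominators of the weights of the exceptional components preceding the
trunk of the cross `i`. -/
def Node.index : {f : PS} → {r : Run f} → Node r → ℕ
  | _, _, .top => 1
  | _, _, .sub p i => p.w.c * i.index

section

variable {f : PS} {h : ¬ IsCross f} {φ : Transversal} {root : Point (shear φ f) → ℂ}
  {root_pow : ∀ p, root p ^ p.w.c = p.v}
  {next : ∀ p : Point (shear φ f), Run (strictTransform (shear φ f) p.w (root p))}
  (p : Point (shear φ f)) (i : Node (next p))

theorem Node.exponent_top {f : PS} {r : Run f} (s : ℝ≥0∞) :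
    (Node.top (r := r)).exponent s = s := by cases r <;> rfl

theorem Node.exponent_sub (s : ℝ≥0∞) :
    (Node.sub (h := h) (root_pow := root_pow) p i).exponent s = p.w.down (i.exponent s) := rfl

theorem Node.breaks_top {f : PS} {r : Run f} (e : ℝ≥0∞) :
    (Node.top (r := r)).breaks e = [e] := by cases r <;> rfl

theorem Node.breaks_sub_of_le {e : ℝ≥0∞} (he : e ≤ p.w.slope) :
    (Node.sub (h := h) (root_pow := root_pow) p i).breaks e = [e] := by
  rw [Node.breaks, if_pos he]

theorem Node.breaks_sub_of_lt {e : ℝ≥0∞} (he : p.w.slope < e) :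
    (Node.sub (h := h) (root_pow := root_pow) p i).breaks e =
      p.w.slope :: (i.breaks (p.w.up e)).map p.w.down := by
  rw [Node.breaks, if_neg he.not_ge]

theorem Node.slopes_top {f : PS} {r : Run f} (e : ℝ≥0∞) :
    (Node.top (r := r)).slopes e = [e] := by cases r <;> rfl

theorem Node.slopes_sub_of_le {e : ℝ≥0∞} (he : e ≤ p.w.slope) :
    (Node.sub (h := h) (root_pow := root_pow) p i).slopes e = [e] := by
  rw [Node.slopes, if_pos he]

theorem Node.slopes_sub_of_lt {e : ℝ≥0∞} (he : p.w.slope < e) :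
    (Node.sub (h := h) (root_pow := root_pow) p i).slopes e =
      p.w.slope :: i.slopes (p.w.up e) := by
  rw [Node.slopes, if_neg he.not_ge]

theorem Node.slopeAt_top {f : PS} {r : Run f} (e : ℝ≥0∞) :
    (Node.top (r := r)).slopeAt e = e := by cases r <;> rfl

theorem Node.slopeAt_sub_of_le {e : ℝ≥0∞} (he : e ≤ p.w.slope) :
    (Node.sub (h := h) (root_pow := root_pow) p i).slopeAt e = e := by
  rw [Node.slopeAt, if_pos he]

theorem Node.slopeAt_sub_of_lt {e : ℝ≥0∞} (he : p.w.slope < e) :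
    (Node.sub (h := h) (root_pow := root_pow) p i).slopeAt e = i.slopeAt (p.w.up e) := by
  rw [Node.slopeAt, if_neg he.not_ge]

theorem Node.jumps_top {f : PS} {r : Run f} : (Node.top (r := r)).jumps = ∅ := by
  cases r <;> rfl

theorem Node.jumps_sub : (Node.sub (h := h) (root_pow := root_pow) p i).jumps =
    insert p.w.slope (p.w.down '' i.jumps) := rfl

theorem Node.index_top {f : PS} {r : Run f} : (Node.top (r := r)).index = 1 := by
  cases r <;> rfl

theorem Node.index_sub : (Node.sub (h := h) (root_pow := root_pow) p i).index =
    p.w.c * i.index := rfl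

end

theorem Weight.up_pos (w : Weight) {e : ℝ≥0∞} (h : w.slope < e) : 0 < w.up e := by
  rw [← w.down_lt_iff h.le, w.down_zero]; exact h

theorem Weight.slope_pos (w : Weight) : 0 < w.slope := pos_iff_ne_zero.2 w.slope_ne_zero

theorem Weight.down_pos (w : Weight) (e : ℝ≥0∞) : 0 < w.down e :=
  w.slope_pos.trans_le (w.slope_le_down e)

theorem Weight.slope_lt_down (w : Weight) {e : ℝ≥0∞} (h : 0 < e) : w.slope < w.down e := by
  rw [← w.down_zero]; exact w.down_strictMono h

section

variable {f : PS} {r : Run f}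

theorem Node.exponent_strictMono (i : Node r) : StrictMono i.exponent := by
  induction i with
  | top => intro a b h; simpa only [exponent_top] using h
  | sub p i ih => exact p.w.down_strictMono.comp ih

theorem Node.exponent_top_eq (i : Node r) : i.exponent ⊤ = ⊤ := by
  induction i with
  | top => exact exponent_top _
  | sub p i ih => rw [exponent_sub, ih, Weight.down_top]

theorem Weight.continuous_down (w : Weight) : Continuous w.down :=
  (ENNReal.continuous_div_const _ w.c_ne_zero).add continuous_const

theorem Weight.continuous_up (w : Weight) : Continuous w.up :=
  (ENNReal.continuous_sub_right _).comp (ENNReal.continuous_const_mul w.c_ne_top)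

theorem Node.continuous_exponent (i : Node r) : Continuous i.exponent := by
  induction i with
  | top => exact continuous_id.congr fun s => (exponent_top s).symm
  | sub p i ih => exact p.w.continuous_down.comp ih

theorem exists_label_top (r : Run f) :
    ∃ φ : Transversal, label (Node.top (r := r)) = arcIdeal 1 φ := by
  cases r with
  | finish h =>
    obtain ⟨φ, hφ⟩ := h.exists_arcIdeal
    exact ⟨φ, by rw [label_finish, hφ]⟩
  | step h φ root root_pow next => exact ⟨φ, label_top⟩

theorem isArc_label (i : Node r) : IsArc (label i) := exists_label_eq_arcIdeal i

end

section

variable {f : PS} {h : ¬ IsCross f} {φ : Transversal} {root : Point (shear φ f) → ℂ}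
  {root_pow : ∀ p, root p ^ p.w.c = p.v}
  {next : ∀ p : Point (shear φ f), Run (strictTransform (shear φ f) p.w (root p))}

theorem coincidence_label_sub_top (p : Point (shear φ f)) (i : Node (next p)) :
    coincidence (label (Node.sub (h := h) (root_pow := root_pow) p i))
      (label (Node.top (r := Run.step h φ root root_pow next))) = p.w.slope := by
  rw [label_sub, label_top, coincidence_comap_top (isArc_label i) φ p.w (p.ne_zero (root_pow p))]

theorem coincidence_label_top_sub (p : Point (shear φ f)) (i : Node (next p)) :
    coincidence (label (Node.top (r := Run.step h φ root root_pow next)))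
      (label (Node.sub (h := h) (root_pow := root_pow) p i)) = p.w.slope := by
  rw [coincidence_comm, coincidence_label_sub_top]

theorem coincidence_label_sub_sub (p : Point (shear φ f)) (i j : Node (next p)) :
    coincidence (label (Node.sub (h := h) (root_pow := root_pow) p i))
      (label (Node.sub (h := h) (root_pow := root_pow) p j)) =
        p.w.down (coincidence (label i) (label j)) := by
  rw [label_sub, label_sub,
    coincidence_comap (isArc_label i) (isArc_label j) φ p.w (p.ne_zero (root_pow p))]
  rfl

theorem coincidence_label_sub_sub_of_ne {p p' : Point (shear φ f)} (hp : p ≠ p')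
    (i : Node (next p)) (j : Node (next p')) :
    coincidence (label (Node.sub (h := h) (root_pow := root_pow) p i))
      (label (Node.sub (h := h) (root_pow := root_pow) p' j)) = min p.w.slope p'.w.slope := by
  rw [label_sub, label_sub]
  exact coincidence_comap_of_ne (isArc_label i) (isArc_label j) φ hp (root_pow p) (root_pow p')

end

/-- The slopes met on the segment of a branch only depend on the part of the segment which has
been walked along. -/
theorem Node.slopes_eq_of_le_coincidence {f : PS} {r : Run f} (i j : Node r) {e : ℝ≥0∞}
    (he : e ≤ coincidence (label i) (label j)) : i.slopes e = j.slopes e := by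
  induction i generalizing e with
  | top =>
    cases j with
    | top => rfl
    | sub p j =>
      rw [coincidence_label_top_sub] at he
      rw [slopes_top, slopes_sub_of_le _ _ he]
  | sub p i ih =>
    cases j with
    | top =>
      rw [coincidence_label_sub_top] at he
      rw [slopes_top, slopes_sub_of_le _ _ he]
    | sub p' j =>
      by_cases hp : p = p'
      · subst hp
        rcases le_or_gt e p.w.slope with h | h
        · rw [slopes_sub_of_le _ _ h, slopes_sub_of_le _ _ h]
        · rw [slopes_sub_of_lt _ _ h, slopes_sub_of_lt _ _ h, ih]
          rw [coincidence_label_sub_sub] at he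
          rw [← p.w.up_down (coincidence _ _)]
          exact p.w.up_mono he
      · rw [coincidence_label_sub_sub_of_ne hp, le_min_iff] at he
        rw [slopes_sub_of_le _ _ he.1, slopes_sub_of_le _ _ he.2]

/-! ### Formulas in terms of the list of slopes -/

/-- `∑ s_j / (c_1 ⋯ c_{j-1}) ^ k`, where `c_j` is the denominator of `s_j`. -/
def weightedSum (k : ℕ) : List ℝ≥0∞ → ℝ≥0∞
  | [] => 0
  | s :: l => s + weightedSum k l / (den s : ℝ≥0∞) ^ k

/-- The product of the denominators of all the elements of the list but the last one. -/
def denProd (l : List ℝ≥0∞) : ℕ := (l.dropLast.map den).prod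

theorem Weight.den_slope (w : Weight) : den w.slope = w.c := by
  have hmem : w.c ∈ {q : ℕ | 0 < q ∧ ∃ p : ℕ, w.slope = (p : ℝ≥0∞) / (q : ℝ≥0∞)} :=
    ⟨w.c_pos, w.d, rfl⟩
  apply le_antisymm (Nat.sInf_le hmem)
  refine le_csInf ⟨_, hmem⟩ ?_
  rintro q ⟨hq, p, hp⟩
  have hq0 : (q : ℝ≥0∞) ≠ 0 := by exact_mod_cast hq.ne'
  have h1 : (w.d : ℝ≥0∞) * q = p * w.c := by
    have h2 := w.c_mul_slope
    rw [hp] at h2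
    rw [← h2, mul_assoc, ENNReal.div_mul_cancel hq0 (ENNReal.natCast_ne_top _), mul_comm]
  have h2 : w.d * q = p * w.c := by exact_mod_cast h1
  exact Nat.le_of_dvd hq (w.coprime.dvd_of_dvd_mul_left ⟨p, by rw [h2, mul_comm]⟩)

theorem Weight.slope_add_up_div (w : Weight) {e : ℝ≥0∞} (h : w.slope ≤ e) :
    w.slope + w.up e / w.c = e := by
  rw [add_comm]; exact w.down_up h

theorem Node.slopes_ne_nil {f : PS} {r : Run f} (i : Node r) (e : ℝ≥0∞) : i.slopes e ≠ [] := by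
  cases i with
  | top => rw [slopes_top]; simp
  | sub p i =>
    rcases le_or_gt e p.w.slope with h | h
    · rw [slopes_sub_of_le _ _ h]; simp
    · rw [slopes_sub_of_lt _ _ h]; simp

theorem denProd_cons {s : ℝ≥0∞} {l : List ℝ≥0∞} (h : l ≠ []) :
    denProd (s :: l) = den s * denProd l := by
  rw [denProd, List.dropLast_cons_of_ne_nil h, List.map_cons, List.prod_cons, denProd]

theorem weightedSum_singleton (k : ℕ) (e : ℝ≥0∞) : weightedSum k [e] = e := by
  simp [weightedSum]

theorem denProd_singleton (e : ℝ≥0∞) : denProd [e] = 1 := by simp [denProd]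

section

variable {f : PS} {r : Run f}

theorem branchIndex_label (i : Node r) (e : ℝ≥0∞) :
    branchIndex (label i) e = denProd (i.slopes e) := by
  induction i generalizing e with
  | @top f r =>
    obtain ⟨φ, hφ⟩ := exists_label_top r
    rw [hφ, branchIndex_one, Node.slopes_top, denProd_singleton]
  | @sub f _ φ root root_pow next p i ih =>
    rw [label_sub, branchIndex_comap (isArc_label i) φ p.w (p.ne_zero (root_pow p))]
    split_ifs with h
    · rw [Node.slopes_sub_of_le _ _ h, denProd_singleton]
    · rw [Node.slopes_sub_of_lt _ _ (not_le.1 h), denProd_cons (Node.slopes_ne_nil _ _), ih,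
        Weight.den_slope]

theorem branchContact_label (i : Node r) (e : ℝ≥0∞) :
    branchContact (label i) e = weightedSum 2 (i.slopes e) := by
  induction i generalizing e with
  | @top f r =>
    obtain ⟨φ, hφ⟩ := exists_label_top r
    rw [hφ, branchContact_one, Node.slopes_top, weightedSum_singleton]
  | @sub f _ φ root root_pow next p i ih =>
    rw [label_sub, branchContact_comap (isArc_label i) φ p.w (p.ne_zero (root_pow p))]
    split_ifs with h
    · rw [Node.slopes_sub_of_le _ _ h, weightedSum_singleton]
    · rw [Node.slopes_sub_of_lt _ _ (not_le.1 h), weightedSum, ih, Weight.den_slope, add_comm]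

theorem Node.weightedSum_one_slopes (i : Node r) (e : ℝ≥0∞) :
    weightedSum 1 (i.slopes e) = e := by
  induction i generalizing e with
  | top => rw [slopes_top, weightedSum_singleton]
  | sub p i ih =>
    rcases le_or_gt e p.w.slope with h | h
    · rw [slopes_sub_of_le _ _ h, weightedSum_singleton]
    · rw [slopes_sub_of_lt _ _ h, weightedSum, ih, Weight.den_slope, pow_one,
        p.w.slope_add_up_div h.le]

theorem branchContact_label_strictMono (i : Node r) : StrictMono (branchContact (label i)) := by
  induction i with
  | @top f r =>
    obtain ⟨φ, hφ⟩ := exists_label_top r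
    intro a b hab
    rwa [hφ, branchContact_one, branchContact_one]
  | @sub f _ φ root root_pow next p i ih =>
    intro a b hab
    rw [label_sub, branchContact_comap (isArc_label i) φ p.w (p.ne_zero (root_pow p)),
      branchContact_comap (isArc_label i) φ p.w (p.ne_zero (root_pow p))]
    have hdiv : StrictMono fun x : ℝ≥0∞ => x / (p.w.c : ℝ≥0∞) ^ 2 + p.w.slope := fun x y hxy =>
      ENNReal.add_lt_add_right p.w.slope_ne_top (ENNReal.div_lt_div_right
        (pow_ne_zero _ p.w.c_ne_zero) (ENNReal.pow_ne_top p.w.c_ne_top) hxy)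
    split_ifs with h1 h2 h2
    · exact hab
    · have h3 := hdiv ((zero_le (a := branchContact (label i) 0)).trans_lt
        (ih (p.w.up_pos (not_le.1 h2))))
      simp only [ENNReal.zero_div, zero_add] at h3
      exact h1.trans_lt h3
    · exact absurd (hab.le.trans h2) h1
    · refine hdiv (ih ?_)
      rwa [← p.w.down_lt_iff (not_le.1 h2).le, p.w.down_up (not_le.1 h1).le]

theorem branchContact_zero (P : Ideal PS) : branchContact P 0 = 0 := by
  rw [branchContact]
  have : {s : ℝ | 0 < s ∧ ENNReal.ofReal s ≤ 0} = ∅ := by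
    ext s
    simp only [Set.mem_ofPred_eq, nonpos_iff_eq_zero, ENNReal.ofReal_eq_zero,
      Set.mem_empty_iff_false, iff_false, not_and, not_le, imp_self]
  rw [this, MeasureTheory.setLIntegral_empty]

theorem branchContact_comap_down {P : Ideal PS} (hP : IsArc P) (φ : Transversal) (w : Weight)
    {a : ℂ} (ha : a ≠ 0) (t : ℝ≥0∞) : branchContact (P.comap (pullback φ w a)) (w.down t) =
      branchContact P t / (w.c : ℝ≥0∞) ^ 2 + w.slope := by
  rw [branchContact_comap hP φ w ha, w.up_down]
  split_ifs with h
  · have h0 : t = 0 := by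
      rw [← w.down_zero, w.down_strictMono.le_iff_le] at h
      exact nonpos_iff_eq_zero.1 h
    rw [h0, branchContact_zero, w.down_zero, ENNReal.zero_div, zero_add]
  · rfl

end

/-! ### The Eggers-Wall tree of a family of parametrized branches -/

section

variable {𝓑 : Set (Ideal PS)}

/-- By the ultrametric property of the orders of coincidence, the relation which defines the
Eggers-Wall tree is already an equivalence relation. -/
theorem EWTree.mk_eq_mk_iff (h𝓑 : ∀ P ∈ 𝓑, IsArc P) {B B' : 𝓑} {t t' : ℝ≥0∞} :
    EWTree.mk B t = EWTree.mk B' t' ↔ t = t' ∧ t ≤ coincidence B.1 B'.1 := by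
  constructor
  · intro h
    have hequiv : Equivalence fun a b : (_ : 𝓑) × ℝ≥0∞ =>
        a.2 = b.2 ∧ a.2 ≤ coincidence a.1.1 b.1.1 :=
      { refl := fun a => ⟨rfl, by rw [(h𝓑 _ a.1.2).coincidence_self]; exact le_top⟩
        symm := fun {a b} hab => ⟨hab.1.symm, by rw [← hab.1, coincidence_comm]; exact hab.2⟩
        trans := fun {a b c} hab hbc => ⟨hab.1.trans hbc.1,
          (le_min hab.2 (hab.1 ▸ hbc.2)).trans
            ((h𝓑 _ a.1.2).min_coincidence_le (h𝓑 _ b.1.2) (h𝓑 _ c.1.2))⟩ }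
    have h1 := Quot.eqvGen_exact h
    rwa [hequiv.eqvGen_iff] at h1
  · rintro ⟨h1, h2⟩
    exact Quot.sound ⟨h1, h2⟩

theorem EWTree.exists_mk (Q : EWTree 𝓑) : ∃ (B : 𝓑) (t : ℝ≥0∞), Q = EWTree.mk B t := by
  induction Q using Quot.ind with
  | mk a => exact ⟨a.1, a.2, rfl⟩

theorem EWTree.exponent_mk (B : 𝓑) (t : ℝ≥0∞) : (EWTree.mk B t).exponent = t := rfl

theorem EWTree.mk_le_mk_iff (h𝓑 : ∀ P ∈ 𝓑, IsArc P) {B B' : 𝓑} {t t' : ℝ≥0∞} :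
    EWTree.le (EWTree.mk B t) (EWTree.mk B' t') ↔ t ≤ t' ∧ t ≤ coincidence B.1 B'.1 := by
  constructor
  · rintro ⟨C, s, s', hs, h1, h2⟩
    rw [mk_eq_mk_iff h𝓑] at h1 h2
    obtain ⟨rfl, h1⟩ := h1
    obtain ⟨rfl, h2⟩ := h2
    rw [coincidence_comm] at h2
    exact ⟨hs, (le_min h1 (hs.trans h2)).trans
      ((h𝓑 _ B.2).min_coincidence_le (h𝓑 _ C.2) (h𝓑 _ B'.2))⟩
  · rintro ⟨h1, h2⟩
    exact ⟨B', t, t', h1, (mk_eq_mk_iff h𝓑).2 ⟨rfl, h2⟩, rfl⟩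

theorem EWTree.le_refl (Q : EWTree 𝓑) : EWTree.le Q Q := by
  obtain ⟨B, t, rfl⟩ := Q.exists_mk
  exact ⟨B, t, t, le_rfl, rfl, rfl⟩

theorem EWTree.le_trans (h𝓑 : ∀ P ∈ 𝓑, IsArc P) {P Q R : EWTree 𝓑} (h1 : EWTree.le P Q)
    (h2 : EWTree.le Q R) : EWTree.le P R := by
  obtain ⟨B, t, rfl⟩ := P.exists_mk
  obtain ⟨B', t', rfl⟩ := Q.exists_mk
  obtain ⟨B'', t'', rfl⟩ := R.exists_mk
  rw [mk_le_mk_iff h𝓑] at *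
  exact ⟨h1.1.trans h2.1, (le_min h1.2 (h1.1.trans h2.2)).trans
    ((h𝓑 _ B.2).min_coincidence_le (h𝓑 _ B'.2) (h𝓑 _ B''.2))⟩

theorem EWTree.le_antisymm (h𝓑 : ∀ P ∈ 𝓑, IsArc P) {P Q : EWTree 𝓑} (h1 : EWTree.le P Q)
    (h2 : EWTree.le Q P) : P = Q := by
  obtain ⟨B, t, rfl⟩ := P.exists_mk
  obtain ⟨B', t', rfl⟩ := Q.exists_mk
  rw [mk_le_mk_iff h𝓑] at *
  exact (mk_eq_mk_iff h𝓑).2 ⟨h1.1.antisymm h2.1, h1.2⟩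

theorem EWTree.out_spec (h𝓑 : ∀ P ∈ 𝓑, IsArc P) (B : 𝓑) (t : ℝ≥0∞) :
    (Quot.out (EWTree.mk B t)).2 = t ∧
      t ≤ coincidence (Quot.out (EWTree.mk B t)).1.1 B.1 := by
  have h : EWTree.mk (Quot.out (EWTree.mk B t)).1 (Quot.out (EWTree.mk B t)).2 =
      EWTree.mk B t := Quot.out_eq (EWTree.mk B t)
  obtain ⟨h1, h2⟩ := (mk_eq_mk_iff h𝓑).1 h
  exact ⟨h1, h1.symm.le.trans h2⟩

end

section

variable {f : PS} {r : Run f}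

theorem isArc_of_mem_completion (hf : IsCurve f) : ∀ P ∈ completion r, IsArc P := by
  intro P hP
  rw [completion_eq r hf] at hP
  obtain ⟨i, rfl⟩ := hP
  exact isArc_label i

theorem label_mem_completion (hf : IsCurve f) (i : Node r) : label i ∈ completion r := by
  rw [completion_eq r hf]; exact ⟨i, rfl⟩

theorem exists_eq_label (hf : IsCurve f) (B : completion r) :
    ∃ i : Node r, B = ⟨label i, label_mem_completion hf i⟩ := by
  obtain ⟨B, hB⟩ := B
  have hB' := hB
  rw [completion_eq r hf] at hB'
  obtain ⟨i, rfl⟩ := hB'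
  exact ⟨i, rfl⟩

theorem EWTree.index_mk (hf : IsCurve f) (B : completion r) (t : ℝ≥0∞) :
    (EWTree.mk B t).index = branchIndex B.1 t := by
  obtain ⟨h1, h2⟩ := EWTree.out_spec (isArc_of_mem_completion hf) B t
  rw [EWTree.index, h1]
  generalize (Quot.out (EWTree.mk B t)).1 = B' at h2
  obtain ⟨i, rfl⟩ := exists_eq_label hf B
  obtain ⟨j, rfl⟩ := exists_eq_label hf B'
  rw [branchIndex_label, branchIndex_label, Node.slopes_eq_of_le_coincidence j i h2]

theorem EWTree.contact_mk (hf : IsCurve f) (B : completion r) (t : ℝ≥0∞) :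
    (EWTree.mk B t).contact = branchContact B.1 t := by
  obtain ⟨h1, h2⟩ := EWTree.out_spec (isArc_of_mem_completion hf) B t
  rw [EWTree.contact, h1]
  generalize (Quot.out (EWTree.mk B t)).1 = B' at h2
  obtain ⟨i, rfl⟩ := exists_eq_label hf B
  obtain ⟨j, rfl⟩ := exists_eq_label hf B'
  rw [branchContact_label, branchContact_label, Node.slopes_eq_of_le_coincidence j i h2]

end

/-! ### Segments of the fan tree -/

section

variable {f : PS} {h : ¬ IsCross f} {φ : Transversal} {root : Point (shear φ f) → ℂ}
  {root_pow : ∀ p, root p ^ p.w.c = p.v}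
  {next : ∀ p : Point (shear φ f), Run (strictTransform (shear φ f) p.w (root p))}

/-- The inclusion of the part of the fan tree which arises from the point `p` of the exceptional
divisor of the first Newton modification. -/
def FanTree.incl (p : Point (shear φ f)) :
    FanTree (next p) → FanTree (Run.step h φ root root_pow next) :=
  Quot.map (fun a => ⟨Node.sub p a.1, a.2⟩) fun _ _ hab => Glue.sub p hab

theorem FanTree.incl_pt (p : Point (shear φ f)) (i : Node (next p)) (s : ℝ≥0∞) :
    FanTree.incl (h := h) (root_pow := root_pow) p (FanTree.pt i s) =
      FanTree.pt (Node.sub p i) s := rfl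

theorem FanTree.pt_sub_top_zero (p : Point (shear φ f)) :
    FanTree.pt (Node.sub (h := h) (root_pow := root_pow) p (Node.top (r := next p))) 0 =
      FanTree.pt Node.top p.w.slope := Quot.sound (Glue.attach p)

theorem FanTree.incl_root (p : Point (shear φ f)) :
    FanTree.incl (h := h) (root_pow := root_pow) p (FanTree.root (next p)) =
      FanTree.pt Node.top p.w.slope := pt_sub_top_zero p

end

theorem FanTree.exists_pt {f : PS} {r : Run f} (P : FanTree r) :
    ∃ (i : Node r) (s : ℝ≥0∞), P = FanTree.pt i s := by
  induction P using Quot.ind with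
  | mk a => exact ⟨a.1, a.2, rfl⟩

open Classical in
/-- The point of exponent `e` of the segment which joins the root to the end of the trunk of the
cross `i`. -/
def Node.point : {f : PS} → {r : Run f} → Node r → ℝ≥0∞ → FanTree r
  | _, _, .top, e => FanTree.pt .top e
  | _, _, .sub p i, e =>
      if e ≤ p.w.slope then FanTree.pt .top e else FanTree.incl p (i.point (p.w.up e))

theorem Node.point_top {f : PS} {r : Run f} (e : ℝ≥0∞) :
    (Node.top (r := r)).point e = FanTree.pt .top e := by cases r <;> rfl

section

variable {f : PS} {h : ¬ IsCross f} {φ : Transversal} {root : Point (shear φ f) → ℂ}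
  {root_pow : ∀ p, root p ^ p.w.c = p.v}
  {next : ∀ p : Point (shear φ f), Run (strictTransform (shear φ f) p.w (root p))}
  (p : Point (shear φ f)) (i : Node (next p))

theorem Node.point_sub_of_le {e : ℝ≥0∞} (he : e ≤ p.w.slope) :
    (Node.sub (h := h) (root_pow := root_pow) p i).point e = FanTree.pt .top e := by
  rw [Node.point, if_pos he]

theorem Node.point_sub_of_lt {e : ℝ≥0∞} (he : p.w.slope < e) :
    (Node.sub (h := h) (root_pow := root_pow) p i).point e =
      FanTree.incl p (i.point (p.w.up e)) := by
  rw [Node.point, if_neg he.not_ge]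

end

section

variable {f : PS} {r : Run f}

theorem Node.point_zero (i : Node r) : i.point 0 = FanTree.root r := by
  cases i with
  | top => exact point_top _
  | sub p i => exact point_sub_of_le p i zero_le

theorem Node.point_exponent (i : Node r) (s : ℝ≥0∞) : i.point (i.exponent s) = FanTree.pt i s := by
  induction i generalizing s with
  | top => rw [exponent_top, point_top]
  | sub p i ih =>
    rw [exponent_sub]
    rcases eq_or_ne (i.exponent s) 0 with h | h
    · rw [h, p.w.down_zero, point_sub_of_le _ _ le_rfl, ← FanTree.incl_pt, ← ih, h, point_zero,
        FanTree.incl_root]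
    · rw [point_sub_of_lt _ _ (p.w.slope_lt_down (pos_iff_ne_zero.2 h)), p.w.up_down, ih,
        FanTree.incl_pt]

/-- The segments to the ends of two trunks coincide up to the order of coincidence of the
branches. -/
theorem Node.point_eq_of_le_coincidence (i j : Node r) {e : ℝ≥0∞}
    (he : e ≤ coincidence (label i) (label j)) : i.point e = j.point e := by
  induction i generalizing e with
  | top =>
    cases j with
    | top => rfl
    | sub p j =>
      rw [coincidence_label_top_sub] at he
      rw [point_top, point_sub_of_le _ _ he]
  | sub p i ih =>
    cases j with
    | top =>
      rw [coincidence_label_sub_top] at he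
      rw [point_top, point_sub_of_le _ _ he]
    | sub p' j =>
      by_cases hp : p = p'
      · subst hp
        rcases le_or_gt e p.w.slope with h | h
        · rw [point_sub_of_le _ _ h, point_sub_of_le _ _ h]
        · rw [point_sub_of_lt _ _ h, point_sub_of_lt _ _ h, ih]
          rw [coincidence_label_sub_sub] at he
          rw [← p.w.up_down (coincidence _ _)]
          exact p.w.up_mono he
      · rw [coincidence_label_sub_sub_of_ne hp, le_min_iff] at he
        rw [point_sub_of_le _ _ he.1, point_sub_of_le _ _ he.2]

/-- The trunk on which a point of a segment lies. -/
theorem Node.exists_point_eq (i : Node r) (e : ℝ≥0∞) : ∃ (j : Node r) (s : ℝ≥0∞),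
    i.point e = FanTree.pt j s ∧ j.exponent s = e ∧ e ≤ coincidence (label i) (label j) := by
  induction i generalizing e with
  | top =>
    exact ⟨.top, e, point_top e, exponent_top e, by
      rw [(isArc_label _).coincidence_self]; exact le_top⟩
  | sub p i ih =>
    rcases le_or_gt e p.w.slope with h | h
    · exact ⟨.top, e, point_sub_of_le _ _ h, exponent_top e, by rwa [coincidence_label_sub_top]⟩
    · obtain ⟨j, s, h1, h2, h3⟩ := ih (p.w.up e)
      refine ⟨.sub p j, s, ?_, ?_, ?_⟩
      · rw [point_sub_of_lt _ _ h, h1, FanTree.incl_pt]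
      · rw [exponent_sub, h2, p.w.down_up h.le]
      · rw [coincidence_label_sub_sub, ← p.w.down_up h.le]
        exact p.w.down_strictMono.monotone h3

end

theorem FanTree.incl_le {f : PS} {h : ¬ IsCross f} {φ : Transversal}
    {root : Point (shear φ f) → ℂ} {root_pow : ∀ p, root p ^ p.w.c = p.v}
    {next : ∀ p : Point (shear φ f), Run (strictTransform (shear φ f) p.w (root p))}
    (p : Point (shear φ f)) {P Q : FanTree (next p)} (hPQ : FanTree.le P Q) :
    FanTree.le (FanTree.incl (h := h) (root_pow := root_pow) p P) (FanTree.incl p Q) := by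
  refine Relation.ReflTransGen.lift _ ?_ _ _ hPQ
  rintro _ _ ⟨i, s, t, hst, rfl, rfl⟩
  exact ⟨.sub p i, s, t, hst, rfl, rfl⟩

section

variable {f : PS} {r : Run f}

theorem FanTree.pt_le_pt (i : Node r) {s t : ℝ≥0∞} (h : s ≤ t) :
    FanTree.le (FanTree.pt i s) (FanTree.pt i t) :=
  Relation.ReflTransGen.single ⟨i, s, t, h, rfl, rfl⟩

theorem Node.point_mono (i : Node r) {e e' : ℝ≥0∞} (h : e ≤ e') :
    FanTree.le (i.point e) (i.point e') := by
  induction i generalizing e e' with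
  | top => rw [point_top, point_top]; exact FanTree.pt_le_pt _ h
  | sub p i ih =>
    rcases le_or_gt e' p.w.slope with h1 | h1
    · rw [point_sub_of_le _ _ h1, point_sub_of_le _ _ (h.trans h1)]
      exact FanTree.pt_le_pt _ h
    · rw [point_sub_of_lt _ _ h1]
      rcases le_or_gt e p.w.slope with h2 | h2
      · rw [point_sub_of_le _ _ h2]
        refine (FanTree.pt_le_pt _ h2).trans ?_
        rw [← FanTree.incl_root, ← i.point_zero]
        exact FanTree.incl_le p (ih zero_le)
      · rw [point_sub_of_lt _ _ h2]
        exact FanTree.incl_le p (ih (p.w.up_mono h))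

/-- Glued points have the same image in the Eggers-Wall tree. -/
theorem Glue.exponent_eq {i j : Node r} {s t : ℝ≥0∞} (h : Glue i s j t) :
    i.exponent s = j.exponent t ∧ i.exponent s ≤ coincidence (label i) (label j) := by
  induction h with
  | attach p =>
    rw [Node.exponent_sub, Node.exponent_top, Node.exponent_top, p.w.down_zero,
      coincidence_label_sub_top]
    exact ⟨rfl, le_rfl⟩
  | sub p hg ih =>
    rw [Node.exponent_sub, Node.exponent_sub, coincidence_label_sub_sub, ih.1]
    exact ⟨rfl, p.w.down_strictMono.monotone (ih.1 ▸ ih.2)⟩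

/-! ### The identification of the two trees -/

/-- The identification of the fan tree with the Eggers-Wall tree. -/
def FanTree.toEW (hf : IsCurve f) : FanTree r → EWTree (completion r) :=
  Quot.lift (fun a => EWTree.mk ⟨label a.1, label_mem_completion hf a.1⟩ (a.1.exponent a.2))
    fun _ _ h => Quot.sound (Glue.exponent_eq h)

theorem FanTree.toEW_pt (hf : IsCurve f) (i : Node r) (s : ℝ≥0∞) : (FanTree.pt i s).toEW hf =
    EWTree.mk ⟨label i, label_mem_completion hf i⟩ (i.exponent s) := rfl

theorem Node.toEW_point (hf : IsCurve f) (i : Node r) (e : ℝ≥0∞) : (i.point e).toEW hf =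
    EWTree.mk ⟨label i, label_mem_completion hf i⟩ e := by
  obtain ⟨j, s, h1, h2, h3⟩ := i.exists_point_eq e
  rw [h1, FanTree.toEW_pt, h2, EWTree.mk_eq_mk_iff (isArc_of_mem_completion hf), coincidence_comm]
  exact ⟨rfl, h3⟩

theorem FanTree.toEW_bijective (hf : IsCurve f) :
    Function.Bijective (FanTree.toEW (r := r) hf) := by
  constructor
  · intro P Q hPQ
    obtain ⟨i, s, rfl⟩ := P.exists_pt
    obtain ⟨j, t, rfl⟩ := Q.exists_pt
    rw [toEW_pt, toEW_pt, EWTree.mk_eq_mk_iff (isArc_of_mem_completion hf)] at hPQ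
    rw [← i.point_exponent, ← j.point_exponent, ← hPQ.1]
    exact i.point_eq_of_le_coincidence j hPQ.2
  · intro Q
    obtain ⟨B, t, rfl⟩ := Q.exists_mk
    obtain ⟨i, rfl⟩ := exists_eq_label hf B
    exact ⟨i.point t, i.toEW_point hf t⟩

theorem FanTree.le_iff_toEW (hf : IsCurve f) (P Q : FanTree r) :
    FanTree.le P Q ↔ EWTree.le (P.toEW hf) (Q.toEW hf) := by
  constructor
  · intro h
    induction h with
    | refl => exact EWTree.le_refl _
    | tail _ h ih =>
      refine EWTree.le_trans (isArc_of_mem_completion hf) ih ?_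
      obtain ⟨i, s, t, hst, rfl, rfl⟩ := h
      exact ⟨_, _, _, i.exponent_strictMono.monotone hst, rfl, rfl⟩
  · rintro ⟨B, s, t, hst, h1, h2⟩
    obtain ⟨i, rfl⟩ := exists_eq_label hf B
    rw [← i.toEW_point hf] at h1 h2
    rw [(toEW_bijective hf).1 h1, (toEW_bijective hf).1 h2]
    exact i.point_mono hst

theorem FanTree.isLabelledIso_toEW (hf : IsCurve f) : IsLabelledIso (FanTree.toEW (r := r) hf) where
  bijective := toEW_bijective hf
  le_iff := le_iff_toEW hf
  map_root := by rw [FanTree.root, toEW_pt, EWTree.exponent_mk, Node.exponent_top]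
  map_end i := ⟨label_mem_completion hf i, by rw [toEW_pt, i.exponent_top_eq]⟩

end

theorem isCurve_next {f : PS} (hf : IsCurve f) {φ : Transversal} {root : Point (shear φ f) → ℂ}
    (root_pow : ∀ p, root p ^ p.w.c = p.v) (p : Point (shear φ f)) :
    IsCurve (strictTransform (shear φ f) p.w (root p)) :=
  (hf.shear φ).strictTransform p (root_pow p)

/-- A Newton modification acts on the exponents by `Weight.down`, and on the contact complexity as
in the definition of the natural embedding. -/
theorem FanTree.isCanonical_toEW {f : PS} (r : Run f) (hf : IsCurve f) :
    IsCanonical r (FanTree.toEW hf) := by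
  induction r with
  | finish h => exact fun s => ⟨label_mem_completion hf _, rfl⟩
  | step h φ root root_pow next ih =>
    refine ⟨fun s => ⟨label_mem_completion hf _, rfl⟩, fun p =>
      ⟨_, ih p (isCurve_next hf root_pow p), fun i s B t hB => ?_⟩⟩
    have hp := isCurve_next hf root_pow p
    obtain ⟨j, rfl⟩ := exists_eq_label hp B
    rw [toEW_pt, EWTree.mk_eq_mk_iff (isArc_of_mem_completion hp)] at hB
    obtain ⟨rfl, hB⟩ := hB
    have hj := label_mem_completion hf (Node.sub (h := h) (root_pow := root_pow) p j)
    have hlab := label_sub (h := h) (root_pow := root_pow) p j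
    refine ⟨hlab ▸ hj, p.w.down (i.exponent s), ?_, ?_⟩
    · rw [toEW_pt, EWTree.mk_eq_mk_iff (isArc_of_mem_completion hf)]
      refine ⟨rfl, ?_⟩
      simp only
      rw [← hlab, coincidence_label_sub_sub]
      exact p.w.down_strictMono.monotone hB
    · exact branchContact_comap_down (isArc_label j) φ p.w (p.ne_zero (root_pow p)) _

/-- The parametrization of the trunks determines the identification. -/
theorem FanTree.eq_toEW_of_isCanonical {f : PS} (r : Run f) (hf : IsCurve f)
    (Φ : FanTree r → EWTree (completion r)) (hΦ : IsCanonical r Φ) : Φ = FanTree.toEW hf := by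
  induction r with
  | finish h =>
    funext P
    obtain ⟨i, s, rfl⟩ := P.exists_pt
    cases i with
    | top => exact (hΦ s).2
  | step h φ root root_pow next ih =>
    funext P
    obtain ⟨i, s, rfl⟩ := P.exists_pt
    cases i with
    | top => exact (hΦ.1 s).2
    | sub p i =>
      have hp := isCurve_next hf root_pow p
      obtain ⟨Ψ, h1, h2⟩ := hΦ.2 p
      obtain rfl := ih p hp Ψ h1
      obtain ⟨hB, t', h3, h4⟩ := h2 i s _ _ (toEW_pt hp i s)
      have hinj := branchContact_label_strictMono
        (Node.sub (h := h) (root_pow := root_pow) p i)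
      rw [label_sub] at hinj
      have ht : t' = p.w.down (i.exponent s) := by
        apply hinj.injective
        rw [h4, branchContact_comap_down (isArc_label i) φ p.w (p.ne_zero (root_pow p))]
      rw [h3, ht, toEW_pt, EWTree.mk_eq_mk_iff (isArc_of_mem_completion hf)]
      refine ⟨rfl, ?_⟩
      simp only
      rw [← label_sub (h := h) (root_pow := root_pow) p i, (isArc_label _).coincidence_self]
      exact le_top

section

variable {f : PS} {r : Run f}

theorem Node.eq_top_of_isTop (i : Node r) (h : i.isTop) : i = .top := by
  cases i with
  | top => rfl
  | sub => exact absurd h (by simp [isTop])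

/-- The origin of a trunk other than the first one is the point at which the segments to two ends
separate. -/
theorem Node.exists_exponent_zero_eq_coincidence (i : Node r) (hi : ¬ i.isTop) :
    ∃ j : Node r, i.exponent 0 = coincidence (label i) (label j) := by
  induction i with
  | top => exact absurd (by cases ‹Run _› <;> trivial) hi
  | sub p i ih =>
    by_cases h : i.isTop
    · refine ⟨.top, ?_⟩
      rw [coincidence_label_sub_top, exponent_sub]
      rw [i.eq_top_of_isTop h, exponent_top, p.w.down_zero]
    · obtain ⟨j, hj⟩ := ih h
      exact ⟨.sub p j, by rw [exponent_sub, coincidence_label_sub_sub, hj]⟩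

/-- The marked points are determined by the ends and by the order: they are the root, the ends, and
infima of two ends. -/
theorem IsLabelledIso.eq_toEW_of_isMarked (hf : IsCurve f) {Φ : FanTree r → EWTree (completion r)}
    (hΦ : IsLabelledIso Φ) {P : FanTree r} (hP : P.IsMarked) : Φ P = P.toEW hf := by
  have harc := isArc_of_mem_completion (r := r) hf
  have hΨ := FanTree.isLabelledIso_toEW (r := r) hf
  have hend : ∀ i : Node r, Φ (FanTree.pt i ⊤) = (FanTree.pt i ⊤).toEW hf := fun i => by
    obtain ⟨_, h1⟩ := hΦ.map_end i
    obtain ⟨_, h2⟩ := hΨ.map_end i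
    rw [h1, h2]
  obtain ⟨i, rfl | rfl⟩ := hP
  · by_cases hi : i.isTop
    · obtain rfl := i.eq_top_of_isTop hi
      have h1 := hΦ.map_root
      have h2 := hΨ.map_root
      rw [FanTree.root] at h1 h2
      obtain ⟨B, t, hB⟩ := (Φ (FanTree.pt .top 0)).exists_mk
      obtain ⟨B', t', hB'⟩ := ((FanTree.pt (Node.top (r := r)) 0).toEW hf).exists_mk
      rw [hB, EWTree.exponent_mk] at h1
      rw [hB', EWTree.exponent_mk] at h2
      rw [hB, hB', EWTree.mk_eq_mk_iff harc, h1, h2]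
      exact ⟨rfl, zero_le⟩
    · obtain ⟨j, hj⟩ := i.exists_exponent_zero_eq_coincidence hi
      -- `pt i 0` is the infimum of the ends of the trunks of `i` and `j`
      have hli : FanTree.le (FanTree.pt i 0) (FanTree.pt i ⊤) := FanTree.pt_le_pt _ zero_le
      have hlj : FanTree.le (FanTree.pt i 0) (FanTree.pt j ⊤) := by
        rw [FanTree.le_iff_toEW hf, FanTree.toEW_pt, FanTree.toEW_pt, j.exponent_top_eq,
          EWTree.mk_le_mk_iff harc]
        exact ⟨le_top, hj.le⟩
      have hglb : ∀ Z : FanTree r, FanTree.le Z (FanTree.pt i ⊤) → FanTree.le Z (FanTree.pt j ⊤) →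
          FanTree.le Z (FanTree.pt i 0) := by
        intro Z h1 h2
        obtain ⟨k, s, rfl⟩ := Z.exists_pt
        rw [FanTree.le_iff_toEW hf, FanTree.toEW_pt, FanTree.toEW_pt,
          EWTree.mk_le_mk_iff harc] at h1 h2 ⊢
        refine ⟨?_, h1.2⟩
        rw [hj]
        refine (le_min ?_ h2.2).trans ((isArc_label i).min_coincidence_le (isArc_label k)
          (isArc_label j))
        rw [coincidence_comm]; exact h1.2
      obtain ⟨Z, hZ⟩ := hΦ.bijective.2 ((FanTree.pt i 0).toEW hf)
      obtain ⟨W, hW⟩ := hΨ.bijective.2 (Φ (FanTree.pt i 0))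
      apply EWTree.le_antisymm harc
      · rw [← hW, ← hΨ.le_iff]
        apply hglb
        · rw [hΨ.le_iff, hW, ← hend, ← hΦ.le_iff]; exact hli
        · rw [hΨ.le_iff, hW, ← hend, ← hΦ.le_iff]; exact hlj
      · rw [← hZ, ← hΦ.le_iff]
        apply hglb
        · rw [hΦ.le_iff, hZ, hend, ← hΨ.le_iff]; exact hli
        · rw [hΦ.le_iff, hZ, hend, ← hΨ.le_iff]; exact hlj
  · exact hend i

end

/-! ### The slope function along a segment -/

open Filter Topology MeasureTheory

/-- The exponent function of the Eggers-Wall tree, seen on the fan tree. -/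
def FanTree.exponent {f : PS} {r : Run f} : FanTree r → ℝ≥0∞ :=
  Quot.lift (fun a => a.1.exponent a.2) fun _ _ h => (Glue.exponent_eq h).1

section

variable {f : PS} {h : ¬ IsCross f} {φ : Transversal} {root : Point (shear φ f) → ℂ}
  {root_pow : ∀ p, root p ^ p.w.c = p.v}
  {next : ∀ p : Point (shear φ f), Run (strictTransform (shear φ f) p.w (root p))}

theorem FanTree.continuous_incl (p : Point (shear φ f)) :
    Continuous (FanTree.incl (h := h) (root_pow := root_pow) (next := next) p) := by
  refine continuous_coinduced_dom.2 ?_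
  refine continuous_sigma fun i => ?_
  exact continuous_coinduced_rng.comp
    (continuous_sigmaMk (σ := fun _ : Node (Run.step h φ root root_pow next) => ℝ≥0∞)
      (i := Node.sub p i))

end

section

variable {f : PS} {r : Run f}

theorem FanTree.exponent_pt (i : Node r) (s : ℝ≥0∞) :
    (FanTree.pt i s).exponent = i.exponent s := rfl

theorem FanTree.continuous_pt (i : Node r) : Continuous (FanTree.pt i) :=
  continuous_coinduced_rng.comp (continuous_sigmaMk (σ := fun _ : Node r => ℝ≥0∞) (i := i))

theorem FanTree.continuous_exponent : Continuous (FanTree.exponent (r := r)) := by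
  refine continuous_coinduced_dom.2 ?_
  exact continuous_sigma fun i => i.continuous_exponent

theorem Node.exponent_point (i : Node r) (e : ℝ≥0∞) : (i.point e).exponent = e := by
  obtain ⟨j, s, h1, h2, -⟩ := i.exists_point_eq e
  rw [h1, FanTree.exponent_pt, h2]

theorem Node.point_injective (i : Node r) : Function.Injective i.point := fun a b h => by
  rw [← i.exponent_point a, h, i.exponent_point]

theorem Node.continuous_point (i : Node r) : Continuous i.point := by
  classical
  induction i with
  | top => exact (FanTree.continuous_pt _).congr fun e => (point_top e).symm
  | @sub f h φ root root_pow next p i ih =>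
    have h1 : Continuous fun e => if e ≤ p.w.slope then
        FanTree.pt (Node.top (r := Run.step h φ root root_pow next)) e else
        FanTree.incl p (i.point (p.w.up e)) := by
      refine Continuous.if_le (FanTree.continuous_pt _)
        ((FanTree.continuous_incl p).comp (ih.comp p.w.continuous_up)) continuous_id
        continuous_const ?_
      rintro e rfl
      rw [p.w.up_slope, i.point_zero, FanTree.incl_root]
    refine h1.congr fun e => ?_
    split_ifs with he
    · rw [point_sub_of_le _ _ he]
    · rw [point_sub_of_lt _ _ (not_le.1 he)]

theorem FanTree.slp_pt (i : Node r) {s : ℝ≥0∞} (h : s ≠ 0) : (FanTree.pt i s).slp = s :=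
  if_neg h

theorem FanTree.slp_pt_zero (i : Node r) : (FanTree.pt i 0).slp = attachSlope i :=
  if_pos rfl

theorem FanTree.slp_root : (FanTree.root r).slp = 0 := by
  rw [FanTree.root, slp_pt_zero]
  cases r <;> simp [attachSlope]

end

theorem FanTree.slp_incl {f : PS} {h : ¬ IsCross f} {φ : Transversal}
    {root : Point (shear φ f) → ℂ} {root_pow : ∀ p, root p ^ p.w.c = p.v}
    {next : ∀ p : Point (shear φ f), Run (strictTransform (shear φ f) p.w (root p))}
    (p : Point (shear φ f)) {P : FanTree (next p)} (hP : P ≠ FanTree.root _) :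
    (FanTree.incl (h := h) (root_pow := root_pow) p P).slp = P.slp := by
  obtain ⟨i, s, rfl⟩ := P.exists_pt
  rw [FanTree.incl_pt]
  rcases eq_or_ne s 0 with rfl | hs
  · rw [slp_pt_zero, slp_pt_zero]
    have hi : ¬ i.isTop := fun hi => hP (by rw [i.eq_top_of_isTop hi]; rfl)
    rw [attachSlope, if_neg hi]
  · rw [slp_pt _ hs, slp_pt _ hs]

section

variable {f : PS} {r : Run f}

theorem Node.slp_point (i : Node r) (e : ℝ≥0∞) : (i.point e).slp = i.slopeAt e := by
  have htop : ∀ {f : PS} (r : Run f) (e : ℝ≥0∞),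
      (FanTree.pt (Node.top (r := r)) e).slp = e := by
    intro f r e
    rcases eq_or_ne e 0 with rfl | he
    · exact FanTree.slp_root
    · exact FanTree.slp_pt _ he
  induction i generalizing e with
  | top => rw [point_top, slopeAt_top, htop]
  | sub p i ih =>
    rcases le_or_gt e p.w.slope with h | h
    · rw [point_sub_of_le _ _ h, slopeAt_sub_of_le _ _ h, htop]
    · rw [point_sub_of_lt _ _ h, slopeAt_sub_of_lt _ _ h, FanTree.slp_incl, ih]
      intro h1
      rw [← i.point_zero] at h1
      exact (p.w.up_pos h).ne' (i.point_injective h1)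

theorem Node.slopeAt_zero (i : Node r) : i.slopeAt 0 = 0 := by
  rw [← slp_point, point_zero, FanTree.slp_root]

theorem Node.slopeAt_ne_zero (i : Node r) {e : ℝ≥0∞} (he : e ≠ 0) : i.slopeAt e ≠ 0 := by
  induction i generalizing e with
  | top => rwa [slopeAt_top]
  | sub p i ih =>
    rcases le_or_gt e p.w.slope with h | h
    · rwa [slopeAt_sub_of_le _ _ h]
    · rw [slopeAt_sub_of_lt _ _ h]
      exact ih (p.w.up_pos h).ne'

theorem Node.zero_notMem_jumps (i : Node r) : (0 : ℝ≥0∞) ∉ i.jumps := by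
  cases i with
  | top => rw [jumps_top]; exact Set.notMem_empty _
  | sub p i =>
    rw [jumps_sub]
    rintro (h | ⟨e, -, h⟩)
    · exact p.w.slope_ne_zero h.symm
    · exact (p.w.down_pos e).ne' h

theorem Node.jumps_finite (i : Node r) : i.jumps.Finite := by
  induction i with
  | top => rw [jumps_top]; exact Set.finite_empty
  | sub p i ih => rw [jumps_sub]; exact (ih.image _).insert _

theorem Node.continuousAt_slopeAt (i : Node r) {e : ℝ≥0∞} (he : e ∉ i.jumps) :
    ContinuousAt i.slopeAt e := by
  induction i generalizing e with
  | top => exact continuousAt_id.congr (Eventually.of_forall fun e => (slopeAt_top e).symm)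
  | sub p i ih =>
    rw [jumps_sub, Set.mem_insert_iff, not_or] at he
    rcases lt_or_gt_of_ne he.1 with h | h
    · refine continuousAt_id.congr ?_
      filter_upwards [Iio_mem_nhds h] with x hx
      exact (slopeAt_sub_of_le _ _ (le_of_lt hx)).symm
    · have h1 : p.w.up e ∉ i.jumps := fun h1 => he.2 ⟨_, h1, p.w.down_up h.le⟩
      have h2 : ContinuousAt (fun x => i.slopeAt (p.w.up x)) e :=
        ContinuousAt.comp (f := p.w.up) (g := i.slopeAt) (ih h1) p.w.continuous_up.continuousAt
      refine h2.congr ?_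
      filter_upwards [Ioi_mem_nhds h] with x hx
      exact (slopeAt_sub_of_lt _ _ hx).symm

theorem Weight.tendsto_up (w : Weight) {e : ℝ≥0∞} (he : w.slope ≤ e) :
    Tendsto w.up (𝓝[>] e) (𝓝[>] (w.up e)) := by
  refine tendsto_nhdsWithin_iff.2 ⟨w.continuous_up.continuousAt.mono_left nhdsWithin_le_nhds, ?_⟩
  filter_upwards [self_mem_nhdsWithin] with x hx
  have hx' : e < x := hx
  rw [Set.mem_Ioi, ← w.down_lt_iff (he.trans hx'.le), w.down_up he]
  exact hx'

/-- When one leaves a trunk, the slope starts again from `0`. -/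
theorem Node.tendsto_slopeAt (i : Node r) {e : ℝ≥0∞} (he : e ∈ i.jumps) :
    Tendsto i.slopeAt (𝓝[>] e) (𝓝 0) := by
  induction i generalizing e with
  | top => rw [jumps_top] at he; exact he.elim
  | sub p i ih =>
    have h1 : p.w.slope ≤ e ∧ Tendsto i.slopeAt (𝓝[>] (p.w.up e)) (𝓝 0) := by
      rw [jumps_sub] at he
      rcases he with rfl | ⟨x, hx, rfl⟩
      · refine ⟨le_rfl, ?_⟩
        rw [p.w.up_slope]
        have := i.continuousAt_slopeAt i.zero_notMem_jumps
        rw [ContinuousAt, i.slopeAt_zero] at this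
        exact this.mono_left nhdsWithin_le_nhds
      · refine ⟨p.w.slope_le_down x, ?_⟩
        rw [p.w.up_down]
        exact ih hx
    refine (h1.2.comp (p.w.tendsto_up h1.1)).congr' ?_
    filter_upwards [self_mem_nhdsWithin] with x hx
    exact (slopeAt_sub_of_lt _ _ (h1.1.trans_lt hx)).symm

end

/-! ### The points of discontinuity of the slope function -/

section

variable {f : PS} {r : Run f}

theorem FanTree.exists_eq_point (P : FanTree r) : ∃ (i : Node r) (e : ℝ≥0∞), P = i.point e := by
  obtain ⟨i, s, rfl⟩ := P.exists_pt
  exact ⟨i, _, (i.point_exponent s).symm⟩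

theorem Node.le_point_iff (hf : IsCurve f) (i : Node r) (e : ℝ≥0∞) (Q : FanTree r) :
    FanTree.le Q (i.point e) ↔ ∃ x ≤ e, Q = i.point x := by
  constructor
  · intro h
    obtain ⟨j, x, rfl⟩ := Q.exists_eq_point
    rw [FanTree.le_iff_toEW hf, toEW_point, toEW_point,
      EWTree.mk_le_mk_iff (isArc_of_mem_completion hf)] at h
    exact ⟨x, h.1, j.point_eq_of_le_coincidence i h.2⟩
  · rintro ⟨x, hx, rfl⟩
    exact i.point_mono hx

theorem Node.segment_point (hf : IsCurve f) (i : Node r) (e : ℝ≥0∞) :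
    (i.point e).segment = i.point '' Set.Iio e := by
  ext Q
  rw [FanTree.segment, Set.mem_ofPred_eq, i.le_point_iff hf]
  constructor
  · rintro ⟨⟨x, hx, rfl⟩, hne⟩
    exact ⟨x, lt_of_le_of_ne hx fun h => hne (by rw [h]), rfl⟩
  · rintro ⟨x, hx, rfl⟩
    exact ⟨⟨x, le_of_lt hx, rfl⟩, fun h => (ne_of_lt hx) (i.point_injective h)⟩

/-- The slope function is discontinuous exactly where the segment leaves a trunk for another one.
At the other points it is, along the segment, a continuous function of the exponent. -/
theorem Node.delta_point (hf : IsCurve f) (i : Node r) (e : ℝ≥0∞) :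
    (i.point e).delta = i.point '' (i.jumps ∩ Set.Iio e) := by
  ext Q
  rw [FanTree.delta, Set.mem_ofPred_eq, i.segment_point hf]
  constructor
  · rintro ⟨⟨x, hx, rfl⟩, hdisc⟩
    refine ⟨x, ⟨?_, hx⟩, rfl⟩
    by_contra hjump
    apply hdisc
    have h1 : ContinuousWithinAt (fun Q : FanTree r => i.slopeAt Q.exponent)
        (i.point '' Set.Iio e) (i.point x) := by
      refine ContinuousAt.continuousWithinAt ?_
      refine ContinuousAt.comp (g := i.slopeAt) ?_ FanTree.continuous_exponent.continuousAt
      rw [i.exponent_point]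
      exact i.continuousAt_slopeAt hjump
    refine h1.congr ?_ ?_
    · rintro _ ⟨y, -, rfl⟩
      rw [i.slp_point, i.exponent_point]
    · rw [i.slp_point, i.exponent_point]
  · rintro ⟨x, ⟨hjump, hx⟩, rfl⟩
    -- Along the new trunk the slope tends to `0`, which is not its value at the attaching point.
    refine ⟨⟨x, hx, rfl⟩, fun hcont => ?_⟩
    have hx' : x < e := hx
    have : (𝓝[>] x).NeBot := nhdsGT_neBot_of_exists_gt ⟨e, hx'⟩
    have h1 : Tendsto i.point (𝓝[>] x) (𝓝[i.point '' Set.Iio e] (i.point x)) := by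
      refine tendsto_nhdsWithin_iff.2
        ⟨i.continuous_point.continuousAt.mono_left nhdsWithin_le_nhds, ?_⟩
      filter_upwards [nhdsWithin_le_nhds (Iio_mem_nhds hx')] with y hy
      exact ⟨y, hy, rfl⟩
    have h2 : Tendsto i.slopeAt (𝓝[>] x) (𝓝 (i.slopeAt x)) := by
      rw [← i.slp_point x]
      exact (hcont.tendsto.comp h1).congr fun y => i.slp_point y
    refine i.slopeAt_ne_zero ?_ (tendsto_nhds_unique h2 (i.tendsto_slopeAt hjump))
    rintro rfl
    exact i.zero_notMem_jumps hjump

theorem Node.jumps_inter_Iio_of_le {h : ¬ IsCross f} {φ : Transversal}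
    {root : Point (shear φ f) → ℂ} {root_pow : ∀ p, root p ^ p.w.c = p.v}
    {next : ∀ p : Point (shear φ f), Run (strictTransform (shear φ f) p.w (root p))}
    (p : Point (shear φ f)) (i : Node (next p)) {e : ℝ≥0∞} (he : e ≤ p.w.slope) :
    (Node.sub (h := h) (root_pow := root_pow) p i).jumps ∩ Set.Iio e = ∅ := by
  rw [jumps_sub, Set.eq_empty_iff_forall_notMem]
  rintro x ⟨rfl | ⟨y, -, rfl⟩, hx⟩
  · exact absurd he (not_le.2 hx)
  · exact absurd (he.trans (p.w.slope_le_down y)) (not_le.2 hx)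

theorem Node.jumps_inter_Iio_of_lt {h : ¬ IsCross f} {φ : Transversal}
    {root : Point (shear φ f) → ℂ} {root_pow : ∀ p, root p ^ p.w.c = p.v}
    {next : ∀ p : Point (shear φ f), Run (strictTransform (shear φ f) p.w (root p))}
    (p : Point (shear φ f)) (i : Node (next p)) {e : ℝ≥0∞} (he : p.w.slope < e) :
    (Node.sub (h := h) (root_pow := root_pow) p i).jumps ∩ Set.Iio e =
      insert p.w.slope (p.w.down '' (i.jumps ∩ Set.Iio (p.w.up e))) := by
  ext x
  rw [jumps_sub]
  constructor
  · rintro ⟨rfl | ⟨y, hy, rfl⟩, hx⟩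
    · exact Or.inl rfl
    · exact Or.inr ⟨y, ⟨hy, (p.w.down_lt_iff he.le).1 hx⟩, rfl⟩
  · rintro (rfl | ⟨y, ⟨hy, hx⟩, rfl⟩)
    · exact ⟨Or.inl rfl, he⟩
    · exact ⟨Or.inr ⟨y, hy, rfl⟩, (p.w.down_lt_iff he.le).2 hx⟩

theorem Node.finprod_den_slopeAt (i : Node r) (e : ℝ≥0∞) :
    ∏ᶠ x ∈ i.jumps ∩ Set.Iio e, den (i.slopeAt x) = denProd (i.slopes e) := by
  induction i generalizing e with
  | top => rw [jumps_top, Set.empty_inter, finprod_mem_empty, slopes_top, denProd_singleton]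
  | sub p i ih =>
    rcases le_or_gt e p.w.slope with h | h
    · rw [jumps_inter_Iio_of_le _ _ h, finprod_mem_empty, slopes_sub_of_le _ _ h,
        denProd_singleton]
    · rw [jumps_inter_Iio_of_lt _ _ h, slopes_sub_of_lt _ _ h, denProd_cons (slopes_ne_nil _ _),
        finprod_mem_insert, slopeAt_sub_of_le _ _ le_rfl,
        finprod_mem_image p.w.down_strictMono.injective.injOn, ← ih]
      · congr 1
        refine finprod_mem_congr rfl fun x hx => ?_
        have hx0 : 0 < x := pos_iff_ne_zero.2 fun h0 => i.zero_notMem_jumps (h0 ▸ hx.1)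
        rw [slopeAt_sub_of_lt _ _ (p.w.slope_lt_down hx0), p.w.up_down]
      · rintro ⟨y, ⟨hy, -⟩, h1⟩
        rw [← p.w.down_zero] at h1
        exact i.zero_notMem_jumps (p.w.down_strictMono.injective h1 ▸ hy)
      · exact (i.jumps_finite.inter_of_left _).image _

/-! ### Chains of points of discontinuity -/

/-- The list `Node.breaks` is the increasing enumeration of the exponents of the points of
`δ_P ∪ {P}`. -/
theorem Node.breaks_pairwise (i : Node r) (e : ℝ≥0∞) : (i.breaks e).Pairwise (· < ·) ∧
    ∀ x, x ∈ i.breaks e ↔ x = e ∨ x ∈ i.jumps ∩ Set.Iio e := by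
  induction i generalizing e with
  | top =>
    rw [breaks_top, jumps_top, Set.empty_inter]
    exact ⟨List.pairwise_singleton _ _, fun x => by simp⟩
  | sub p i ih =>
    rcases le_or_gt e p.w.slope with h | h
    · rw [jumps_inter_Iio_of_le _ _ h, breaks_sub_of_le _ _ h]
      exact ⟨List.pairwise_singleton _ _, fun x => by simp⟩
    · rw [jumps_inter_Iio_of_lt _ _ h, breaks_sub_of_lt _ _ h]
      obtain ⟨h1, h2⟩ := ih (p.w.up e)
      refine ⟨List.pairwise_cons.2 ⟨?_, ?_⟩, fun x => ?_⟩
      · intro x hx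
        obtain ⟨y, hy, rfl⟩ := List.mem_map.1 hx
        refine p.w.slope_lt_down ?_
        rcases (h2 y).1 hy with rfl | ⟨hy, -⟩
        · exact p.w.up_pos h
        · exact pos_iff_ne_zero.2 fun h0 => i.zero_notMem_jumps (h0 ▸ hy)
      · exact h1.map _ fun a b hab => p.w.down_strictMono hab
      · rw [List.mem_cons, List.mem_map]
        constructor
        · rintro (rfl | ⟨y, hy, rfl⟩)
          · exact Or.inr (Or.inl rfl)
          · rcases (h2 y).1 hy with rfl | hy
            · exact Or.inl (p.w.down_up h.le)
            · exact Or.inr (Or.inr ⟨y, hy, rfl⟩)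
        · rintro (rfl | rfl | ⟨y, hy, rfl⟩)
          · exact Or.inr ⟨p.w.up x, (h2 _).2 (Or.inl rfl), p.w.down_up h.le⟩
          · exact Or.inl rfl
          · exact Or.inr ⟨y, (h2 _).2 (Or.inr hy), rfl⟩

theorem Node.map_slopeAt_breaks (i : Node r) (e : ℝ≥0∞) :
    (i.breaks e).map i.slopeAt = i.slopes e := by
  induction i generalizing e with
  | top => rw [breaks_top, slopes_top, List.map_singleton, slopeAt_top]
  | sub p i ih =>
    rcases le_or_gt e p.w.slope with h | h
    · rw [breaks_sub_of_le _ _ h, slopes_sub_of_le _ _ h, List.map_singleton,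
        slopeAt_sub_of_le _ _ h]
    · rw [breaks_sub_of_lt _ _ h, slopes_sub_of_lt _ _ h, List.map_cons,
        slopeAt_sub_of_le _ _ le_rfl, List.map_map, ← ih]
      congr 1
      refine List.map_congr_left fun x hx => ?_
      have hx0 : 0 < x := by
        rcases ((i.breaks_pairwise _).2 x).1 hx with rfl | ⟨hy, -⟩
        · exact p.w.up_pos h
        · exact pos_iff_ne_zero.2 fun h0 => i.zero_notMem_jumps (h0 ▸ hy)
      rw [Function.comp_apply, slopeAt_sub_of_lt _ _ (p.w.slope_lt_down hx0), p.w.up_down]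

/-- An increasing enumeration of the points of `δ_P ∪ {P}` is the enumeration by `Node.breaks`. -/
theorem Node.ofFn_slp_eq_slopes (hf : IsCurve f) (i : Node r) (e : ℝ≥0∞) {k : ℕ}
    {Q : Fin (k + 1) → FanTree r} (hinj : Function.Injective Q)
    (hle : ∀ a b, a ≤ b → FanTree.le (Q a) (Q b))
    (hrange : Set.range Q = insert (i.point e) (i.point e).delta) :
    List.ofFn (fun j => (Q j).slp) = i.slopes e := by
  have hQ : ∀ j, ∃ x, (x = e ∨ x ∈ i.jumps ∩ Set.Iio e) ∧ Q j = i.point x := by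
    intro j
    have hj : Q j ∈ Set.range Q := ⟨j, rfl⟩
    rw [hrange, i.delta_point hf] at hj
    rcases hj with hj | ⟨x, hx, hj⟩
    · exact ⟨e, Or.inl rfl, hj⟩
    · exact ⟨x, Or.inr hx, hj.symm⟩
  choose q hq hQq using hQ
  have hmono : StrictMono q := by
    refine Monotone.strictMono_of_injective (fun a b hab => ?_) fun a b hab =>
      hinj (by rw [hQq, hQq, hab])
    have h1 := hle a b hab
    rw [hQq, hQq, i.le_point_iff hf] at h1
    obtain ⟨x, hx, h2⟩ := h1
    rwa [i.point_injective h2]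
  have hlist : List.ofFn q = i.breaks e := by
    obtain ⟨h1, h2⟩ := i.breaks_pairwise e
    refine List.Perm.eq_of_pairwise (le := (· < ·)) (fun a b _ _ hab hba => absurd hba hab.not_gt)
      (List.pairwise_ofFn.2 fun a b hab => hmono hab) h1 ?_
    rw [List.perm_ext_iff_of_nodup (List.nodup_ofFn.2 hmono.injective)
      (h1.imp fun hab => hab.ne)]
    intro x
    rw [h2, List.mem_ofFn]
    constructor
    · rintro ⟨j, rfl⟩
      exact hq j
    · intro hx
      have hx' : i.point x ∈ Set.range Q := by
        rw [hrange, i.delta_point hf]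
        rcases hx with rfl | hx
        · exact Or.inl rfl
        · exact Or.inr ⟨x, hx, rfl⟩
      obtain ⟨j, hj⟩ := hx'
      exact ⟨j, i.point_injective (by rw [← hQq, hj])⟩
  rw [← i.map_slopeAt_breaks, ← hlist, List.map_ofFn]
  congr 1
  funext j
  rw [hQq, i.slp_point, Function.comp_apply]

theorem denProd_ofFn {k : ℕ} (s : Fin (k + 1) → ℝ≥0∞) :
    denProd (List.ofFn s) = ∏ i : Fin k, den (s i.castSucc) := by
  induction k with
  | zero => rw [List.ofFn_succ, List.ofFn_zero, denProd_singleton]; simp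
  | succ k ih =>
    rw [List.ofFn_succ, denProd_cons (by simp), ih, Fin.prod_univ_succ]
    rfl

theorem weightedSum_ofFn (m : ℕ) {k : ℕ} (s : Fin (k + 1) → ℝ≥0∞)
    (h : ∀ i : Fin k, den (s i.castSucc) ≠ 0) :
    weightedSum m (List.ofFn s) = ∑ j : Fin (k + 1),
      s j / ∏ i ∈ Finset.univ.filter (· < j), (den (s i) : ℝ≥0∞) ^ m := by
  induction k with
  | zero => rw [List.ofFn_succ, List.ofFn_zero, weightedSum_singleton]; simp
  | succ k ih =>
    rw [List.ofFn_succ, weightedSum, ih _ fun i => h i.succ, Fin.sum_univ_succ (n := k + 1)]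
    have h0 : ((den (s 0) : ℕ) : ℝ≥0∞) ^ m ≠ 0 := by
      refine pow_ne_zero _ ?_
      exact_mod_cast h 0
    have ht : ((den (s 0) : ℕ) : ℝ≥0∞) ^ m ≠ ⊤ := ENNReal.pow_ne_top (ENNReal.natCast_ne_top _)
    congr 1
    · simp
    · rw [div_eq_mul_inv, Finset.sum_mul]
      refine Finset.sum_congr rfl fun j _ => ?_
      rw [div_eq_mul_inv, div_eq_mul_inv, mul_assoc]
      congr 1
      have hset : (Finset.univ.filter (· < j.succ) : Finset (Fin (k + 2))) =
          insert 0 ((Finset.univ.filter (· < j)).map (Fin.succEmb (k + 1))) := by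
        ext x
        refine Fin.cases ?_ (fun y => ?_) x
        · simp
        · simp [Fin.succ_ne_zero]
      rw [hset, Finset.prod_insert (by simp [Fin.succ_ne_zero]), Finset.prod_map,
        ENNReal.mul_inv (Or.inl h0) (Or.inl ht), mul_comm]
      rfl

end

/-! ### Integration along a segment of the fan tree -/

open MeasureTheory

section

variable {f : PS} {r : Run f}

theorem Node.denProd_slopes_ne_zero (i : Node r) (e : ℝ≥0∞) : denProd (i.slopes e) ≠ 0 := by
  induction i generalizing e with
  | top => rw [slopes_top, denProd_singleton]; exact one_ne_zero
  | sub p i ih =>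
    rcases le_or_gt e p.w.slope with h | h
    · rw [slopes_sub_of_le _ _ h, denProd_singleton]; exact one_ne_zero
    · rw [slopes_sub_of_lt _ _ h, denProd_cons (slopes_ne_nil _ _), Weight.den_slope]
      exact Nat.mul_ne_zero p.w.c_pos.ne' (ih _)

/-- The index is constant in the interior of a trunk. -/
theorem Node.denProd_slopes_exponent (i : Node r) {s : ℝ≥0∞} (hs : 0 < s) :
    denProd (i.slopes (i.exponent s)) = i.index := by
  induction i with
  | top => rw [slopes_top, denProd_singleton, index_top]
  | sub p i ih =>
    have h : 0 < i.exponent s := zero_le.trans_lt (i.exponent_strictMono hs)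
    rw [exponent_sub, slopes_sub_of_lt _ _ (p.w.slope_lt_down h),
      denProd_cons (slopes_ne_nil _ _), p.w.up_down, ih, index_sub, Weight.den_slope]

/-- The part of the trunk of `j` (without its origin) whose points have exponent at most `m`. -/
def Node.trunkPart (j : Node r) (m : ℝ≥0∞) : Set ℝ :=
  {s : ℝ | 0 < s ∧ j.exponent (ENNReal.ofReal s) ≤ m}

theorem Node.measurableSet_trunkPart (j : Node r) (m : ℝ≥0∞) :
    MeasurableSet (j.trunkPart m) :=
  measurableSet_Ioi.inter
    ((j.continuous_exponent.measurable.comp ENNReal.measurable_ofReal) measurableSet_Iic)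

theorem Node.volume_trunkPart_top (m : ℝ≥0∞) :
    volume ((Node.top (r := r)).trunkPart m) = m := by
  rw [trunkPart]
  simp only [exponent_top]
  exact volume_segment m

/-- The sum, over the trunks, of the integral of the power `-k` of the index with respect to the
slope on the part of the trunk contained in the segment of the branch of `i` up to the point
of exponent `e`. -/
def Node.indexIntegral (k : ℕ) (i : Node r) (e : ℝ≥0∞) : ℝ≥0∞ :=
  ∑' j : Node r, ((j.index : ℝ≥0∞) ^ k)⁻¹ *
    volume (j.trunkPart (min e (coincidence (label j) (label i))))

end

section

variable {f : PS} {h : ¬ IsCross f} {φ : Transversal} {root : Point (shear φ f) → ℂ}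
  {root_pow : ∀ p, root p ^ p.w.c = p.v}
  {next : ∀ p : Point (shear φ f), Run (strictTransform (shear φ f) p.w (root p))}

theorem Node.trunkPart_sub_of_le (p : Point (shear φ f)) (j : Node (next p)) {m : ℝ≥0∞}
    (hm : m ≤ p.w.slope) :
    (Node.sub (h := h) (root_pow := root_pow) p j).trunkPart m = ∅ := by
  rw [Set.eq_empty_iff_forall_notMem]
  rintro s ⟨h0, hs⟩
  rw [exponent_sub] at hs
  refine absurd (hs.trans hm) (not_le.2 (p.w.slope_lt_down ?_))
  exact zero_le.trans_lt (j.exponent_strictMono (ENNReal.ofReal_pos.2 h0))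

theorem Node.trunkPart_sub_of_le' (p : Point (shear φ f)) (j : Node (next p)) {m : ℝ≥0∞}
    (hm : p.w.slope ≤ m) :
    (Node.sub (h := h) (root_pow := root_pow) p j).trunkPart m = j.trunkPart (p.w.up m) := by
  ext s
  rw [trunkPart, trunkPart, Set.mem_ofPred_eq, Set.mem_ofPred_eq, exponent_sub,
    p.w.down_le_iff hm]

theorem Node.sub_injective (p : Point (shear φ f)) :
    Function.Injective (Node.sub (h := h) (root_pow := root_pow) (next := next) p) := by
  intro i j hij
  injection hij

open Classical in
/-- Only the first trunk and the trunks above the point `p` meet the segment. -/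
theorem Node.indexIntegral_sub (k : ℕ) (p : Point (shear φ f)) (i : Node (next p)) (e : ℝ≥0∞) :
    (Node.sub (h := h) (root_pow := root_pow) p i).indexIntegral k e =
      if e ≤ p.w.slope then e else
        p.w.slope + i.indexIntegral k (p.w.up e) / (p.w.c : ℝ≥0∞) ^ k := by
  have hc0 : (p.w.c : ℝ≥0∞) ^ k ≠ 0 := pow_ne_zero _ p.w.c_ne_zero
  have hct : (p.w.c : ℝ≥0∞) ^ k ≠ ⊤ := ENNReal.pow_ne_top p.w.c_ne_top
  set F : Node (Run.step h φ root root_pow next) → ℝ≥0∞ := fun j =>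
    ((j.index : ℝ≥0∞) ^ k)⁻¹ *
      volume (j.trunkPart (min e (coincidence (label j) (label (Node.sub p i))))) with hF
  have htop : F .top = min e p.w.slope := by
    simp only [hF]
    rw [index_top, volume_trunkPart_top, coincidence_label_top_sub]
    simp
  have hne : ∀ (p' : Point (shear φ f)) (j : Node (next p')), p' ≠ p → F (.sub p' j) = 0 := by
    intro p' j hp
    simp only [hF]
    rw [coincidence_label_sub_sub_of_ne hp,
      trunkPart_sub_of_le _ _ ((min_le_right _ _).trans (min_le_left _ _)), measure_empty, mul_zero]
  have hsum : (Node.sub (h := h) (root_pow := root_pow) p i).indexIntegral k e =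
      F .top + ∑' j : Node (next p), F (.sub p j) := by
    have h1 : ∑' j : Node (next p), F (.sub p j) =
        ∑' j, if j = Node.top then 0 else F j := by
      rw [← (Node.sub_injective (h := h) (root_pow := root_pow) p).tsum_eq]
      · refine tsum_congr fun j => ?_
        rw [if_neg (by simp)]
      · intro j hj
        rw [Function.mem_support] at hj
        cases j with
        | top => simp at hj
        | sub p' j =>
          by_cases hp : p' = p
          · subst hp; exact ⟨j, rfl⟩
          · rw [if_neg (by simp), hne p' j hp] at hj
            exact absurd rfl hj
    rw [h1, indexIntegral]
    exact ENNReal.tsum_eq_add_tsum_ite Node.top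
  rw [hsum, htop]
  split_ifs with he
  · have h0 : ∀ j : Node (next p), F (.sub p j) = 0 := by
      intro j
      simp only [hF]
      rw [trunkPart_sub_of_le _ _ ((min_le_left _ _).trans he), measure_empty, mul_zero]
    simp_rw [h0]
    rw [tsum_zero, add_zero, min_eq_left he]
  · have he' := (not_le.1 he).le
    rw [min_eq_right he', indexIntegral, ENNReal.div_eq_inv_mul, ← ENNReal.tsum_mul_left]
    congr 1
    refine tsum_congr fun j => ?_
    simp only [hF]
    rw [coincidence_label_sub_sub,
      trunkPart_sub_of_le' _ _ (le_min he' (p.w.slope_le_down _)), p.w.up_mono.map_min,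
      p.w.up_down, index_sub, Nat.cast_mul, mul_pow,
      ENNReal.mul_inv (Or.inl hc0) (Or.inl hct), mul_assoc]

end

section

variable {f : PS} {r : Run f}

theorem Node.indexIntegral_top (k : ℕ) (e : ℝ≥0∞) :
    (Node.top (r := r)).indexIntegral k e = e := by
  rw [indexIntegral, tsum_eq_single Node.top]
  · rw [index_top, volume_trunkPart_top, (isArc_label _).coincidence_self]
    simp
  · intro j hj
    cases j with
    | top => exact absurd rfl hj
    | sub p j =>
      rw [coincidence_label_sub_top, trunkPart_sub_of_le _ _ (min_le_right _ _), measure_empty,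
        mul_zero]

theorem Node.indexIntegral_eq (k : ℕ) (i : Node r) (e : ℝ≥0∞) :
    i.indexIntegral k e = weightedSum k (i.slopes e) := by
  induction i generalizing e with
  | top => rw [indexIntegral_top, slopes_top, weightedSum_singleton]
  | sub p i ih =>
    rw [indexIntegral_sub]
    split_ifs with h
    · rw [slopes_sub_of_le _ _ h, weightedSum_singleton]
    · rw [slopes_sub_of_lt _ _ (not_le.1 h), weightedSum, ih, Weight.den_slope]

theorem Node.index_toEW_point (hf : IsCurve f) (i : Node r) (e : ℝ≥0∞) :
    ((i.point e).toEW hf).index = denProd (i.slopes e) := by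
  rw [toEW_point, EWTree.index_mk hf, branchIndex_label]

theorem Node.contact_toEW_point (hf : IsCurve f) (i : Node r) (e : ℝ≥0∞) :
    ((i.point e).toEW hf).contact = weightedSum 2 (i.slopes e) := by
  rw [toEW_point, EWTree.contact_mk hf, branchContact_label]

theorem Node.integral_point (hf : IsCurve f) (k : ℕ) (i : Node r) (e : ℝ≥0∞) :
    FanTree.integral (fun Q => (((Q.toEW hf).index : ℝ≥0∞) ^ k)⁻¹) (i.point e) =
      weightedSum k (i.slopes e) := by
  rw [← i.indexIntegral_eq, FanTree.integral, indexIntegral]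
  refine tsum_congr fun j => ?_
  have hset : {s : ℝ | 0 < s ∧ FanTree.le (FanTree.pt j (ENNReal.ofReal s)) (i.point e)} =
      j.trunkPart (min e (coincidence (label j) (label i))) := by
    ext s
    rw [trunkPart, Set.mem_ofPred_eq, Set.mem_ofPred_eq, FanTree.le_iff_toEW hf, FanTree.toEW_pt,
      toEW_point, EWTree.mk_le_mk_iff (isArc_of_mem_completion hf), le_min_iff]
  rw [hset, setLIntegral_congr_fun (g := fun _ => ((j.index : ℝ≥0∞) ^ k)⁻¹)
    (j.measurableSet_trunkPart _), setLIntegral_const]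
  rintro s ⟨h0, -⟩
  simp only
  rw [← j.point_exponent, j.index_toEW_point hf,
    j.denProd_slopes_exponent (ENNReal.ofReal_pos.2 h0)]

end

end PlaneCurve

end

theorem proposition5p29 (f : PS) (hf : Squarefree f)
    (hf0 : MvPowerSeries.constantCoeff f = 0) (hL : ¬ (MvPowerSeries.X 0 : PS) ∣ f)
    (r : Run f) :
    (∀ (B : completion r) (t : ℝ≥0∞),
      (EWTree.mk B t).index = branchIndex B.1 t ∧
      (EWTree.mk B t).contact = branchContact B.1 t) ∧
    ∃ Ψ : FanTree r → EWTree (completion r),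
      IsLabelledIso Ψ ∧ IsCanonical r Ψ ∧
      (∀ Φ : FanTree r → EWTree (completion r), IsLabelledIso Φ →
        (∀ P : FanTree r, P.IsMarked → Φ P = Ψ P) ∧ (IsCanonical r Φ → Φ = Ψ)) ∧
      ∀ P : FanTree r,
        P.delta.Finite ∧
        (Ψ P).index = ∏ᶠ Q ∈ P.delta, den Q.slp ∧
        (Ψ P).exponent = FanTree.integral (fun Q => ((Ψ Q).index : ℝ≥0∞)⁻¹) P ∧
        (Ψ P).contact = FanTree.integral (fun Q => (((Ψ Q).index : ℝ≥0∞) ^ 2)⁻¹) P ∧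
        ∀ (k : ℕ) (Q : Fin (k + 1) → FanTree r), Function.Injective Q →
          (∀ i j, i ≤ j → FanTree.le (Q i) (Q j)) → Set.range Q = insert P P.delta →
          (Ψ P).index = ∏ i : Fin k, den (Q i.castSucc).slp ∧
          (Ψ P).exponent = ∑ j : Fin (k + 1),
            (Q j).slp / ∏ i ∈ Finset.univ.filter (· < j), (den (Q i).slp : ℝ≥0∞) ∧
          (Ψ P).contact = ∑ j : Fin (k + 1),
            (Q j).slp / ∏ i ∈ Finset.univ.filter (· < j), (den (Q i).slp : ℝ≥0∞) ^ 2 := by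
  have hC : IsCurve f := ⟨hf0, hL⟩
  refine ⟨fun B t => ⟨EWTree.index_mk hC B t, EWTree.contact_mk hC B t⟩, FanTree.toEW hC,
    FanTree.isLabelledIso_toEW hC, FanTree.isCanonical_toEW r hC,
    fun Φ hΦ => ⟨fun P hP => hΦ.eq_toEW_of_isMarked hC hP,
      FanTree.eq_toEW_of_isCanonical r hC Φ⟩, fun P => ?_⟩
  obtain ⟨i, e, rfl⟩ := P.exists_eq_point
  -- The exponent is the weighted sum of the slopes with `k = 1`.
  have hexp : (FanTree.toEW hC (i.point e)).exponent = weightedSum 1 (i.slopes e) := by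
    rw [i.weightedSum_one_slopes, i.toEW_point, EWTree.exponent_mk]
  refine ⟨?_, ?_, ?_, ?_, ?_⟩
  · rw [i.delta_point hC]
    exact (i.jumps_finite.inter_of_left _).image _
  · rw [i.index_toEW_point hC, i.delta_point hC, finprod_mem_image i.point_injective.injOn,
      ← i.finprod_den_slopeAt]
    exact finprod_mem_congr rfl fun x _ => by rw [i.slp_point]
  · rw [hexp, ← i.integral_point hC]
    simp only [pow_one]
  · rw [i.contact_toEW_point hC, i.integral_point hC]
  · intro k Q hinj hle hrange
    have hlist := i.ofFn_slp_eq_slopes hC e hinj hle hrange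
    have hden : denProd (i.slopes e) = ∏ j : Fin k, den (Q j.castSucc).slp := by
      rw [← hlist, denProd_ofFn]
    have hne : ∀ j : Fin k, den (Q j.castSucc).slp ≠ 0 := fun j =>
      Finset.prod_ne_zero_iff.1 (hden ▸ i.denProd_slopes_ne_zero e) j (Finset.mem_univ j)
    refine ⟨by rw [i.index_toEW_point hC, hden], ?_, ?_⟩
    · rw [hexp, ← hlist, weightedSum_ofFn 1 _ hne]
      simp only [pow_one]
    · rw [i.contact_toEW_point hC, ← hlist, weightedSum_ofFn 2 _ hne]
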